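/- Let $\theta>1$. Let $u^*$ be the unique positive root of $\theta\log(1+u^2)-u^2=0$, and put $$J_1=\int_1^{u^*}\frac{du}{\sqrt{\theta\log(1+u^2)-u^2}},$$ $$J_2=-\int_0^1\frac{\theta\,(\log(1+u^2)+\log(1-u^2))}{\sqrt{f(u)}\,\sqrt{g(u)}\,\bigl(\sqrt{f(u)}+\sqrt{g(u)}\bigr)}\,du,$$ where $f(u)=\theta\log(1+u^2)-u^2$, $g(u)=-\theta\log(1-u^2)-u^2$ and the square roots are principal complex square roots (the radicand $f$ is negative on $(u^*,1)$ if $u^*<1$). Put $$\alpha=J_1+J_2,\qquad \beta=\frac{\pi}{2\sqrt{\theta-1}}.$$ Then $\alpha$ is real and positive. Let $U:\mathbb{R}\to\mathbb{R}$ be the solitary wave, i.e. the even, positive $C^2$ solution of $U''+U-\dfrac{\theta U}{1+U^2}=0$ on $\mathbb{R}$ with $U(x)\to0$ as $x\to\pm\infty$. Let $$S=\{z\in\mathbb{C}:0\le\operatorname{Im}z\le2\beta\}\setminus\bigl([-\alpha+i\beta,-\alpha+2i\beta]\cup[\alpha+i\beta,\alpha+2i\beta]\bigr).$$ Then $U$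 extends from $\mathbb{R}$ to a single-valued function, again denoted $U$, that is analytic on $S$ (in a complex neighbourhood of each point of $S$), and (a) for every $0\le y\le2\beta$, $U(R+iy)\to0$ as $R\to+\infty$ and as $R\to-\infty$; (b) $U(x+2i\beta)=-U(x)$ for all real $x$ with $x<-\alpha$ or $x>\alpha$. -/

import Mathlib

open Filter Topology

namespace SaturableNLS

noncomputable section

/-- `f(u) = θ log(1 + u²) - u²` for real `u`. -/
def f (θ u : ℝ) : ℝ := θ * Real.log (1 + u ^ 2) - u ^ 2

/-- `g(u) = -θ log(1 - u²) - u²`, so that `f(iu) = -g(u)`. It is used for `0 < u < 1` only, where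
it is positive. -/
def g (θ u : ℝ) : ℝ := -θ * Real.log (1 - u ^ 2) - u ^ 2

/-- The positive root `u*` of `θ log(1 + u²) - u² = 0`. For `θ > 1` there is exactly one positive
root, so the set below is a singleton and the supremum picks its element. -/
def uStar (θ : ℝ) : ℝ := sSup {u : ℝ | 0 < u ∧ f θ u = 0}

/-- `J₁ = ∫_1^{u*} du / √(θ log(1 + u²) - u²)`. The square root is the principal complex one,
because the radicand is negative on the range of integration when `u* < 1`. -/
def J₁ (θ : ℝ) : ℂ := ∫ u in (1 : ℝ)..(uStar θ), 1 / Complex.sqrt (f θ u : ℂ)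

/-- `J₂ = -∫_0^1 θ (log(1 + u²) + log(1 - u²)) / (√f √g (√f + √g)) du`, with the principal complex
square root, because `f` is negative on `(u*, 1)` when `u* < 1`. -/
def J₂ (θ : ℝ) : ℂ :=
  -∫ u in (0 : ℝ)..1,
    ((θ * (Real.log (1 + u ^ 2) + Real.log (1 - u ^ 2)) : ℝ) : ℂ) /
      (Complex.sqrt (f θ u : ℂ) * Complex.sqrt (g θ u : ℂ) *
        (Complex.sqrt (f θ u : ℂ) + Complex.sqrt (g θ u : ℂ)))

/-- The real number `α = J₁ + J₂` (the sum is real, also when the two summands are not). -/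
def alpha (θ : ℝ) : ℝ := (J₁ θ + J₂ θ).re

/-- `β = π / (2 √(θ - 1))`. -/
def beta (θ : ℝ) : ℝ := Real.pi / (2 * Real.sqrt (θ - 1))

/-- The solitary wave: the even, positive solution of `u'' + u - θ u / (1 + u²) = 0` on the real
line that decays to zero at `±∞`. -/
structure IsSolitaryWave (θ : ℝ) (U : ℝ → ℝ) : Prop where
  contDiff : ContDiff ℝ 2 U
  ode : ∀ x : ℝ, deriv (deriv U) x + U x - θ * U x / (1 + U x ^ 2) = 0
  even : ∀ x : ℝ, U (-x) = U x
  pos : ∀ x : ℝ, 0 < U x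
  tendsto_atTop : Tendsto U atTop (𝓝 0)
  tendsto_atBot : Tendsto U atBot (𝓝 0)

/-- The closed vertical segment `[a + i b, a + 2 i b]`. -/
def verticalCut (a b : ℝ) : Set ℂ := {z : ℂ | z.re = a ∧ b ≤ z.im ∧ z.im ≤ 2 * b}

/-- The closed strip `0 ≤ Im z ≤ 2b` without the vertical cuts `[-a + i b, -a + 2 i b]` and
`[a + i b, a + 2 i b]`. -/
def cutStrip (a b : ℝ) : Set ℂ :=
  {z : ℂ | 0 ≤ z.im ∧ z.im ≤ 2 * b} \ (verticalCut (-a) b ∪ verticalCut a b)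

end

end SaturableNLS

/-! The energy of the solitary wave is zero, so `U' ^ 2 = f θ U`, and on `x > 0` the wave is
inverted by `z = ∫ du / √f` taken from `u` up to the crest `U 0 = u*`. The continuation of `U` is
the inverse of this integral for complex `u`, so the task is to find the exact image of the integral
as a conformal map.

Put `u = exp (-w)`. The closed fourth quadrant of the `u`-plane becomes the strip `0 ≤ Im w ≤ π /
2`, and `dz / dw = 1 / √(f / u²)`, which is `slope`. Since `log (1 + s) / s = ∫ dt / (1 + t s)` over
`[0, 1]`, the quotient `f / u²` lies in the upper half-plane inside the strip
(`im_log_one_add_div_ge`, `quotF_im_pos`). Hence `slope` lies in the open fourth quadrant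
(`slope_re_pos_im_neg`), and `Re Z` and `Im Z` are monotone in both coordinates of `w`. This gives
injectivity at once (`IsHodograph.injOn`). The same lower bound for `Im (f / u²)` makes the boundary
singularities integrable, so `Z` is continuous up to the boundary.

The edges go to explicit curves: `0 < u < u*` to the positive real axis, `u > u*` to the positive
imaginary axis, and `u = -i v` with `0 < v < 1` to the half-line `Im z = β`, `Re z > α`. The height
is `β` because `slope` tends to `1 / √(θ - 1)` at the far end of a strip of width `π / 2`
(`top_im`). The branch point `u = -i` goes to `α + i β`: `J₁` is the value of `Z` at `u = 1`, and
`J₂` integrates the variation of the difference of `Z` between the two edges (`J₁_add_J₂`).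

The remaining edge `v > 1` goes to a curve that leaves `α + i β` up and to the left, so the region
between it and the cut is still missing. It is covered by continuing across that edge in the
coordinate `p = i u`: below the real `p`-axis the continued `f` has negative imaginary part
(`contF_im_neg`), and the derivative again stays in one quadrant. The combined map `hodo` is
injective and proper over the quarter of the cut strip. Openness, properness and connectedness make
it onto, and its inverse is continuous up to the boundary (`exists_inverse`).

The inverse is real on the real and imaginary axes and purely imaginary on `Im z = β`, `Re z > α`.
Schwarz reflection, evenness and the rule `z ↦ -U (z - 2 i β)` then extend it to the whole cut strip
(`analyticOnNhd_reflectTop`). Continuity across each seam suffices for analyticity there, by a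
Morera argument. -/

namespace SaturableNLS

open MeasureTheory Set Complex
open scoped Interval

/-! ### Morera arguments across a line, and primitives on a closed strip -/

/-- The boundary integral of a rectangle is additive when the rectangle is cut horizontally. -/
theorem isConservativeOn_of_differentiableOn_off_line {F : ℂ → ℂ} {O : Set ℂ} (c : ℝ)
    (hc : ContinuousOn F O) (hd : ∀ z ∈ O, z.im ≠ c → DifferentiableAt ℂ F z) :
    IsConservativeOn F O := by
  rintro z w hzw
  have hzw' : [[z.re, w.re]] ×ℂ [[z.im, w.im]] ⊆ O := hzw
  rw [← add_eq_zero_iff_eq_neg, wedgeIntegral_add_wedgeIntegral_eq]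
  by_cases hmem : c ∈ [[z.im, w.im]]
  · have sub1 : [[z.im, c]] ⊆ [[z.im, w.im]] := uIcc_subset_uIcc_left hmem
    have sub2 : [[c, w.im]] ⊆ [[z.im, w.im]] := uIcc_subset_uIcc_right hmem
    -- On a rectangle whose interior misses the line, Cauchy's theorem needs only continuity on the
    -- edge that may lie on the line.
    have piece : ∀ a b : ℝ, [[a, b]] ⊆ [[z.im, w.im]] → c ∉ Ioo (min a b) (max a b) →
        (∫ x : ℝ in z.re..w.re, F (x + a * I)) - (∫ x : ℝ in z.re..w.re, F (x + b * I)) +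
        I • (∫ y : ℝ in a..b, F (w.re + y * I)) - I • (∫ y : ℝ in a..b, F (z.re + y * I)) = 0 := by
      intro a b hab hcab
      have := integral_boundary_rect_eq_zero_of_continuousOn_of_differentiableOn F
        (⟨z.re, a⟩ : ℂ) (⟨w.re, b⟩ : ℂ)
        (hc.mono fun x hx => hzw' ⟨hx.1, hab hx.2⟩)
        (fun x hx => (hd x (hzw' ⟨Ioo_subset_Icc_self hx.1, hab (Ioo_subset_Icc_self hx.2)⟩)
          (fun h => hcab (h ▸ hx.2))).differentiableWithinAt)
      simpa using this
    have p1 := piece z.im c sub1 (by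
      rintro ⟨h1, h2⟩
      rcases le_total z.im c with h | h
      · simp [max_eq_right h] at h2
      · simp [min_eq_right h] at h1)
    have p2 := piece c w.im sub2 (by
      rintro ⟨h1, h2⟩
      rcases le_total c w.im with h | h
      · simp [min_eq_left h] at h1
      · simp [max_eq_left h] at h2)
    have hint : ∀ x ∈ [[z.re, w.re]], ∀ a b : ℝ, [[a, b]] ⊆ [[z.im, w.im]] →
        IntervalIntegrable (fun y : ℝ => F (x + y * I)) volume a b := by
      intro x hx a b hab
      apply ContinuousOn.intervalIntegrable
      refine hc.comp (by fun_prop) ?_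
      intro y hy
      exact hzw' ⟨by simpa using hx, by simpa using hab hy⟩
    have e1 := intervalIntegral.integral_add_adjacent_intervals
      (hint w.re right_mem_uIcc _ _ sub1) (hint w.re right_mem_uIcc _ _ sub2)
    have e2 := intervalIntegral.integral_add_adjacent_intervals
      (hint z.re left_mem_uIcc _ _ sub1) (hint z.re left_mem_uIcc _ _ sub2)
    rw [← e1, ← e2, smul_add, smul_add]
    linear_combination p1 + p2
  · have := integral_boundary_rect_eq_zero_of_differentiableOn F z w
      (fun x hx => (hd x (hzw hx) (fun h => hmem (h ▸ hx.2))).differentiableWithinAt)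
    simpa using this

/-- A continuous function on an open set which is holomorphic off a horizontal line is
holomorphic. -/
theorem differentiableOn_of_off_horizontal_line {F : ℂ → ℂ} {O : Set ℂ} (hO : IsOpen O) (c : ℝ)
    (hc : ContinuousOn F O) (hd : ∀ z ∈ O, z.im ≠ c → DifferentiableAt ℂ F z) :
    DifferentiableOn ℂ F O :=
  (isConservativeOn_and_continuousOn_iff_isDifferentiableOn hO).1
    ⟨isConservativeOn_of_differentiableOn_off_line c hc hd, hc⟩

/-- A continuous function on an open set which is holomorphic off the imaginary axis is
holomorphic. -/
theorem differentiableOn_of_off_imaginary_axis {F : ℂ → ℂ} {O : Set ℂ} (hO : IsOpen O)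
    (hc : ContinuousOn F O) (hd : ∀ z ∈ O, z.re ≠ 0 → DifferentiableAt ℂ F z) :
    DifferentiableOn ℂ F O := by
  have hmul : Continuous fun z : ℂ => I * z := by fun_prop
  -- Multiplication by `I` interchanges the real and imaginary axes.
  have key := differentiableOn_of_off_horizontal_line (F := fun z => F (I * z))
    (O := (fun z : ℂ => I * z) ⁻¹' O) (hO.preimage hmul) 0
    (hc.comp hmul.continuousOn fun z hz => hz)
    (fun z hz hz0 => by
      have := hd (I * z) hz (by simpa using hz0)
      exact this.comp z (by fun_prop))
  intro z hz
  have hz' : I * (-I * z) = z := by rw [← mul_assoc]; simp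
  have h1 : DifferentiableAt ℂ (fun z => F (I * z)) (-I * z) :=
    (key (-I * z) (by show I * (-I * z) ∈ O; rwa [hz'])).differentiableAt
      ((hO.preimage hmul).mem_nhds (by show I * (-I * z) ∈ O; rwa [hz']))
  have h2 : DifferentiableAt ℂ (fun y => F (I * (-I * y))) z :=
    DifferentiableAt.comp (g := fun z => F (I * z)) (f := fun y => -I * y) z h1 (by fun_prop)
  have h3 : (fun y => F (I * (-I * y))) = F := by
    funext y; rw [← mul_assoc]; simp
  rw [h3] at h2
  exact h2.differentiableWithinAt

/-- A holomorphic function on an open strip whose growth at the boundary is integrable has a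
primitive which is continuous up to the boundary. -/
theorem exists_primitive_continuousOn_closed_strip {c : ℝ} (hc : 0 < c) {m : ℂ → ℂ}
    (hm : DifferentiableOn ℂ m {w | 0 < w.im ∧ w.im < c}) {C b : ℝ → ℝ} (hC : Continuous C)
    (hC0 : ∀ x, 0 ≤ C x) (hb0 : ∀ t, 0 ≤ b t)
    (hb : ∀ x y, IntervalIntegrable b volume x y)
    (hbound : ∀ w : ℂ, 0 < w.im → w.im < c → ‖m w‖ ≤ C w.re * b w.im) :
    ∃ Z : ℂ → ℂ, ContinuousOn Z {w | 0 ≤ w.im ∧ w.im ≤ c} ∧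
      ∀ w : ℂ, 0 < w.im → w.im < c → HasDerivAt Z (m w) w := by
  have hopen : IsOpen {w : ℂ | 0 < w.im ∧ w.im < c} :=
    (isOpen_lt continuous_const continuous_im).inter (isOpen_lt continuous_im continuous_const)
  have hconv : Convex ℝ {w : ℂ | 0 < w.im ∧ w.im < c} :=
    (convex_halfSpace_im_gt 0).inter (convex_halfSpace_im_lt c)
  obtain ⟨Z₀, hZ₀⟩ := hconv.exists_forall_hasDerivWithinAt hm
  replace hZ₀ : ∀ w : ℂ, 0 < w.im → w.im < c → HasDerivAt Z₀ (m w) w := fun w h1 h2 =>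
    (hZ₀ w ⟨h1, h2⟩).hasDerivAt (hopen.mem_nhds ⟨h1, h2⟩)
  have hmc : ∀ w : ℂ, 0 < w.im → w.im < c → ContinuousAt m w := fun w h1 h2 =>
    (hm.differentiableAt (hopen.mem_nhds ⟨h1, h2⟩)).continuousAt
  -- Extension by zero past the strip lets both endpoints `0` and `c` be interior points of the
  -- interval `(-1, c + 1)` used for domination.
  let Fm : ℝ → ℝ → ℂ := fun x => indicator (Ioo 0 c) fun t => m (x + t * I)
  have hmeas : ∀ x, Measurable (Fm x) := by
    intro x
    have : ContinuousOn (fun t : ℝ => m (x + t * I)) (Ioo 0 c) := by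
      intro t ht
      apply ContinuousAt.continuousWithinAt
      exact ContinuousAt.comp (f := fun t : ℝ => (x + t * I : ℂ))
        (hmc _ (by simpa using ht.1) (by simpa using ht.2)) (by fun_prop)
    have h2 := this.measurable_piecewise (g := fun _ => (0 : ℂ)) continuousOn_const
      measurableSet_Ioo
    convert h2 using 1
    funext t
    simp [Fm, indicator, piecewise]
  have hcont : ∀ x₀ t, ContinuousAt (fun x => Fm x t) x₀ := by
    intro x₀ t
    by_cases ht : t ∈ Ioo 0 c
    · simp only [Fm, indicator_of_mem ht]
      exact ContinuousAt.comp (f := fun x : ℝ => (x + t * I : ℂ))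
        (hmc _ (by simpa using ht.1) (by simpa using ht.2)) (by fun_prop)
    · simp only [Fm, indicator_of_notMem ht]
      exact continuousAt_const
  have hZ₀c : Continuous fun x : ℝ => Z₀ (x + (c / 2 : ℝ) * I) := by
    rw [continuous_iff_continuousAt]
    intro x
    refine ContinuousAt.comp (f := fun x : ℝ => (x + (c / 2 : ℝ) * I : ℂ))
      (hZ₀ _ ?_ ?_).continuousAt (by fun_prop) <;> simp <;> linarith
  have hpc : ∀ p : ℝ × ℝ, 0 ≤ p.2 → p.2 ≤ c →
      ContinuousAt (fun p : ℝ × ℝ => ∫ t in (c / 2)..p.2, Fm p.1 t) p := by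
    rintro ⟨x₀, y₀⟩ h1 h2
    simp only at h1 h2
    refine intervalIntegral.continuousAt_parametric_primitive_of_dominated
      (fun t => (C x₀ + 1) * b t) (-1) (c + 1)
      (fun x => (hmeas x).aestronglyMeasurable) ?_ ((hb _ _).const_mul _)
      (Eventually.of_forall fun t => hcont x₀ t) ⟨by linarith, by linarith⟩
      ⟨by linarith, by linarith⟩ (by simp)
    have : ∀ᶠ x in 𝓝 x₀, C x < C x₀ + 1 :=
      hC.continuousAt.eventually_lt continuousAt_const (by linarith)
    filter_upwards [this] with x hx
    refine Eventually.of_forall fun t => ?_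
    by_cases ht : t ∈ Ioo 0 c
    · simp only [Fm, indicator_of_mem ht]
      have := hbound (x + t * I) (by simpa using ht.1) (by simpa using ht.2)
      simp only [add_re, ofReal_re, mul_re, I_re, mul_zero, ofReal_im, I_im, mul_one, sub_self,
        add_zero, add_im, mul_im, zero_add] at this
      exact this.trans (mul_le_mul_of_nonneg_right hx.le (hb0 t))
    · simp only [Fm, indicator_of_notMem ht, norm_zero]
      exact mul_nonneg (by linarith [hC0 x₀]) (hb0 t)
  -- The primitive is rebuilt from its values on the middle line by vertical integration. Inside the
  -- strip this returns `Z₀`, and it also makes sense on the edges.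
  refine ⟨fun w => Z₀ (w.re + (c / 2 : ℝ) * I) + I * ∫ t in (c / 2)..w.im, Fm w.re t, ?_, ?_⟩
  · intro w hw
    apply ContinuousAt.continuousWithinAt
    refine ContinuousAt.add (ContinuousAt.comp (f := re) hZ₀c.continuousAt
      continuous_re.continuousAt) (continuousAt_const.mul ?_)
    exact ContinuousAt.comp (f := fun w : ℂ => (w.re, w.im)) (hpc (w.re, w.im) hw.1 hw.2)
      (by fun_prop)
  · intro w h1 h2
    refine (hZ₀ w h1 h2).congr_of_eventuallyEq ?_
    filter_upwards [hopen.mem_nhds ⟨h1, h2⟩] with v hv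
    have hsub : ∀ t ∈ [[c / 2, v.im]], 0 < t ∧ t < c := by
      intro t ht
      rcases le_total (c / 2) v.im with h | h
      · rw [uIcc_of_le h] at ht; exact ⟨by linarith [ht.1], by linarith [ht.2, hv.2]⟩
      · rw [uIcc_of_ge h] at ht; exact ⟨by linarith [ht.1, hv.1], by linarith [ht.2]⟩
    have e1 : ∫ t in (c / 2)..v.im, Fm v.re t = ∫ t in (c / 2)..v.im, m (v.re + t * I) :=
      intervalIntegral.integral_congr fun t ht => by
        simp only [Fm]
        rw [indicator_of_mem (show t ∈ Ioo 0 c from hsub t ht)]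
    have hder : ∀ t ∈ [[c / 2, v.im]],
        HasDerivAt (fun t : ℝ => Z₀ (v.re + t * I)) (I * m (v.re + t * I)) t := by
      intro t ht
      have h3 := hZ₀ (v.re + t * I) (by simpa using (hsub t ht).1) (by simpa using (hsub t ht).2)
      have h4 : HasDerivAt (fun t : ℝ => (v.re + t * I : ℂ)) I t := by
        simpa using ((ofRealCLM.hasDerivAt (x := t)).mul_const I).const_add (v.re : ℂ)
      have h5 := h3.comp t h4
      rwa [mul_comm] at h5
    have e2 := intervalIntegral.integral_eq_sub_of_hasDerivAt hder (by
      apply ContinuousOn.intervalIntegrable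
      intro t ht
      apply ContinuousAt.continuousWithinAt
      refine continuousAt_const.mul (ContinuousAt.comp (f := fun t : ℝ => (v.re + t * I : ℂ))
        (hmc _ ?_ ?_) (by fun_prop))
      · simpa using (hsub t ht).1
      · simpa using (hsub t ht).2)
    rw [e1, ← intervalIntegral.integral_const_mul, e2]
    simp

end SaturableNLS

namespace SaturableNLS

open MeasureTheory Set Complex
open scoped Interval

noncomputable section

/-! ### Branches of the logarithm and the Stieltjes bound -/

/-- The logarithm with argument in `[0, π]` on the closed upper half-plane. -/
def logUpper (z : ℂ) : ℂ := log (-I * z) + (Real.pi / 2 : ℝ) * I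

/-- The logarithm with argument in `[-π, 0]` on the closed lower half-plane. -/
def logLower (z : ℂ) : ℂ := log (I * z) - (Real.pi / 2 : ℝ) * I

theorem negI_mul_mem_slitPlane {z : ℂ} (hz : 0 ≤ z.im) (hz0 : z ≠ 0) : -I * z ∈ slitPlane := by
  rw [mem_slitPlane_iff]
  by_cases h : z.im = 0
  · right
    intro h1
    apply hz0
    apply Complex.ext
    · simpa using h1
    · simpa using h
  · left
    simpa using lt_of_le_of_ne hz (Ne.symm h)

theorem I_mul_mem_slitPlane {z : ℂ} (hz : z.im ≤ 0) (hz0 : z ≠ 0) : I * z ∈ slitPlane := by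
  have := negI_mul_mem_slitPlane (z := -z) (by simpa using hz) (by simpa using hz0)
  simpa using this

theorem differentiableAt_logUpper {z : ℂ} (hz : 0 ≤ z.im) (hz0 : z ≠ 0) :
    DifferentiableAt ℂ logUpper z := by
  unfold logUpper
  exact (DifferentiableAt.clog (by fun_prop) (negI_mul_mem_slitPlane hz hz0)).add_const _

theorem differentiableAt_logLower {z : ℂ} (hz : z.im ≤ 0) (hz0 : z ≠ 0) :
    DifferentiableAt ℂ logLower z := by
  unfold logLower
  exact (DifferentiableAt.clog (by fun_prop) (I_mul_mem_slitPlane hz hz0)).sub_const _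

theorem exp_pi_div_two_mul_I : exp ((Real.pi / 2 : ℝ) * I) = I := by
  rw [exp_mul_I, ← ofReal_cos, ← ofReal_sin]; simp

theorem exp_logUpper {z : ℂ} (hz0 : z ≠ 0) : exp (logUpper z) = z := by
  rw [logUpper, Complex.exp_add, exp_log (by simp [hz0]), exp_pi_div_two_mul_I]
  linear_combination (-z) * I_sq

theorem logUpper_im_mem {z : ℂ} (hz : 0 < z.im) :
    0 < (logUpper z).im ∧ (logUpper z).im < Real.pi := by
  have h1 : |arg (-I * z)| < Real.pi / 2 := by
    rw [abs_arg_lt_pi_div_two_iff]; left; simpa using hz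
  rw [abs_lt] at h1
  simp only [logUpper, add_im, log_im, im_ofReal_mul, I_im, mul_one]
  constructor <;> linarith [h1.1, h1.2]

/-- The principal logarithm agrees with any logarithm of imaginary part in `(-π, π]`. -/
theorem log_eq_of_exp_eq {a z : ℂ} (h : exp a = z) (h1 : -Real.pi < a.im) (h2 : a.im ≤ Real.pi) :
    log z = a := by rw [← h, log_exp h1 h2]

theorem logLower_eq_of_exp_eq {a z : ℂ} (h : exp a = z) (h1 : -(3 * Real.pi / 2) < a.im)
    (h2 : a.im ≤ Real.pi / 2) : logLower z = a := by
  have : log (I * z) = a + (Real.pi / 2 : ℝ) * I := by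
    apply log_eq_of_exp_eq
    · rw [Complex.exp_add, h, exp_pi_div_two_mul_I, mul_comm]
    · simp; linarith
    · simp; linarith
  rw [logLower, this]; ring

theorem logUpper_eq_of_exp_eq {a z : ℂ} (h : exp a = z) (h1 : -(Real.pi / 2) < a.im)
    (h2 : a.im ≤ 3 * Real.pi / 2) : logUpper z = a := by
  have : log (-I * z) = a - (Real.pi / 2 : ℝ) * I := by
    apply log_eq_of_exp_eq
    · rw [Complex.exp_sub, h, exp_pi_div_two_mul_I]; field_simp; simp
    · simp; linarith
    · simp; linarith
  rw [logUpper, this]; ring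

theorem logLower_eq_log {z : ℂ} (hz0 : z ≠ 0) (h : z.arg ≤ Real.pi / 2) : logLower z = log z := by
  apply logLower_eq_of_exp_eq (exp_log hz0)
  · rw [log_im]; linarith [neg_pi_lt_arg z, Real.pi_pos]
  · rwa [log_im]

theorem logLower_ofReal_pos {x : ℝ} (hx : 0 < x) : logLower x = Real.log x := by
  rw [logLower_eq_log (by exact_mod_cast hx.ne') (by rw [arg_ofReal_of_nonneg hx.le]; positivity),
    ofReal_log hx.le]

theorem logLower_neg_ofReal {x : ℝ} (hx : 0 < x) :
    logLower (-x) = Real.log x - Real.pi * I := by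
  apply logLower_eq_of_exp_eq
  · rw [Complex.exp_sub, exp_pi_mul_I, ofReal_log hx.le, exp_log (by exact_mod_cast hx.ne')]
    ring
  · simp; linarith [Real.pi_pos]
  · simp; linarith [Real.pi_pos]

theorem logUpper_ofReal_pos {x : ℝ} (hx : 0 < x) : logUpper x = Real.log x := by
  apply logUpper_eq_of_exp_eq
  · rw [ofReal_log hx.le, exp_log (by exact_mod_cast hx.ne')]
  · simp; positivity
  · simp; positivity

theorem logUpper_neg_ofReal {x : ℝ} (hx : 0 < x) :
    logUpper (-x) = Real.log x + Real.pi * I := by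
  apply logUpper_eq_of_exp_eq
  · rw [Complex.exp_add, exp_pi_mul_I, ofReal_log hx.le, exp_log (by exact_mod_cast hx.ne')]
    ring
  · simp; linarith [Real.pi_pos]
  · simp; linarith [Real.pi_pos]

/-- Lower bound for the imaginary part of the Stieltjes function `log (1 + s) / s` in the lower
half-plane. -/
theorem im_log_one_add_div_ge {s : ℂ} (hs : s.im < 0) :
    -s.im / (2 * (1 + ‖s‖) ^ 2) ≤ (log (1 + s) / s).im := by
  have hs0 : s ≠ 0 := by rintro rfl; simp at hs
  have hmem : ∀ t : ℝ, 0 ≤ t → 1 + t * s ∈ slitPlane := by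
    intro t ht
    rw [mem_slitPlane_iff]
    rcases ht.eq_or_lt with rfl | h
    · left; simp
    · right; simp; exact ⟨h.ne', hs.ne⟩
  -- This is the representation `log (1 + s) / s = ∫ dt / (1 + t s)` over `[0, 1]`.
  have hder : ∀ t ∈ [[(0 : ℝ), 1]],
      HasDerivAt (fun t : ℝ => log (1 + t * s) / s) ((1 + t * s)⁻¹) t := by
    intro t ht
    rw [uIcc_of_le zero_le_one] at ht
    have h4 : HasDerivAt (fun t : ℝ => (1 + t * s : ℂ)) s t := by
      simpa using ((ofRealCLM.hasDerivAt (x := t)).mul_const s).const_add (1 : ℂ)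
    have h5 := (h4.clog_real (hmem t ht.1)).div_const s
    rwa [div_right_comm, div_self hs0, one_div] at h5
  have hcont : ContinuousOn (fun t : ℝ => (1 + t * s : ℂ)⁻¹) [[(0 : ℝ), 1]] := by
    intro t ht
    rw [uIcc_of_le zero_le_one] at ht
    have h4 : ContinuousAt (fun t : ℝ => (1 + t * s : ℂ)) t := by fun_prop
    exact (h4.inv₀ (slitPlane_ne_zero (hmem t ht.1))).continuousWithinAt
  have hint := hcont.intervalIntegrable (μ := volume)
  have e := intervalIntegral.integral_eq_sub_of_hasDerivAt hder hint
  simp only [ofReal_one, one_mul, ofReal_zero, zero_mul, add_zero, log_one, zero_div, sub_zero] at e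
  rw [← e]
  have e2 : (∫ t in (0 : ℝ)..1, (1 + t * s : ℂ)⁻¹).im
      = ∫ t in (0 : ℝ)..1, ((1 + t * s : ℂ)⁻¹).im := by
    exact (imCLM.intervalIntegral_comp_comm hint).symm
  rw [e2]
  -- The integrand has imaginary part `t (-Im s) / |1 + t s|²`, and `|1 + t s| ≤ 1 + |s|`.
  -- Integrating `t` produces the factor `1 / 2`.
  have e3 : ∫ t in (0 : ℝ)..1, t * (-s.im / (1 + ‖s‖) ^ 2) = -s.im / (2 * (1 + ‖s‖) ^ 2) := by
    rw [intervalIntegral.integral_mul_const, integral_id]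
    field_simp; norm_num
  rw [← e3]
  apply intervalIntegral.integral_mono_on zero_le_one
  · exact (by fun_prop : Continuous fun t : ℝ => t * (-s.im / (1 + ‖s‖) ^ 2)).intervalIntegrable _ _
  · exact (continuous_im.comp_continuousOn hcont).intervalIntegrable
  · intro t ht
    rw [inv_im]
    simp only [add_im, one_im, im_ofReal_mul, zero_add]
    have hn : 0 < normSq (1 + t * s) := normSq_pos.2 (slitPlane_ne_zero (hmem t ht.1))
    have hle : normSq (1 + t * s) ≤ (1 + ‖s‖) ^ 2 := by
      rw [normSq_eq_norm_sq]
      have : ‖(1 : ℂ) + t * s‖ ≤ 1 + ‖s‖ := by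
        refine (norm_add_le _ _).trans ?_
        rw [norm_one, norm_mul, norm_real, Real.norm_of_nonneg ht.1]
        nlinarith [norm_nonneg s, ht.2]
      gcongr
    rw [show -(t * s.im) / normSq (1 + t * s) = t * (-s.im / normSq (1 + t * s)) by ring]
    apply mul_le_mul_of_nonneg_left _ ht.1
    apply div_le_div_of_nonneg_left _ hn hle
    linarith

/-! ### The integrand in the strip coordinate and its boundary values -/

/-- The open strip `0 < Im w < π / 2`. -/
def openStrip : Set ℂ := {w | 0 < w.im ∧ w.im < Real.pi / 2}

/-- The closed strip `0 ≤ Im w ≤ π / 2`. -/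
def closedStrip : Set ℂ := {w | 0 ≤ w.im ∧ w.im ≤ Real.pi / 2}

/-- The function `f (u) / u²` in the coordinate `u = exp (-w)`, on the closed strip. -/
def quotF (θ : ℝ) (w : ℂ) : ℂ := θ * logLower (1 + exp (-2 * w)) * exp (2 * w) - 1

/-- `dz / dw = 1 / √(f (u) / u²)` in the coordinate `u = exp (-w)`. -/
def slope (θ : ℝ) (w : ℂ) : ℂ := exp (-(logUpper (quotF θ w) / 2))

theorem exp_neg_two_mul_im (w : ℂ) :
    (exp (-2 * w)).im = -(Real.exp (-2 * w.re) * Real.sin (2 * w.im)) := by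
  rw [exp_im]; simp

theorem sin_two_mul_im_pos {w : ℂ} (hw : w ∈ openStrip) : 0 < Real.sin (2 * w.im) :=
  Real.sin_pos_of_pos_of_lt_pi (by linarith [hw.1]) (by linarith [hw.2])

theorem exp_neg_two_mul_im_neg {w : ℂ} (hw : w ∈ openStrip) : (exp (-2 * w)).im < 0 := by
  rw [exp_neg_two_mul_im]
  have := mul_pos (Real.exp_pos (-2 * w.re)) (sin_two_mul_im_pos hw)
  linarith

theorem exp_neg_two_mul_im_nonpos {w : ℂ} (hw : w ∈ closedStrip) : (exp (-2 * w)).im ≤ 0 := by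
  rw [exp_neg_two_mul_im]
  have := mul_nonneg (Real.exp_pos (-2 * w.re)).le
    (Real.sin_nonneg_of_nonneg_of_le_pi (x := 2 * w.im) (by linarith [hw.1]) (by linarith [hw.2]))
  linarith

/-- In the closed fourth quadrant `1 + u²` vanishes only at the branch point `u = -i`, which is `w =
i π / 2`. -/
theorem one_add_exp_ne_zero {w : ℂ} (hw : w ∈ closedStrip) (hne : w ≠ (Real.pi / 2 : ℝ) * I) :
    1 + exp (-2 * w) ≠ 0 := by
  intro h
  apply hne
  have h1 : exp (-2 * w) = -1 := by linear_combination h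
  have hn : ‖exp (-2 * w)‖ = 1 := by rw [h1]; simp
  rw [norm_exp, Real.exp_eq_one_iff] at hn
  have hre : w.re = 0 := by simpa using hn
  have h2 : (exp (-2 * w)).re = -1 := by rw [h1]; simp
  rw [exp_re] at h2
  simp [hre] at h2
  have him : w.im = Real.pi / 2 := by
    rcases lt_or_eq_of_le hw.2 with h3 | h3
    · have := Real.cos_lt_cos_of_nonneg_of_le_pi (x := 2 * w.im) (y := Real.pi)
        (by linarith [hw.1]) le_rfl (by linarith)
      rw [Real.cos_pi] at this
      linarith
    · exact h3
  apply Complex.ext <;> simp [hre, him]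

theorem differentiableAt_quotF (θ : ℝ) {w : ℂ} (hw : w ∈ closedStrip)
    (hne : w ≠ (Real.pi / 2 : ℝ) * I) : DifferentiableAt ℂ (quotF θ) w := by
  have h1 : DifferentiableAt ℂ (fun w => logLower (1 + exp (-2 * w))) w :=
    DifferentiableAt.comp (g := logLower) (f := fun w => 1 + exp (-2 * w)) w
      (differentiableAt_logLower (by simpa using exp_neg_two_mul_im_nonpos hw)
        (one_add_exp_ne_zero hw hne)) (by fun_prop)
  unfold quotF
  fun_prop

theorem quotF_eq_log {θ : ℝ} {w : ℂ} (hw : w ∈ openStrip) :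
    quotF θ w = θ * (log (1 + exp (-2 * w)) / exp (-2 * w)) - 1 := by
  have him := exp_neg_two_mul_im_neg hw
  rw [quotF, logLower_eq_log]
  · rw [show 2 * w = -(-2 * w) by ring, Complex.exp_neg]
    simp only [neg_mul]
    ring
  · intro h
    have := congrArg im h
    simp at this
    simp at him
    linarith
  · have : arg (1 + exp (-2 * w)) < 0 := by rw [arg_neg_iff]; simpa using him
    linarith [Real.pi_pos]

theorem quotF_im_ge {θ : ℝ} (hθ : 0 < θ) {w : ℂ} (hw : w ∈ openStrip) :
    θ * (Real.exp (-2 * w.re) * Real.sin (2 * w.im) / (2 * (1 + Real.exp (-2 * w.re)) ^ 2)) ≤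
      (quotF θ w).im := by
  have h := im_log_one_add_div_ge (exp_neg_two_mul_im_neg hw)
  rw [exp_neg_two_mul_im, neg_neg, norm_exp] at h
  rw [quotF_eq_log hw]
  simp only [sub_im, im_ofReal_mul, one_im, sub_zero]
  apply mul_le_mul_of_nonneg_left _ hθ.le
  simpa using h

theorem quotF_im_pos {θ : ℝ} (hθ : 0 < θ) {w : ℂ} (hw : w ∈ openStrip) : 0 < (quotF θ w).im := by
  refine lt_of_lt_of_le ?_ (quotF_im_ge hθ hw)
  have := sin_two_mul_im_pos hw
  positivity

theorem quotF_ofReal (θ x : ℝ) :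
    quotF θ x = ((θ * Real.log (1 + Real.exp (-2 * x)) * Real.exp (2 * x) - 1 : ℝ) : ℂ) := by
  have h : (1 + exp (-2 * (x : ℂ))) = ((1 + Real.exp (-2 * x) : ℝ) : ℂ) := by push_cast; ring_nf
  rw [quotF, h, logLower_ofReal_pos (by positivity)]
  push_cast; ring

theorem exp_neg_two_mul_top (x : ℝ) :
    exp (-2 * (x + (Real.pi / 2 : ℝ) * I)) = -(Real.exp (-2 * x) : ℝ) := by
  rw [show (-2 * (x + (Real.pi / 2 : ℝ) * I) : ℂ) = ((-2 * x : ℝ) : ℂ) - Real.pi * I by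
    push_cast; ring, Complex.exp_sub, exp_pi_mul_I]
  rw [ofReal_exp, div_neg, div_one]

theorem exp_two_mul_top (x : ℝ) :
    exp (2 * (x + (Real.pi / 2 : ℝ) * I)) = -(Real.exp (2 * x) : ℝ) := by
  rw [show (2 * (x + (Real.pi / 2 : ℝ) * I) : ℂ) = ((2 * x : ℝ) : ℂ) + Real.pi * I by
    push_cast; ring, Complex.exp_add, exp_pi_mul_I]
  simp

theorem quotF_top_of_pos (θ : ℝ) {x : ℝ} (hx : 0 < x) :
    quotF θ (x + (Real.pi / 2 : ℝ) * I) =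
      ((-θ * Real.log (1 - Real.exp (-2 * x)) * Real.exp (2 * x) - 1 : ℝ) : ℂ) := by
  have h0 : Real.exp (-2 * x) < 1 := by rw [Real.exp_lt_one_iff]; linarith
  have h : (1 + -((Real.exp (-2 * x) : ℝ) : ℂ)) = ((1 - Real.exp (-2 * x) : ℝ) : ℂ) := by
    push_cast; ring
  rw [quotF, exp_neg_two_mul_top, exp_two_mul_top, h, logLower_ofReal_pos (by linarith)]
  push_cast; ring

/-- At `u = -i v` with `v > 1` the number `1 - v²` is negative and its lower logarithm contributes
`-π i`; division by `u² = -v²` turns the sign. Since the result is positive, `slope` stays in the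
open fourth quadrant along this edge too. -/
theorem quotF_top_im_of_neg (θ : ℝ) {x : ℝ} (hx : x < 0) :
    (quotF θ (x + (Real.pi / 2 : ℝ) * I)).im = Real.pi * θ * Real.exp (2 * x) := by
  have h0 : 1 < Real.exp (-2 * x) := by rw [Real.one_lt_exp_iff]; linarith
  have h : (1 + -((Real.exp (-2 * x) : ℝ) : ℂ)) = -((Real.exp (-2 * x) - 1 : ℝ) : ℂ) := by
    push_cast; ring
  rw [quotF, exp_neg_two_mul_top, exp_two_mul_top, h, logLower_neg_ofReal (by linarith)]
  simp only [sub_im, mul_im, one_im, mul_re, sub_re, ofReal_re, ofReal_im, I_re, I_im, neg_re,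
    neg_im]
  ring

theorem quotF_top_pos {θ : ℝ} (hθ : 1 < θ) {x : ℝ} (hx : 0 < x) :
    0 < -θ * Real.log (1 - Real.exp (-2 * x)) * Real.exp (2 * x) - 1 := by
  have h0 : Real.exp (-2 * x) < 1 := by rw [Real.exp_lt_one_iff]; linarith
  have h1 := Real.log_le_sub_one_of_pos (x := 1 - Real.exp (-2 * x)) (by linarith)
  have h2 : Real.exp (-2 * x) * Real.exp (2 * x) = 1 := by
    rw [← Real.exp_add]; simp
  have h3 : 0 < Real.exp (2 * x) := Real.exp_pos _
  have h4 : 1 ≤ -Real.log (1 - Real.exp (-2 * x)) * Real.exp (2 * x) := by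
    nlinarith
  nlinarith

/-- The quotients are secant slopes of the strictly concave logarithm from the point `1`.
Consequently `f / u²` is strictly decreasing, which gives the uniqueness of `u*` and the sign of `f`
on either side of it. -/
theorem log_one_add_div_lt {a b : ℝ} (ha : 0 < a) (hab : a < b) :
    Real.log (1 + b) / b < Real.log (1 + a) / a := by
  have h := strictConcaveOn_log_Ioi.slope_anti_adjacent (x := 1) (y := 1 + a) (z := 1 + b)
    (by simp) (by simp; linarith) (by linarith) (by linarith)
  simp only [Real.log_one, sub_zero, add_sub_cancel_left, add_sub_add_left_eq_sub] at h
  rw [div_lt_div_iff₀ (by linarith) ha] at h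
  rw [div_lt_div_iff₀ (by linarith) ha]
  nlinarith

theorem f_eq (θ : ℝ) {u : ℝ} (hu : 0 < u) :
    f θ u = u ^ 2 * (θ * (Real.log (1 + u ^ 2) / u ^ 2) - 1) := by
  unfold f; field_simp

theorem f_pos_of_lt_root {θ us u : ℝ} (hθ : 0 < θ) (h0 : f θ us = 0) (hu : 0 < u)
    (hlt : u < us) : 0 < f θ u := by
  have hus : 0 < us := hu.trans hlt
  rw [f_eq θ hu]
  rw [f_eq θ hus] at h0
  have h1 := log_one_add_div_lt (a := u ^ 2) (b := us ^ 2) (by positivity) (by gcongr)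
  have h2 : θ * (Real.log (1 + us ^ 2) / us ^ 2) - 1 = 0 := by
    rcases mul_eq_zero.1 h0 with h | h
    · exact absurd h (by positivity)
    · exact h
  have h3 := mul_lt_mul_of_pos_left h1 hθ
  apply mul_pos (by positivity); linarith

theorem f_neg_of_root_lt {θ us u : ℝ} (hθ : 0 < θ) (h0 : f θ us = 0) (hus : 0 < us)
    (hlt : us < u) : f θ u < 0 := by
  have hu : 0 < u := hus.trans hlt
  rw [f_eq θ hu]
  rw [f_eq θ hus] at h0
  have h1 := log_one_add_div_lt (a := us ^ 2) (b := u ^ 2) (by positivity) (by gcongr)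
  have h2 : θ * (Real.log (1 + us ^ 2) / us ^ 2) - 1 = 0 := by
    rcases mul_eq_zero.1 h0 with h | h
    · exact absurd h (by positivity)
    · exact h
  have h3 := mul_lt_mul_of_pos_left h1 hθ
  apply mul_neg_of_pos_of_neg (by positivity); linarith

theorem f_ne_zero_of_ne_root {θ us u : ℝ} (hθ : 0 < θ) (h0 : f θ us = 0) (hus : 0 < us)
    (hu : 0 < u) (hne : u ≠ us) : f θ u ≠ 0 := by
  rcases lt_or_gt_of_ne hne with h | h
  · exact (f_pos_of_lt_root hθ h0 hu h).ne'
  · exact (f_neg_of_root_lt hθ h0 hus h).ne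

theorem uStar_eq_of_root {θ us : ℝ} (hθ : 0 < θ) (h0 : f θ us = 0) (hus : 0 < us) :
    uStar θ = us := by
  have : {u : ℝ | 0 < u ∧ f θ u = 0} = {us} := by
    ext u
    simp only [mem_ofPred_eq, mem_singleton_iff]
    constructor
    · rintro ⟨h1, h2⟩
      by_contra h
      exact f_ne_zero_of_ne_root hθ h0 hus h1 h h2
    · rintro rfl; exact ⟨hus, h0⟩
  rw [uStar, this, csSup_singleton]

theorem exp_neg_sq (x : ℝ) : Real.exp (-x) ^ 2 = Real.exp (-2 * x) := by
  rw [← Real.exp_nat_mul]; congr 1; push_cast; ring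

theorem exp_neg_two_mul_mul_exp (x : ℝ) : Real.exp (-2 * x) * Real.exp (2 * x) = 1 := by
  rw [← Real.exp_add]; simp

theorem quotF_bottom (θ x : ℝ) :
    quotF θ x = ((f θ (Real.exp (-x)) * Real.exp (2 * x) : ℝ) : ℂ) := by
  rw [quotF_ofReal, f, exp_neg_sq]
  congr 1
  linear_combination exp_neg_two_mul_mul_exp x

theorem quotF_top (θ : ℝ) {x : ℝ} (hx : 0 < x) :
    quotF θ (x + (Real.pi / 2 : ℝ) * I) =
      ((g θ (Real.exp (-x)) * Real.exp (2 * x) : ℝ) : ℂ) := by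
  rw [quotF_top_of_pos θ hx, g, exp_neg_sq]
  congr 1
  linear_combination exp_neg_two_mul_mul_exp x

theorem g_exp_pos {θ : ℝ} (hθ : 1 < θ) {x : ℝ} (hx : 0 < x) : 0 < g θ (Real.exp (-x)) := by
  have h := quotF_top_pos hθ hx
  have e : -θ * Real.log (1 - Real.exp (-2 * x)) * Real.exp (2 * x) - 1 =
      g θ (Real.exp (-x)) * Real.exp (2 * x) := by
    rw [g, exp_neg_sq]
    linear_combination exp_neg_two_mul_mul_exp x
  rw [e] at h
  exact pos_of_mul_pos_left h (Real.exp_pos _).le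

theorem logUpper_ofReal {r : ℝ} (hr : r ≠ 0) : logUpper r = log r := by
  rcases lt_or_gt_of_ne hr with h | h
  · have h1 := logUpper_neg_ofReal (x := -r) (by linarith)
    have h2 : (-((-r : ℝ) : ℂ)) = r := by push_cast; ring
    rw [h2] at h1
    rw [h1]
    apply Complex.ext
    · simp [log_re]
    · simp [log_im, arg_ofReal_of_neg h]
  · rw [logUpper_ofReal_pos h, ofReal_log h.le]

/-- For negative reals both the principal logarithm and `logUpper` have argument `π`. The boundary
values of `slope` taken from inside the strip are therefore the principal roots that occur in `J₁`
and `J₂`, even where `f` is negative. -/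
theorem slope_of_quotF_eq {θ : ℝ} {w : ℂ} {r x : ℝ} (hr : r ≠ 0)
    (h : quotF θ w = ((r * Real.exp (2 * x) : ℝ) : ℂ)) :
    slope θ w = Real.exp (-x) / Complex.sqrt r := by
  have hr' : (r : ℂ) ≠ 0 := by exact_mod_cast hr
  have e : log ((r * Real.exp (2 * x) : ℝ) : ℂ) = log r + (2 * x : ℝ) := by
    have := log_mul_ofReal (Real.exp (2 * x)) (Real.exp_pos _) (r : ℂ) hr'
    rw [Real.log_exp] at this
    rw [ofReal_mul, this, add_comm]
  rw [slope, h, logUpper_ofReal (mul_ne_zero hr (Real.exp_pos _).ne'), e, sqrt_eq_exp hr',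
    ofReal_exp, ← Complex.exp_sub]
  congr 1
  push_cast
  ring

theorem slope_bottom {θ x : ℝ} (h : f θ (Real.exp (-x)) ≠ 0) :
    slope θ x = Real.exp (-x) / Complex.sqrt (f θ (Real.exp (-x))) :=
  slope_of_quotF_eq h (quotF_bottom θ x)

theorem slope_top {θ x : ℝ} (hθ : 1 < θ) (hx : 0 < x) :
    slope θ (x + (Real.pi / 2 : ℝ) * I) = Real.exp (-x) / Complex.sqrt (g θ (Real.exp (-x))) :=
  slope_of_quotF_eq (g_exp_pos hθ hx).ne' (quotF_top θ hx)

theorem sqrt_ofReal_pos {r : ℝ} (hr : 0 ≤ r) : Complex.sqrt r = (√r : ℝ) := by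
  rw [Complex.sqrt_of_nonneg (by exact_mod_cast hr)]; simp

theorem sqrt_ofReal_neg {r : ℝ} (hr : r ≤ 0) : Complex.sqrt r = I * (√(-r) : ℝ) := by
  have := Complex.sqrt_neg_of_nonneg (a := ((-r : ℝ) : ℂ)) (by exact_mod_cast (by linarith))
  rw [sqrt_ofReal_pos (by linarith)] at this
  rw [← this]; simp

theorem quotF_ne_zero {θ : ℝ} (hθ : 1 < θ) {us : ℝ} (hus : 0 < us) (h0 : f θ us = 0) {w : ℂ}
    (hw : w ∈ closedStrip) (h1 : w ≠ (Real.pi / 2 : ℝ) * I) (h2 : w ≠ (-Real.log us : ℝ)) :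
    quotF θ w ≠ 0 ∧ 0 ≤ (quotF θ w).im := by
  rcases hw.1.eq_or_lt with hb | hb
  · have e : w = (w.re : ℝ) := Complex.ext (by simp) (by simp [← hb])
    rw [e, quotF_bottom]
    refine ⟨?_, by rw [ofReal_im]⟩
    have : f θ (Real.exp (-w.re)) ≠ 0 := by
      apply f_ne_zero_of_ne_root (by linarith) h0 hus (Real.exp_pos _)
      intro h
      apply h2
      rw [e, ← h, Real.log_exp]; simp
    exact_mod_cast mul_ne_zero this (Real.exp_pos _).ne'
  rcases hw.2.eq_or_lt with ht | ht
  · have e : w = w.re + (Real.pi / 2 : ℝ) * I := Complex.ext (by simp) (by simp [ht])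
    rcases lt_trichotomy w.re 0 with h | h | h
    · have h3 := quotF_top_im_of_neg θ h
      rw [← e] at h3
      have h4 : 0 < (quotF θ w).im := by rw [h3]; positivity
      exact ⟨fun h => by simp [h] at h4, h4.le⟩
    · rw [h] at e; simp at e; simp [e] at h1
    · rw [e, quotF_top θ h]
      refine ⟨?_, by rw [ofReal_im]⟩
      exact_mod_cast mul_ne_zero (g_exp_pos hθ h).ne' (Real.exp_pos _).ne'
  · have h4 := quotF_im_pos (θ := θ) (by linarith) (w := w) ⟨hb, ht⟩
    exact ⟨fun h => by simp [h] at h4, h4.le⟩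

theorem differentiableAt_slope {θ : ℝ} (hθ : 1 < θ) {us : ℝ} (hus : 0 < us) (h0 : f θ us = 0)
    {w : ℂ} (hw : w ∈ closedStrip) (h1 : w ≠ (Real.pi / 2 : ℝ) * I)
    (h2 : w ≠ (-Real.log us : ℝ)) : DifferentiableAt ℂ (slope θ) w := by
  obtain ⟨h3, h4⟩ := quotF_ne_zero hθ hus h0 hw h1 h2
  have h5 : DifferentiableAt ℂ (fun w => logUpper (quotF θ w)) w :=
    DifferentiableAt.comp w (differentiableAt_logUpper h4 h3) (differentiableAt_quotF θ hw h1)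
  unfold slope
  fun_prop

theorem openStrip_subset_closedStrip : openStrip ⊆ closedStrip := fun _ h => ⟨h.1.le, h.2.le⟩

theorem isOpen_openStrip : IsOpen openStrip :=
  (isOpen_lt continuous_const continuous_im).inter (isOpen_lt continuous_im continuous_const)

theorem convex_openStrip : Convex ℝ openStrip :=
  (convex_halfSpace_im_gt 0).inter (convex_halfSpace_im_lt _)

theorem closure_openStrip : closure openStrip = closedStrip := by
  have h1 : openStrip = univ ×ℂ Ioo 0 (Real.pi / 2) := by
    ext w; simp [openStrip, mem_reProdIm]
  have h2 : closedStrip = univ ×ℂ Icc 0 (Real.pi / 2) := by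
    ext w; simp [closedStrip, mem_reProdIm]
  rw [h1, h2, closure_reProdIm, closure_univ, closure_Ioo (by positivity)]

theorem differentiableAt_slope_of_mem_openStrip {θ : ℝ} (hθ : 0 < θ) {w : ℂ} (hw : w ∈ openStrip) :
    DifferentiableAt ℂ (slope θ) w := by
  have h4 := quotF_im_pos hθ hw
  have h5 : DifferentiableAt ℂ (fun w => logUpper (quotF θ w)) w :=
    DifferentiableAt.comp w (differentiableAt_logUpper h4.le (fun h => by simp [h] at h4))
      (differentiableAt_quotF θ (openStrip_subset_closedStrip hw)
        (by rintro rfl; simpa using hw.2))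
  unfold slope
  fun_prop

/-- If `h` is in the open upper half-plane then `1 / √h` is in the open fourth quadrant. -/
theorem slope_re_pos_im_neg {θ : ℝ} {w : ℂ} (h : 0 < (quotF θ w).im) :
    0 < (slope θ w).re ∧ (slope θ w).im < 0 := by
  obtain ⟨h1, h2⟩ := logUpper_im_mem h
  have him : (-(logUpper (quotF θ w) / 2)).im = -((logUpper (quotF θ w)).im / 2) := by simp
  rw [slope, exp_re, exp_im, him, Real.cos_neg, Real.sin_neg]
  refine ⟨mul_pos (Real.exp_pos _) (Real.cos_pos_of_mem_Ioo ⟨by linarith, by linarith⟩), ?_⟩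
  rw [mul_neg, neg_lt_zero]
  exact mul_pos (Real.exp_pos _) (Real.sin_pos_of_pos_of_lt_pi (by linarith) (by linarith))

theorem norm_slope {θ : ℝ} {w : ℂ} (h : quotF θ w ≠ 0) :
    ‖slope θ w‖ = (√‖quotF θ w‖)⁻¹ := by
  have h1 : slope θ w ^ 2 = (quotF θ w)⁻¹ := by
    rw [slope, ← Complex.exp_nat_mul, ← exp_logUpper h, ← Complex.exp_neg, exp_logUpper h]
    congr 1; push_cast; ring
  have h2 : ‖slope θ w‖ ^ 2 = ‖quotF θ w‖⁻¹ := by rw [← norm_pow, h1, norm_inv]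
  rw [← Real.sqrt_inv, ← h2, Real.sqrt_sq (norm_nonneg _)]

/-- Jordan's inequality is applied to both factors of `sin 2t = 2 sin t cos t`, the cosine being the
sine of `π / 2 - t`. -/
theorem sin_two_mul_ge {t : ℝ} (h0 : 0 ≤ t) (h1 : t ≤ Real.pi / 2) :
    8 / Real.pi ^ 2 * (t * (Real.pi / 2 - t)) ≤ Real.sin (2 * t) := by
  have h2 := Real.mul_le_sin h0 h1
  have h3 := Real.mul_le_sin (x := Real.pi / 2 - t) (by linarith) (by linarith)
  rw [Real.sin_pi_div_two_sub] at h3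
  rw [Real.sin_two_mul]
  have h4 : 2 / Real.pi * t * (2 / Real.pi * (Real.pi / 2 - t)) ≤ Real.sin t * Real.cos t :=
    mul_le_mul h2 h3 (mul_nonneg (by positivity) (by linarith)) (by
      have : 0 ≤ 2 / Real.pi * t := by positivity
      linarith)
  calc _ = 2 * (2 / Real.pi * t * (2 / Real.pi * (Real.pi / 2 - t))) := by
        have := Real.pi_pos; field_simp; ring
    _ ≤ _ := by linarith

theorem inv_sqrt_mul_le {a b : ℝ} (ha : 0 < a) (hb : 0 < b) (hab : 1 ≤ a + b) :
    (√(a * b))⁻¹ ≤ |a ^ (-(1 / 2) : ℝ)| + |b ^ (-(1 / 2) : ℝ)| := by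
  have e : ∀ x : ℝ, 0 < x → |x ^ (-(1 / 2) : ℝ)| = (√x)⁻¹ := by
    intro x hx
    rw [Real.rpow_neg hx.le, ← Real.sqrt_eq_rpow, abs_of_pos (by positivity)]
  rw [e a ha, e b hb, Real.sqrt_mul ha.le]
  have h1 := Real.sqrt_pos.2 ha
  have h2 := Real.sqrt_pos.2 hb
  have h3 : 1 ≤ √a + √b := by
    nlinarith [Real.sq_sqrt ha.le, Real.sq_sqrt hb.le, mul_pos h1 h2]
  rw [inv_add_inv h1.ne' h2.ne', ← one_div]
  gcongr

/-- The modulus of `quotF` is at least its imaginary part, so one estimate with integrable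
singularities `t ^ (-1/2)` at the two edges covers the crest and the branch point without local
analysis. The splitting of the product into a sum uses `π / 2 ≥ 1`. -/
theorem norm_slope_le {θ : ℝ} (hθ : 0 < θ) {w : ℂ} (hw : w ∈ openStrip) :
    ‖slope θ w‖ ≤ (√(θ * (Real.exp (-2 * w.re) * (8 / Real.pi ^ 2) /
        (2 * (1 + Real.exp (-2 * w.re)) ^ 2))))⁻¹ *
      (|w.im ^ (-(1 / 2) : ℝ)| + |(Real.pi / 2 - w.im) ^ (-(1 / 2) : ℝ)|) := by
  have him := quotF_im_pos hθ hw
  have hw1 := hw.1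
  have hw2 : 0 < Real.pi / 2 - w.im := by linarith [hw.2]
  rw [norm_slope (fun h => by simp [h] at him)]
  refine le_trans ?_ (mul_le_mul_of_nonneg_left
    (inv_sqrt_mul_le hw1 hw2 (by linarith [Real.pi_gt_three])) (by positivity))
  rw [← mul_inv, ← Real.sqrt_mul (by positivity)]
  apply inv_anti₀ (by positivity)
  apply Real.sqrt_le_sqrt
  refine le_trans (le_trans ?_ (quotF_im_ge hθ hw)) ((le_abs_self _).trans (abs_im_le_norm _))
  rw [mul_assoc]
  apply mul_le_mul_of_nonneg_left _ hθ.le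
  rw [div_mul_eq_mul_div, mul_assoc]
  gcongr
  exact sin_two_mul_ge hw1.le hw.2.le

/-! ### The primitive and its derivative on the boundary -/

/-- A primitive of `slope` on the closed strip. -/
structure IsStripPrimitive (θ : ℝ) (Z : ℂ → ℂ) : Prop where
  continuousOn : ContinuousOn Z closedStrip
  hasDerivAt : ∀ w ∈ openStrip, HasDerivAt Z (slope θ w) w

theorem exists_isStripPrimitive {θ : ℝ} (hθ : 0 < θ) (w₀ : ℂ) :
    ∃ Z, IsStripPrimitive θ Z ∧ Z w₀ = 0 := by
  have hr : ∀ x y, IntervalIntegrable (fun t : ℝ => |t ^ (-(1 / 2) : ℝ)|) volume x y :=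
    fun x y => (intervalIntegral.intervalIntegrable_rpow' (by norm_num)).abs
  obtain ⟨Z, h1, h2⟩ := exists_primitive_continuousOn_closed_strip (c := Real.pi / 2)
    (by positivity) (m := slope θ)
    (fun w hw => (differentiableAt_slope_of_mem_openStrip hθ hw).differentiableWithinAt)
    (C := fun x => (√(θ * (Real.exp (-2 * x) * (8 / Real.pi ^ 2) /
        (2 * (1 + Real.exp (-2 * x)) ^ 2))))⁻¹)
    (b := fun t => |t ^ (-(1 / 2) : ℝ)| + |(Real.pi / 2 - t) ^ (-(1 / 2) : ℝ)|)
    (by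
      refine Continuous.inv₀ (Real.continuous_sqrt.comp ?_) fun x => by positivity
      refine continuous_const.mul (Continuous.div (by fun_prop) (by fun_prop) fun x => ?_)
      positivity)
    (fun x => by positivity) (fun t => by positivity)
    (fun x y => (hr x y).add (by
      have := (hr (Real.pi / 2 - x) (Real.pi / 2 - y)).comp_sub_left (Real.pi / 2)
      simpa using this))
    (fun w hw1 hw2 => norm_slope_le hθ ⟨hw1, hw2⟩)
  exact ⟨fun w => Z w - Z w₀, ⟨h1.sub continuousOn_const, fun w hw => (h2 w hw.1 hw.2).sub_const _⟩,
    by simp⟩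

/-- The derivative has a limit at the boundary point from inside a convex open set, and `Z` is
continuous there; this yields the one-sided derivative along the edge. -/
theorem IsStripPrimitive.hasDerivWithinAt {θ : ℝ} {Z : ℂ → ℂ} (hZ : IsStripPrimitive θ Z) {w : ℂ}
    (hm : ContinuousAt (slope θ) w) :
    HasDerivWithinAt Z (slope θ w) closedStrip w := by
  have h := hasFDerivWithinAt_closure_of_tendsto_fderiv (f := Z) (s := openStrip) (x := w)
    (f' := (ContinuousLinearMap.toSpanSingleton ℂ (slope θ w)).restrictScalars ℝ)
    (fun v hv => ((hZ.hasDerivAt v hv).differentiableAt.restrictScalars ℝ).differentiableWithinAt)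
    convex_openStrip isOpen_openStrip
    (fun v hv => (hZ.continuousOn v (closure_openStrip ▸ hv)).mono openStrip_subset_closedStrip)
    (by
      have h1 : Tendsto (fun v => (ContinuousLinearMap.toSpanSingleton ℂ (slope θ v)).restrictScalars ℝ)
          (𝓝[openStrip] w) (𝓝 ((ContinuousLinearMap.toSpanSingleton ℂ (slope θ w)).restrictScalars ℝ)) := by
        have hc : Continuous fun c : ℂ => (ContinuousLinearMap.toSpanSingleton ℂ c).restrictScalars ℝ :=
          (ContinuousLinearMap.continuous_restrictScalars ℝ).comp
            (ContinuousLinearMap.toSpanSingletonLIE ℂ ℂ).continuous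
        exact (hc.tendsto _).comp (hm.tendsto.mono_left nhdsWithin_le_nhds)
      refine h1.congr' ?_
      filter_upwards [self_mem_nhdsWithin] with v hv
      exact (((hZ.hasDerivAt v hv).hasFDerivAt.restrictScalars ℝ).fderiv).symm)
  rw [closure_openStrip] at h
  exact h.of_restrictScalars ℝ rfl

/-- As `Re w → ∞` the variable `s = u²` tends to zero and `log (1 + s) / s` to `1`. -/
theorem tendsto_quotF {θ : ℝ} :
    Tendsto (quotF θ) (comap re atTop ⊓ 𝓟 openStrip) (𝓝 ((θ - 1 : ℝ) : ℂ)) := by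
  have h1 : Tendsto (fun s : ℂ => log (1 + s) / s) (𝓝[≠] 0) (𝓝 1) := by
    have := (Complex.hasDerivAt_log (z := 1) (by simp)).tendsto_slope_zero
    simp only [log_one, sub_zero, inv_one, smul_eq_mul] at this
    refine this.congr fun s => ?_
    rw [div_eq_inv_mul]
  have h2 : Tendsto (fun w : ℂ => exp (-2 * w)) (comap re atTop ⊓ 𝓟 openStrip) (𝓝[≠] 0) := by
    refine tendsto_nhdsWithin_iff.2 ⟨?_, Eventually.of_forall fun w => Complex.exp_ne_zero _⟩
    refine Tendsto.mono_left ?_ inf_le_left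
    rw [tendsto_zero_iff_norm_tendsto_zero]
    simp only [norm_exp]
    have : Tendsto (fun x : ℝ => Real.exp (-2 * x)) atTop (𝓝 0) :=
      Real.tendsto_exp_atBot.comp (tendsto_id.const_mul_atTop_of_neg (by norm_num))
    refine (this.comp tendsto_comap).congr fun w => ?_
    simp
  have h3 := ((h1.comp h2).const_mul (θ : ℂ)).sub_const 1
  have e : ((θ - 1 : ℝ) : ℂ) = θ * 1 - 1 := by push_cast; ring
  rw [e]
  refine h3.congr' ?_
  filter_upwards [mem_inf_of_right (mem_principal_self _)] with w hw
  rw [quotF_eq_log hw]; rfl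

theorem tendsto_slope {θ : ℝ} (hθ : 1 < θ) :
    Tendsto (slope θ) (comap re atTop ⊓ 𝓟 openStrip) (𝓝 (((√(θ - 1))⁻¹ : ℝ) : ℂ)) := by
  have hpos : 0 < θ - 1 := by linarith
  have hc : ContinuousAt (fun h => exp (-(logUpper h / 2))) ((θ - 1 : ℝ) : ℂ) := by
    have := (differentiableAt_logUpper (z := ((θ - 1 : ℝ) : ℂ)) (by rw [ofReal_im])
      (by exact_mod_cast hpos.ne')).continuousAt
    fun_prop
  have e : exp (-(logUpper ((θ - 1 : ℝ) : ℂ) / 2)) = (((√(θ - 1))⁻¹ : ℝ) : ℂ) := by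
    rw [logUpper_ofReal_pos hpos, Real.sqrt_eq_rpow, ← Real.rpow_neg hpos.le,
      Real.rpow_def_of_pos hpos]
    push_cast
    congr 1; ring
  rw [← e]
  exact hc.tendsto.comp tendsto_quotF

/-! ### Monotonicity, edge values and injectivity of the hodograph map -/

/-- The hodograph map: the position `z` as a function of `w = -log u`, normalised to vanish at the
crest `u = u*`. -/
structure IsHodograph (θ us : ℝ) (Z : ℂ → ℂ) : Prop extends IsStripPrimitive θ Z where
  one_lt : 1 < θ
  root_pos : 0 < us
  root : f θ us = 0
  crest : Z (-Real.log us : ℝ) = 0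

namespace IsHodograph

variable {θ us : ℝ} {Z : ℂ → ℂ}

theorem mem_closedStrip {x y : ℝ} (hy : y ∈ Icc 0 (Real.pi / 2)) :
    (x + y * I : ℂ) ∈ closedStrip := by simpa [closedStrip] using hy

theorem mem_openStrip {x y : ℝ} (hy : y ∈ Ioo 0 (Real.pi / 2)) :
    (x + y * I : ℂ) ∈ openStrip := by simpa [openStrip] using hy

theorem theta_pos (H : IsHodograph θ us Z) : 0 < θ := by linarith [H.one_lt]

theorem continuousOn_vertical (H : IsHodograph θ us Z) (x : ℝ) :
    ContinuousOn (fun y : ℝ => Z (x + y * I)) (Icc 0 (Real.pi / 2)) :=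
  H.continuousOn.comp (by fun_prop) fun _ hy => mem_closedStrip hy

theorem continuous_horizontal (H : IsHodograph θ us Z) {y : ℝ} (hy : y ∈ Icc 0 (Real.pi / 2)) :
    Continuous (fun x : ℝ => Z (x + y * I)) :=
  H.continuousOn.comp_continuous (by fun_prop) fun _ => mem_closedStrip hy

theorem hasDerivAt_vertical (H : IsHodograph θ us Z) (x : ℝ) {y : ℝ}
    (hy : y ∈ Ioo 0 (Real.pi / 2)) :
    HasDerivAt (fun y : ℝ => Z (x + y * I)) (slope θ (x + y * I) * I) y := by
  have h4 : HasDerivAt (fun t : ℝ => (x + t * I : ℂ)) I y := by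
    simpa using ((ofRealCLM.hasDerivAt (x := y)).mul_const I).const_add (x : ℂ)
  exact (H.hasDerivAt _ (mem_openStrip hy)).comp y h4

theorem hasDerivAt_re {F : ℝ → ℂ} {F' : ℂ} {x : ℝ} (h : HasDerivAt F F' x) :
    HasDerivAt (fun x => (F x).re) F'.re x :=
  reCLM.hasFDerivAt.comp_hasDerivAt x h

theorem hasDerivAt_im {F : ℝ → ℂ} {F' : ℂ} {x : ℝ} (h : HasDerivAt F F' x) :
    HasDerivAt (fun x => (F x).im) F'.im x :=
  imCLM.hasFDerivAt.comp_hasDerivAt x h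

theorem slope_openStrip (H : IsHodograph θ us Z) {w : ℂ} (hw : w ∈ openStrip) :
    0 < (slope θ w).re ∧ (slope θ w).im < 0 :=
  slope_re_pos_im_neg (quotF_im_pos H.theta_pos hw)

/-- The vertical derivative is `i` times `slope`, and rotation by a right angle takes the open
fourth quadrant to the first. The real and the imaginary part of `Z` therefore both increase
upwards. -/
theorem strictMonoOn_vertical_re (H : IsHodograph θ us Z) (x : ℝ) :
    StrictMonoOn (fun y : ℝ => (Z (x + y * I)).re) (Icc 0 (Real.pi / 2)) := by
  apply strictMonoOn_of_deriv_pos (convex_Icc _ _)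
    (continuous_re.comp_continuousOn (H.continuousOn_vertical x))
  intro y hy
  rw [interior_Icc] at hy
  refine lt_of_lt_of_eq ?_ (hasDerivAt_re (H.hasDerivAt_vertical x hy)).deriv.symm
  simpa using (H.slope_openStrip (mem_openStrip hy)).2

theorem strictMonoOn_vertical_im (H : IsHodograph θ us Z) (x : ℝ) :
    StrictMonoOn (fun y : ℝ => (Z (x + y * I)).im) (Icc 0 (Real.pi / 2)) := by
  apply strictMonoOn_of_deriv_pos (convex_Icc _ _)
    (continuous_im.comp_continuousOn (H.continuousOn_vertical x))
  intro y hy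
  rw [interior_Icc] at hy
  refine lt_of_lt_of_eq ?_ (hasDerivAt_im (H.hasDerivAt_vertical x hy)).deriv.symm
  simpa using (H.slope_openStrip (mem_openStrip hy)).1

theorem hasDerivAt_horizontal (H : IsHodograph θ us Z) {x y : ℝ} (hy : y ∈ Icc 0 (Real.pi / 2))
    (hc : ContinuousAt (slope θ) (x + y * I)) :
    HasDerivAt (fun x : ℝ => Z (x + y * I)) (slope θ (x + y * I)) x := by
  have h4 : HasDerivAt (fun t : ℝ => (t + y * I : ℂ)) 1 x :=
    (ofRealCLM.hasDerivAt (x := x)).add_const (y * I : ℂ)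
  have h := (H.toIsStripPrimitive.hasDerivWithinAt hc).comp_hasDerivAt x h4
    (Eventually.of_forall fun t => mem_closedStrip hy)
  rwa [mul_one] at h

theorem continuousAt_slope_of_mem_Ioo (H : IsHodograph θ us Z) {x y : ℝ}
    (hy : y ∈ Ioo 0 (Real.pi / 2)) : ContinuousAt (slope θ) (x + y * I) :=
  (differentiableAt_slope_of_mem_openStrip H.theta_pos (mem_openStrip hy)).continuousAt

theorem hasDerivAt_bottom (H : IsHodograph θ us Z) {x : ℝ} (hx : x ≠ -Real.log us) :
    HasDerivAt (fun x : ℝ => Z x) (slope θ x) x := by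
  have h := H.hasDerivAt_horizontal (x := x) (y := 0) ⟨le_rfl, by positivity⟩ (by
    refine (differentiableAt_slope H.one_lt H.root_pos H.root
      (mem_closedStrip ⟨le_rfl, by positivity⟩) ?_ ?_).continuousAt
    · intro h
      have := congrArg im h
      simp at this
      linarith [Real.pi_pos]
    · intro h
      apply hx
      simpa using congrArg re h)
  simpa using h

theorem hasDerivAt_top (H : IsHodograph θ us Z) {x : ℝ} (hx : x ≠ 0) :
    HasDerivAt (fun x : ℝ => Z (x + (Real.pi / 2 : ℝ) * I))
      (slope θ (x + (Real.pi / 2 : ℝ) * I)) x := by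
  refine H.hasDerivAt_horizontal (x := x) ⟨by positivity, le_rfl⟩ ?_
  refine (differentiableAt_slope H.one_lt H.root_pos H.root
      (mem_closedStrip ⟨by positivity, le_rfl⟩) ?_ ?_).continuousAt
  · intro h
    apply hx
    simpa using congrArg re h
  · intro h
    have := congrArg im h
    rw [ofReal_im] at this
    simp at this

theorem strictMono_horizontal_re (H : IsHodograph θ us Z) {y : ℝ} (hy : y ∈ Ioo 0 (Real.pi / 2)) :
    StrictMono (fun x : ℝ => (Z (x + y * I)).re) := by
  apply strictMono_of_deriv_pos
  intro x
  rw [(hasDerivAt_re (H.hasDerivAt_horizontal (Ioo_subset_Icc_self hy)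
    (H.continuousAt_slope_of_mem_Ioo hy))).deriv]
  exact (H.slope_openStrip (mem_openStrip hy)).1

theorem strictAnti_horizontal_im (H : IsHodograph θ us Z) {y : ℝ} (hy : y ∈ Ioo 0 (Real.pi / 2)) :
    StrictAnti (fun x : ℝ => (Z (x + y * I)).im) := by
  apply strictAnti_of_deriv_neg
  intro x
  rw [(hasDerivAt_im (H.hasDerivAt_horizontal (Ioo_subset_Icc_self hy)
    (H.continuousAt_slope_of_mem_Ioo hy))).deriv]
  exact (H.slope_openStrip (mem_openStrip hy)).2

theorem neBot_nhdsWithin_Ioo {y : ℝ} (hy : y ∈ Icc 0 (Real.pi / 2)) :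
    (𝓝[Ioo 0 (Real.pi / 2)] y).NeBot := by
  rw [← mem_closure_iff_nhdsWithin_neBot, closure_Ioo (by positivity)]
  exact hy

theorem tendsto_vertical (H : IsHodograph θ us Z) (x : ℝ) {y : ℝ} (hy : y ∈ Icc 0 (Real.pi / 2)) :
    Tendsto (fun t : ℝ => Z (x + t * I)) (𝓝[Ioo 0 (Real.pi / 2)] y) (𝓝 (Z (x + y * I))) :=
  ((H.continuousOn_vertical x) y hy).mono Ioo_subset_Icc_self

/-- Passing to the limit from interior lines includes both edges, at the price of strictness. -/
theorem monotone_horizontal_re (H : IsHodograph θ us Z) {y : ℝ} (hy : y ∈ Icc 0 (Real.pi / 2)) :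
    Monotone (fun x : ℝ => (Z (x + y * I)).re) := by
  intro x₁ x₂ h
  have := neBot_nhdsWithin_Ioo hy
  refine le_of_tendsto_of_tendsto ((continuous_re.tendsto _).comp (H.tendsto_vertical x₁ hy))
    ((continuous_re.tendsto _).comp (H.tendsto_vertical x₂ hy)) ?_
  filter_upwards [self_mem_nhdsWithin] with t ht
  exact (H.strictMono_horizontal_re ht).monotone h

theorem antitone_horizontal_im (H : IsHodograph θ us Z) {y : ℝ} (hy : y ∈ Icc 0 (Real.pi / 2)) :
    Antitone (fun x : ℝ => (Z (x + y * I)).im) := by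
  intro x₁ x₂ h
  have := neBot_nhdsWithin_Ioo hy
  refine le_of_tendsto_of_tendsto ((continuous_im.tendsto _).comp (H.tendsto_vertical x₂ hy))
    ((continuous_im.tendsto _).comp (H.tendsto_vertical x₁ hy)) ?_
  filter_upwards [self_mem_nhdsWithin] with t ht
  exact (H.strictAnti_horizontal_im ht).antitone h

theorem continuous_bottom (H : IsHodograph θ us Z) : Continuous (fun x : ℝ => Z x) := by
  simpa using H.continuous_horizontal (y := 0) ⟨le_rfl, by positivity⟩

theorem continuous_top (H : IsHodograph θ us Z) :
    Continuous (fun x : ℝ => Z (x + (Real.pi / 2 : ℝ) * I)) :=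
  H.continuous_horizontal ⟨by positivity, le_rfl⟩

theorem lt_root_of_lt (H : IsHodograph θ us Z) {x : ℝ} (hx : -Real.log us < x) :
    Real.exp (-x) < us := by
  rw [← Real.lt_log_iff_exp_lt H.root_pos]; linarith

theorem root_lt_of_lt (H : IsHodograph θ us Z) {x : ℝ} (hx : x < -Real.log us) :
    us < Real.exp (-x) := by
  rw [← Real.log_lt_iff_lt_exp H.root_pos]; linarith

theorem slope_bottom_right (H : IsHodograph θ us Z) {x : ℝ} (hx : -Real.log us < x) :
    slope θ x = ((Real.exp (-x) / √(f θ (Real.exp (-x))) : ℝ) : ℂ) ∧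
      0 < Real.exp (-x) / √(f θ (Real.exp (-x))) := by
  have hf := f_pos_of_lt_root H.theta_pos H.root (Real.exp_pos (-x)) (H.lt_root_of_lt hx)
  rw [slope_bottom hf.ne', sqrt_ofReal_pos hf.le]
  exact ⟨by push_cast; rfl, by positivity⟩

/-- The bound by `1` comes from `-f ≤ u²`. It makes the imaginary part of `Z` grow at least linearly
towards `u = ∞`, which is needed for properness. -/
theorem slope_bottom_left (H : IsHodograph θ us Z) {x : ℝ} (hx : x < -Real.log us) :
    slope θ x = ((-(Real.exp (-x) / √(-f θ (Real.exp (-x)))) : ℝ) : ℂ) * I ∧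
      1 ≤ Real.exp (-x) / √(-f θ (Real.exp (-x))) := by
  have hf := f_neg_of_root_lt H.theta_pos H.root H.root_pos (H.root_lt_of_lt hx)
  have hf' : 0 < √(-f θ (Real.exp (-x))) := Real.sqrt_pos.2 (by linarith)
  rw [slope_bottom hf.ne, sqrt_ofReal_neg hf.le]
  refine ⟨?_, ?_⟩
  · push_cast
    rw [div_mul_eq_div_div_swap, div_I]
    ring
  · rw [one_le_div hf', Real.sqrt_le_left (Real.exp_pos _).le]
    have : 0 ≤ Real.log (1 + Real.exp (-x) ^ 2) :=
      Real.log_nonneg (by linarith [sq_nonneg (Real.exp (-x))])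
    have := mul_nonneg H.theta_pos.le this
    unfold f
    linarith

theorem bottom_right_im (H : IsHodograph θ us Z) {x : ℝ} (hx : -Real.log us ≤ x) :
    (Z x).im = 0 := by
  have hc : ContinuousOn (fun x : ℝ => (Z x).im) (Ici (-Real.log us)) :=
    (continuous_im.comp H.continuous_bottom).continuousOn
  have hd : ∀ x ∈ interior (Ici (-Real.log us)), HasDerivAt (fun x : ℝ => (Z x).im) 0 x := by
    intro x hx
    rw [interior_Ici] at hx
    have := hasDerivAt_im (H.hasDerivAt_bottom (ne_of_gt hx))
    rwa [(H.slope_bottom_right hx).1, ofReal_im] at this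
  have h1 := monotoneOn_of_deriv_nonneg (convex_Ici _) hc
    (fun x hx => (hd x hx).differentiableAt.differentiableWithinAt)
    (fun x hx => (hd x hx).deriv.ge)
  have h2 := antitoneOn_of_deriv_nonpos (convex_Ici _) hc
    (fun x hx => (hd x hx).differentiableAt.differentiableWithinAt)
    (fun x hx => (hd x hx).deriv.le)
  have e : (Z (-Real.log us : ℝ)).im = 0 := by rw [H.crest]; simp
  rw [← e]
  exact le_antisymm (h2 self_mem_Ici hx hx) (h1 self_mem_Ici hx hx)

theorem bottom_left_re (H : IsHodograph θ us Z) {x : ℝ} (hx : x ≤ -Real.log us) :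
    (Z x).re = 0 := by
  have hc : ContinuousOn (fun x : ℝ => (Z x).re) (Iic (-Real.log us)) :=
    (continuous_re.comp H.continuous_bottom).continuousOn
  have hd : ∀ x ∈ interior (Iic (-Real.log us)), HasDerivAt (fun x : ℝ => (Z x).re) 0 x := by
    intro x hx
    rw [interior_Iic] at hx
    have := hasDerivAt_re (H.hasDerivAt_bottom (ne_of_lt hx))
    rwa [(H.slope_bottom_left hx).1, re_ofReal_mul, I_re, mul_zero] at this
  have h1 := monotoneOn_of_deriv_nonneg (convex_Iic _) hc
    (fun x hx => (hd x hx).differentiableAt.differentiableWithinAt)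
    (fun x hx => (hd x hx).deriv.ge)
  have h2 := antitoneOn_of_deriv_nonpos (convex_Iic _) hc
    (fun x hx => (hd x hx).differentiableAt.differentiableWithinAt)
    (fun x hx => (hd x hx).deriv.le)
  have e : (Z (-Real.log us : ℝ)).re = 0 := by rw [H.crest]; simp
  rw [← e]
  exact le_antisymm (h1 hx self_mem_Iic hx) (h2 hx self_mem_Iic hx)

theorem strictMonoOn_bottom_re (H : IsHodograph θ us Z) :
    StrictMonoOn (fun x : ℝ => (Z x).re) (Ici (-Real.log us)) := by
  apply strictMonoOn_of_deriv_pos (convex_Ici _)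
    (continuous_re.comp H.continuous_bottom).continuousOn
  intro x hx
  rw [interior_Ici] at hx
  refine lt_of_lt_of_eq ?_ (hasDerivAt_re (H.hasDerivAt_bottom (ne_of_gt hx))).deriv.symm
  rw [(H.slope_bottom_right hx).1, ofReal_re]
  exact (H.slope_bottom_right hx).2

theorem bottom_left_im_ge (H : IsHodograph θ us Z) {x₁ x₂ : ℝ} (h12 : x₁ ≤ x₂)
    (hx : x₂ ≤ -Real.log us) : x₂ - x₁ ≤ (Z x₁).im - (Z x₂).im := by
  have hc : ContinuousOn (fun x : ℝ => (Z x).im + x) (Iic (-Real.log us)) :=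
    ((continuous_im.comp H.continuous_bottom).add continuous_id).continuousOn
  have hd : ∀ x ∈ interior (Iic (-Real.log us)), HasDerivAt (fun x : ℝ => (Z x).im + x)
      ((slope θ x).im + 1) x := by
    intro x hx
    rw [interior_Iic] at hx
    exact (hasDerivAt_im (H.hasDerivAt_bottom (ne_of_lt hx))).add (hasDerivAt_id x)
  have h2 := antitoneOn_of_deriv_nonpos (convex_Iic _) hc
    (fun x hx => (hd x hx).differentiableAt.differentiableWithinAt)
    (fun x hx => by
      rw [(hd x hx).deriv]
      rw [interior_Iic] at hx
      rw [(H.slope_bottom_left hx).1, im_ofReal_mul, I_im]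
      linarith [(H.slope_bottom_left hx).2])
  have := h2 (h12.trans hx) hx h12
  simp only at this
  linarith

theorem bottom_re_nonneg (H : IsHodograph θ us Z) (x : ℝ) : 0 ≤ (Z x).re := by
  rcases le_total x (-Real.log us) with h | h
  · exact (H.bottom_left_re h).ge
  · have := H.strictMonoOn_bottom_re.monotoneOn self_mem_Ici h h
    simpa [← H.bottom_left_re le_rfl] using this

theorem bottom_im_nonneg (H : IsHodograph θ us Z) (x : ℝ) : 0 ≤ (Z x).im := by
  rcases le_total x (-Real.log us) with h | h
  · have := H.bottom_left_im_ge h le_rfl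
    rw [H.crest] at this
    simp at this
    linarith
  · exact (H.bottom_right_im h).ge

theorem bottom_im_ge (H : IsHodograph θ us Z) (x : ℝ) : -Real.log us - x ≤ (Z x).im := by
  rcases le_total x (-Real.log us) with h | h
  · have := H.bottom_left_im_ge h le_rfl
    rw [H.crest, zero_im, sub_zero] at this
    linarith
  · linarith [H.bottom_right_im h]

/-- Because `log (1 + u²) ≤ u²`, one has `√f ≤ √(θ - 1) u`. The resulting linear growth towards `u =
0` is the second half of properness. -/
theorem bottom_re_ge (H : IsHodograph θ us Z) {x : ℝ} (hx : -Real.log us ≤ x) :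
    (√(θ - 1))⁻¹ * (x + Real.log us) ≤ (Z x).re := by
  have hc : ContinuousOn (fun x : ℝ => (Z x).re - (√(θ - 1))⁻¹ * x) (Ici (-Real.log us)) :=
    ((continuous_re.comp H.continuous_bottom).sub (by fun_prop)).continuousOn
  have hd : ∀ x ∈ interior (Ici (-Real.log us)),
      HasDerivAt (fun x : ℝ => (Z x).re - (√(θ - 1))⁻¹ * x)
      ((slope θ x).re - (√(θ - 1))⁻¹ * 1) x := by
    intro x hx
    rw [interior_Ici] at hx
    exact (hasDerivAt_re (H.hasDerivAt_bottom (ne_of_gt hx))).sub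
      ((hasDerivAt_id x).const_mul _)
  have h2 := monotoneOn_of_deriv_nonneg (convex_Ici _) hc
    (fun x hx => (hd x hx).differentiableAt.differentiableWithinAt)
    (fun x hx => by
      rw [(hd x hx).deriv]
      rw [interior_Ici] at hx
      rw [(H.slope_bottom_right hx).1, ofReal_re]
      have hf := f_pos_of_lt_root H.theta_pos H.root (Real.exp_pos (-x)) (H.lt_root_of_lt hx)
      have hle : f θ (Real.exp (-x)) ≤ (θ - 1) * Real.exp (-x) ^ 2 := by
        have h1 := Real.log_le_sub_one_of_pos (x := 1 + Real.exp (-x) ^ 2) (by positivity)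
        have := H.theta_pos
        unfold f; nlinarith
      have h3 : √(f θ (Real.exp (-x))) ≤ √(θ - 1) * Real.exp (-x) := by
        refine (Real.sqrt_le_sqrt hle).trans ?_
        rw [Real.sqrt_mul (by linarith [H.one_lt]), Real.sqrt_sq (Real.exp_pos _).le]
      have h4 : 0 < √(f θ (Real.exp (-x))) := Real.sqrt_pos.2 hf
      have h5 : 0 < √(θ - 1) := Real.sqrt_pos.2 (by linarith [H.one_lt])
      rw [mul_one, sub_nonneg, inv_eq_one_div, div_le_div_iff₀ h5 h4]
      linarith)
  have := h2 self_mem_Ici hx hx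
  simp only [H.crest, zero_re] at this
  linarith

theorem re_pos (H : IsHodograph θ us Z) (x : ℝ) {y : ℝ} (hy : y ∈ Ioc 0 (Real.pi / 2)) :
    0 < (Z (x + y * I)).re := by
  have := H.strictMonoOn_vertical_re x (left_mem_Icc.2 (by positivity)) ⟨hy.1.le, hy.2⟩ hy.1
  simp only [ofReal_zero, zero_mul, add_zero] at this
  linarith [H.bottom_re_nonneg x]

theorem im_pos (H : IsHodograph θ us Z) (x : ℝ) {y : ℝ} (hy : y ∈ Ioc 0 (Real.pi / 2)) :
    0 < (Z (x + y * I)).im := by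
  have := H.strictMonoOn_vertical_im x (left_mem_Icc.2 (by positivity)) ⟨hy.1.le, hy.2⟩ hy.1
  simp only [ofReal_zero, zero_mul, add_zero] at this
  linarith [H.bottom_im_nonneg x]

theorem slope_top_right (H : IsHodograph θ us Z) {x : ℝ} (hx : 0 < x) :
    slope θ (x + (Real.pi / 2 : ℝ) * I) = ((Real.exp (-x) / √(g θ (Real.exp (-x))) : ℝ) : ℂ) ∧
      0 < Real.exp (-x) / √(g θ (Real.exp (-x))) := by
  have hg := g_exp_pos H.one_lt hx
  rw [slope_top H.one_lt hx, sqrt_ofReal_pos hg.le]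
  exact ⟨by push_cast; rfl, by positivity⟩

theorem strictMonoOn_top_re (H : IsHodograph θ us Z) :
    StrictMonoOn (fun x : ℝ => (Z (x + (Real.pi / 2 : ℝ) * I)).re) (Ici 0) := by
  apply strictMonoOn_of_deriv_pos (convex_Ici _)
    (continuous_re.comp H.continuous_top).continuousOn
  intro x hx
  rw [interior_Ici] at hx
  refine lt_of_lt_of_eq ?_ (hasDerivAt_re (H.hasDerivAt_top (ne_of_gt hx))).deriv.symm
  rw [(H.slope_top_right hx).1, ofReal_re]
  exact (H.slope_top_right hx).2

theorem slope_top_left (H : IsHodograph θ us Z) {x : ℝ} (hx : x < 0) :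
    0 < (slope θ (x + (Real.pi / 2 : ℝ) * I)).re ∧
      (slope θ (x + (Real.pi / 2 : ℝ) * I)).im < 0 := by
  apply slope_re_pos_im_neg
  rw [quotF_top_im_of_neg θ hx]
  have := H.theta_pos
  positivity

theorem strictMonoOn_top_re_left (H : IsHodograph θ us Z) :
    StrictMonoOn (fun x : ℝ => (Z (x + (Real.pi / 2 : ℝ) * I)).re) (Iic 0) := by
  apply strictMonoOn_of_deriv_pos (convex_Iic _)
    (continuous_re.comp H.continuous_top).continuousOn
  intro x hx
  rw [interior_Iic] at hx
  refine lt_of_lt_of_eq ?_ (hasDerivAt_re (H.hasDerivAt_top (ne_of_lt hx))).deriv.symm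
  exact (H.slope_top_left hx).1

theorem strictMono_top_re (H : IsHodograph θ us Z) :
    StrictMono (fun x : ℝ => (Z (x + (Real.pi / 2 : ℝ) * I)).re) :=
  H.strictMonoOn_top_re_left.Iic_union_Ici H.strictMonoOn_top_re

theorem strictAntiOn_top_im (H : IsHodograph θ us Z) :
    StrictAntiOn (fun x : ℝ => (Z (x + (Real.pi / 2 : ℝ) * I)).im) (Iic 0) := by
  apply strictAntiOn_of_deriv_neg (convex_Iic _)
    (continuous_im.comp H.continuous_top).continuousOn
  intro x hx
  rw [interior_Iic] at hx
  refine lt_of_eq_of_lt (hasDerivAt_im (H.hasDerivAt_top (ne_of_lt hx))).deriv ?_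
  exact (H.slope_top_left hx).2

theorem top_im_eq (H : IsHodograph θ us Z) {x : ℝ} (hx : 0 ≤ x) :
    (Z (x + (Real.pi / 2 : ℝ) * I)).im = (Z ((Real.pi / 2 : ℝ) * I)).im := by
  have hc : ContinuousOn (fun x : ℝ => (Z (x + (Real.pi / 2 : ℝ) * I)).im) (Ici 0) :=
    (continuous_im.comp H.continuous_top).continuousOn
  have hd : ∀ x ∈ interior (Ici (0 : ℝ)),
      HasDerivAt (fun x : ℝ => (Z (x + (Real.pi / 2 : ℝ) * I)).im) 0 x := by
    intro x hx
    rw [interior_Ici] at hx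
    have := hasDerivAt_im (H.hasDerivAt_top (ne_of_gt hx))
    rwa [(H.slope_top_right hx).1, ofReal_im] at this
  have h1 := monotoneOn_of_deriv_nonneg (convex_Ici _) hc
    (fun x hx => (hd x hx).differentiableAt.differentiableWithinAt)
    (fun x hx => (hd x hx).deriv.ge)
  have h2 := antitoneOn_of_deriv_nonpos (convex_Ici _) hc
    (fun x hx => (hd x hx).differentiableAt.differentiableWithinAt)
    (fun x hx => (hd x hx).deriv.le)
  have h3 := h1 self_mem_Ici hx hx
  have h4 := h2 self_mem_Ici hx hx
  simp only [ofReal_zero, zero_add] at h3 h4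
  exact le_antisymm h4 h3

/-- The rise of the hodograph map across the strip tends to `i β`. -/
theorem tendsto_top_sub_bottom (H : IsHodograph θ us Z) :
    Tendsto (fun x : ℝ => Z (x + (Real.pi / 2 : ℝ) * I) - Z x) atTop (𝓝 (beta θ * I)) := by
  set c : ℂ := (((√(θ - 1))⁻¹ : ℝ) : ℂ) with hcdef
  have hβ : (beta θ : ℂ) * I = c * ((Real.pi / 2 : ℝ) * I) := by
    rw [hcdef, beta]; push_cast; rw [div_mul_eq_div_div]; ring
  rw [hβ, Metric.tendsto_nhds]
  intro ε hε
  -- The strip has width `π / 2 < 2`, so a slope error of `ε / 4` gives a total error of at most `ε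
  -- / 2`.
  have hε' : 0 < ε / 4 := by positivity
  have h1 := (Metric.tendsto_nhds.1 (tendsto_slope H.one_lt)) (ε / 4) hε'
  rw [eventually_inf_principal, eventually_comap] at h1
  filter_upwards [h1] with x hx
  have hd : ∀ y ∈ Ioo (0 : ℝ) (Real.pi / 2), HasDerivWithinAt
      (fun y : ℝ => Z (x + y * I) - c * (y * I))
      (slope θ (x + y * I) * I - c * (1 * I)) (Ioo 0 (Real.pi / 2)) y := by
    intro y hy
    refine ((H.hasDerivAt_vertical x hy).sub ?_).hasDerivWithinAt
    exact ((ofRealCLM.hasDerivAt (x := y)).mul_const I).const_mul c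
  have hb : ∀ y ∈ Ioo (0 : ℝ) (Real.pi / 2), ‖slope θ (x + y * I) * I - c * (1 * I)‖ ≤ ε / 4 := by
    intro y hy
    have := hx (x + y * I) (by simp) (mem_openStrip hy)
    rw [dist_eq_norm] at this
    rw [one_mul, ← sub_mul, norm_mul, norm_I, mul_one]
    exact this.le
  have h2 : ∀ y₁ ∈ Ioo (0 : ℝ) (Real.pi / 2), ∀ y₂ ∈ Ioo (0 : ℝ) (Real.pi / 2),
      ‖(Z (x + y₂ * I) - c * (y₂ * I)) - (Z (x + y₁ * I) - c * (y₁ * I))‖ ≤ ε / 4 * 2 := by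
    intro y₁ hy₁ y₂ hy₂
    refine ((convex_Ioo _ _).norm_image_sub_le_of_norm_hasDerivWithin_le hd hb hy₁ hy₂).trans ?_
    apply mul_le_mul_of_nonneg_left _ hε'.le
    rw [Real.norm_eq_abs, abs_le]
    constructor <;> linarith [hy₁.1, hy₁.2, hy₂.1, hy₂.2, Real.pi_lt_four]
  have ht : ∀ y ∈ Icc (0 : ℝ) (Real.pi / 2), Tendsto (fun y : ℝ => Z (x + y * I) - c * (y * I))
      (𝓝[Ioo 0 (Real.pi / 2)] y) (𝓝 (Z (x + y * I) - c * (y * I))) := by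
    intro y hy
    refine (H.tendsto_vertical x hy).sub (Tendsto.mono_left ?_ nhdsWithin_le_nhds)
    exact (by fun_prop : Continuous fun y : ℝ => c * (y * I)).tendsto y
  have m0 : (0 : ℝ) ∈ Icc 0 (Real.pi / 2) := ⟨le_rfl, by positivity⟩
  have m1 : (Real.pi / 2 : ℝ) ∈ Icc 0 (Real.pi / 2) := ⟨by positivity, le_rfl⟩
  -- The mean value estimate holds between interior heights; continuity carries it to the top edge,
  -- then to the bottom edge.
  have h3 : ∀ y₁ ∈ Ioo (0 : ℝ) (Real.pi / 2),
      ‖(Z (x + (Real.pi / 2 : ℝ) * I) - c * ((Real.pi / 2 : ℝ) * I)) -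
        (Z (x + y₁ * I) - c * (y₁ * I))‖ ≤ ε / 4 * 2 := by
    intro y₁ hy₁
    have := neBot_nhdsWithin_Ioo m1
    refine le_of_tendsto ((ht _ m1).sub_const _).norm ?_
    filter_upwards [self_mem_nhdsWithin] with y hy
    exact h2 y₁ hy₁ y hy
  have h4 : ‖(Z (x + (Real.pi / 2 : ℝ) * I) - c * ((Real.pi / 2 : ℝ) * I)) -
        (Z (x + (0 : ℝ) * I) - c * ((0 : ℝ) * I))‖ ≤ ε / 4 * 2 := by
    have := neBot_nhdsWithin_Ioo m0
    refine le_of_tendsto ((ht _ m0).const_sub _).norm ?_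
    filter_upwards [self_mem_nhdsWithin] with y hy
    exact h3 y hy
  rw [dist_eq_norm]
  simp only [ofReal_zero, zero_mul, mul_zero, sub_zero, add_zero] at h4
  rw [sub_right_comm]
  linarith

/-- The imaginary part is constant along the top edge right of the branch point and zero on the
bottom edge right of the crest, so the constant equals the limiting rise. -/
theorem top_im (H : IsHodograph θ us Z) {x : ℝ} (hx : 0 ≤ x) :
    (Z (x + (Real.pi / 2 : ℝ) * I)).im = beta θ := by
  rw [H.top_im_eq hx]
  have h := (continuous_im.tendsto _).comp H.tendsto_top_sub_bottom
  have h2 : Tendsto (im ∘ fun x : ℝ => Z (x + (Real.pi / 2 : ℝ) * I) - Z x) atTop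
      (𝓝 (Z ((Real.pi / 2 : ℝ) * I)).im) := by
    apply tendsto_const_nhds.congr'
    filter_upwards [eventually_ge_atTop 0, eventually_ge_atTop (-Real.log us)] with x h1 h2
    simp only [Function.comp_apply, sub_im]
    rw [H.top_im_eq h1, H.bottom_right_im h2, sub_zero]
  have := tendsto_nhds_unique h2 h
  simpa using this

/-- Of two points with `x₁ ≤ x₂`, the real part separates them if the second is higher, since it
grows to the right and upwards. The imaginary part separates them if the second is lower, since it
falls to the right and grows upwards. At equal heights the monotonicity along the horizontal line is
strict; on the bottom edge the imaginary part serves left of the crest and the real part right of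
it. -/
theorem injOn (H : IsHodograph θ us Z) : InjOn Z closedStrip := by
  have key : ∀ x₁ y₁ x₂ y₂ : ℝ, y₁ ∈ Icc 0 (Real.pi / 2) → y₂ ∈ Icc 0 (Real.pi / 2) →
      x₁ ≤ x₂ → Z (x₁ + y₁ * I) = Z (x₂ + y₂ * I) → x₁ = x₂ ∧ y₁ = y₂ := by
    intro x₁ y₁ x₂ y₂ h1 h2 hx he
    rcases lt_trichotomy y₁ y₂ with hy | hy | hy
    · have a1 := H.monotone_horizontal_re h1 hx
      have a2 := H.strictMonoOn_vertical_re x₂ h1 h2 hy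
      simp only [he] at a1 a2
      linarith
    · subst hy
      refine ⟨?_, rfl⟩
      by_contra hne
      have hlt := lt_of_le_of_ne hx hne
      rcases h1.1.eq_or_lt with h | h
      · subst h
        simp only [ofReal_zero, zero_mul, add_zero] at he
        rcases le_total x₂ (-Real.log us) with h3 | h3
        · have := H.bottom_left_im_ge hx h3
          rw [he] at this
          linarith
        · rcases le_total (-Real.log us) x₁ with h4 | h4
          · have := H.strictMonoOn_bottom_re h4 h3 hlt
            simp only [he] at this
            linarith
          · rcases h3.eq_or_lt with h5 | h5
            · have := H.bottom_left_im_ge hx h5.ge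
              rw [he] at this
              linarith
            · have := H.strictMonoOn_bottom_re self_mem_Ici h3 h5
              simp only [← he, H.bottom_left_re h4, H.crest, zero_re] at this
              linarith
      · rcases h1.2.eq_or_lt with h' | h'
        · subst h'
          have := H.strictMono_top_re hlt
          simp only [he] at this
          linarith
        · have := H.strictMono_horizontal_re ⟨h, h'⟩ hlt
          simp only [he] at this
          linarith
    · have a1 := H.antitone_horizontal_im h1 hx
      have a2 := H.strictMonoOn_vertical_im x₂ h2 h1 hy
      simp only [he] at a1 a2
      linarith
  intro w₁ h1 w₂ h2 he
  rw [← re_add_im w₁, ← re_add_im w₂] at he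
  rcases le_total w₁.re w₂.re with h | h
  · obtain ⟨a, b⟩ := key _ _ _ _ h1 h2 h he
    exact Complex.ext a b
  · obtain ⟨a, b⟩ := key _ _ _ _ h2 h1 h he.symm
    exact Complex.ext a.symm b.symm

end IsHodograph

theorem exists_isHodograph {θ us : ℝ} (hθ : 1 < θ) (hus : 0 < us) (h0 : f θ us = 0) :
    ∃ Z, IsHodograph θ us Z := by
  obtain ⟨Z, h1, h2⟩ := exists_isStripPrimitive (θ := θ) (by linarith) ((-Real.log us : ℝ) : ℂ)
  exact ⟨Z, ⟨h1, hθ, hus, h0, h2⟩⟩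

/-! ### The integrals `J₁` and `J₂` as values of the hodograph map -/

namespace IsHodograph

variable {θ us : ℝ} {Z : ℂ → ℂ}

theorem hasDerivAt_bottom_log (H : IsHodograph θ us Z) {u : ℝ} (hu : 0 < u) (hne : u ≠ us) :
    HasDerivAt (fun u : ℝ => Z (-Real.log u : ℝ)) (-(1 / Complex.sqrt (f θ u))) u := by
  have hx : -Real.log u ≠ -Real.log us := fun h =>
    hne (Real.log_injOn_pos hu H.root_pos (neg_injective h))
  have hl : HasDerivAt (fun u : ℝ => -Real.log u) (-u⁻¹) u := (Real.hasDerivAt_log hu.ne').neg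
  have h := (H.hasDerivAt_bottom hx).scomp u hl
  have hf : f θ u ≠ 0 := f_ne_zero_of_ne_root H.theta_pos H.root H.root_pos hu hne
  have e : Real.exp (- -Real.log u) = u := by rw [neg_neg, Real.exp_log hu]
  rw [slope_bottom (by rwa [e]), e] at h
  refine h.congr_deriv ?_
  rw [real_smul]
  have : (u : ℂ) ≠ 0 := by exact_mod_cast hu.ne'
  push_cast
  field_simp

theorem hasDerivAt_top_log (H : IsHodograph θ us Z) {u : ℝ} (hu : 0 < u) (hu1 : u < 1) :
    HasDerivAt (fun u : ℝ => Z ((-Real.log u : ℝ) + (Real.pi / 2 : ℝ) * I))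
      (-(1 / Complex.sqrt (g θ u))) u := by
  have hx : 0 < -Real.log u := by linarith [Real.log_neg hu hu1]
  have hl : HasDerivAt (fun u : ℝ => -Real.log u) (-u⁻¹) u := (Real.hasDerivAt_log hu.ne').neg
  have h := (H.hasDerivAt_top hx.ne').scomp u hl
  have e : Real.exp (- -Real.log u) = u := by rw [neg_neg, Real.exp_log hu]
  rw [slope_top H.one_lt hx, e] at h
  refine h.congr_deriv ?_
  rw [real_smul]
  have : (u : ℂ) ≠ 0 := by exact_mod_cast hu.ne'
  push_cast
  field_simp

theorem continuousOn_bottom_log (H : IsHodograph θ us Z) :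
    ContinuousOn (fun u : ℝ => Z (-Real.log u : ℝ)) (Ioi 0) :=
  H.continuous_bottom.comp_continuousOn
    ((Real.continuousOn_log.mono fun _ hu => ne_of_gt hu).neg)

theorem continuousOn_top_log (H : IsHodograph θ us Z) :
    ContinuousOn (fun u : ℝ => Z ((-Real.log u : ℝ) + (Real.pi / 2 : ℝ) * I)) (Ioi 0) :=
  H.continuous_top.comp_continuousOn
    ((Real.continuousOn_log.mono fun _ hu => ne_of_gt hu).neg)

theorem f_exp_nonneg (H : IsHodograph θ us Z) {u : ℝ} (hu : 0 < u) (h : u ≤ us) : 0 ≤ f θ u := by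
  rcases h.eq_or_lt with rfl | h
  · exact H.root.ge
  · exact (f_pos_of_lt_root H.theta_pos H.root hu h).le

theorem g_pos (H : IsHodograph θ us Z) {u : ℝ} (hu : 0 < u) (hu1 : u < 1) : 0 < g θ u := by
  have := g_exp_pos H.one_lt (x := -Real.log u) (by linarith [Real.log_neg hu hu1])
  rwa [neg_neg, Real.exp_log hu] at this

/-- A nonnegative derivative of a continuous function is integrable, so the singularity at the crest
needs no expansion of `f`. -/
theorem intervalIntegrable_inv_sqrt_f_left (H : IsHodograph θ us Z) {a b : ℝ} (ha : 0 < a)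
    (hab : a ≤ b) (hb : b ≤ us) :
    IntervalIntegrable (fun u : ℝ => 1 / Complex.sqrt (f θ u)) volume a b := by
  have h := intervalIntegral.intervalIntegrable_deriv_of_nonneg (a := a) (b := b)
    (g := fun u : ℝ => -(Z (-Real.log u : ℝ)).re) (g' := fun u => (√(f θ u))⁻¹)
    (by
      rw [uIcc_of_le hab]
      exact (continuous_re.comp_continuousOn (H.continuousOn_bottom_log.mono fun u hu =>
        ha.trans_le hu.1)).neg)
    (by
      rw [min_eq_left hab, max_eq_right hab]
      intro u hu
      have hu0 := ha.trans hu.1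
      have hd := hasDerivAt_re (H.hasDerivAt_bottom_log hu0 (hu.2.trans_le hb).ne)
      refine hd.neg.congr_deriv ?_
      rw [sqrt_ofReal_pos (H.f_exp_nonneg hu0 (hu.2.trans_le hb).le), one_div, ← ofReal_inv,
        ← ofReal_neg, ofReal_re, neg_neg])
    (fun u _ => by positivity)
  have h2 : IntervalIntegrable (fun u : ℝ => (((√(f θ u))⁻¹ : ℝ) : ℂ)) volume a b :=
    ⟨h.1.ofReal, h.2.ofReal⟩
  refine h2.congr ?_
  rw [uIoc_of_le hab]
  intro u hu
  simp only
  rw [sqrt_ofReal_pos (H.f_exp_nonneg (ha.trans hu.1) (hu.2.trans hb)), one_div, ← ofReal_inv]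

theorem intervalIntegrable_inv_sqrt_f_right (H : IsHodograph θ us Z) {a b : ℝ} (ha : us ≤ a)
    (hab : a ≤ b) : IntervalIntegrable (fun u : ℝ => 1 / Complex.sqrt (f θ u)) volume a b := by
  have hus := H.root_pos
  have e : ∀ u, us < u → 1 / Complex.sqrt (f θ u) = -((((√(-f θ u))⁻¹ : ℝ) : ℂ) * I) := by
    intro u hu
    have hf := f_neg_of_root_lt H.theta_pos H.root H.root_pos hu
    rw [sqrt_ofReal_neg hf.le, div_mul_eq_div_div, one_div, inv_I, ofReal_inv, div_eq_mul_inv]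
    ring
  have h := intervalIntegral.intervalIntegrable_deriv_of_nonneg (a := a) (b := b)
    (g := fun u : ℝ => (Z (-Real.log u : ℝ)).im) (g' := fun u => (√(-f θ u))⁻¹)
    (by
      rw [uIcc_of_le hab]
      exact (continuous_im.comp_continuousOn (H.continuousOn_bottom_log.mono fun u hu =>
        (hus.trans_le ha).trans_le hu.1)))
    (by
      rw [min_eq_left hab, max_eq_right hab]
      intro u hu
      have hu0 := ha.trans_lt hu.1
      have hd := hasDerivAt_im (H.hasDerivAt_bottom_log (hus.trans hu0) hu0.ne')
      refine hd.congr_deriv ?_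
      rw [e u hu0, neg_neg, im_ofReal_mul, I_im, mul_one])
    (fun u _ => by positivity)
  have h2 : IntervalIntegrable (fun u : ℝ => -((((√(-f θ u))⁻¹ : ℝ) : ℂ) * I)) volume a b :=
    (IntervalIntegrable.mul_const (f := fun u : ℝ => (((√(-f θ u))⁻¹ : ℝ) : ℂ))
      ⟨h.1.ofReal, h.2.ofReal⟩ I).neg
  refine h2.congr ?_
  rw [uIoc_of_le hab]
  intro u hu
  exact (e u (ha.trans_lt hu.1)).symm

theorem intervalIntegrable_inv_sqrt_f (H : IsHodograph θ us Z) {a b : ℝ} (ha : 0 < a)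
    (hb : 0 < b) : IntervalIntegrable (fun u : ℝ => 1 / Complex.sqrt (f θ u)) volume a b := by
  have key : ∀ a, 0 < a → IntervalIntegrable (fun u : ℝ => 1 / Complex.sqrt (f θ u)) volume a us := by
    intro a ha
    rcases le_total a us with h | h
    · exact H.intervalIntegrable_inv_sqrt_f_left ha h le_rfl
    · exact (H.intervalIntegrable_inv_sqrt_f_right le_rfl h).symm
  exact (key a ha).trans (key b hb).symm

theorem intervalIntegrable_inv_sqrt_g (H : IsHodograph θ us Z) {a : ℝ} (ha : 0 < a)
    (ha1 : a ≤ 1) : IntervalIntegrable (fun u : ℝ => 1 / Complex.sqrt (g θ u)) volume a 1 := by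
  have h := intervalIntegral.intervalIntegrable_deriv_of_nonneg (a := a) (b := 1)
    (g := fun u : ℝ => -(Z ((-Real.log u : ℝ) + (Real.pi / 2 : ℝ) * I)).re)
    (g' := fun u => (√(g θ u))⁻¹)
    (by
      rw [uIcc_of_le ha1]
      exact (continuous_re.comp_continuousOn (H.continuousOn_top_log.mono fun u hu =>
        ha.trans_le hu.1)).neg)
    (by
      rw [min_eq_left ha1, max_eq_right ha1]
      intro u hu
      have hu0 := ha.trans hu.1
      have hd := hasDerivAt_re (H.hasDerivAt_top_log hu0 hu.2)
      refine hd.neg.congr_deriv ?_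
      rw [sqrt_ofReal_pos (H.g_pos hu0 hu.2).le, one_div, ← ofReal_inv,
        ← ofReal_neg, ofReal_re, neg_neg])
    (fun u _ => by positivity)
  have h2 : IntervalIntegrable (fun u : ℝ => (((√(g θ u))⁻¹ : ℝ) : ℂ)) volume a 1 :=
    ⟨h.1.ofReal, h.2.ofReal⟩
  refine h2.congr_ae ?_
  rw [uIoc_of_le ha1]
  have : ∀ᵐ u : ℝ ∂volume, u ≠ 1 := by simp [ae_iff]
  filter_upwards [ae_restrict_of_ae this, ae_restrict_mem measurableSet_Ioc] with u hu1 hu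
  rw [sqrt_ofReal_pos (H.g_pos (ha.trans hu.1) (lt_of_le_of_ne hu.2 hu1)).le, one_div, ← ofReal_inv]

theorem J₁_eq (H : IsHodograph θ us Z) : J₁ θ = Z 0 := by
  rw [J₁, uStar_eq_of_root H.theta_pos H.root H.root_pos]
  have hsub : [[(1 : ℝ), us]] ⊆ Ioi 0 := fun u hu =>
    (lt_min one_pos H.root_pos).trans_le hu.1
  have h := integral_eq_of_hasDerivAt_off_countable (fun u : ℝ => -Z (-Real.log u : ℝ))
    (fun u : ℝ => 1 / Complex.sqrt (f θ u)) (a := 1) (b := us) (countable_singleton us)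
    (H.continuousOn_bottom_log.mono hsub).neg
    (fun u hu => by
      have := (H.hasDerivAt_bottom_log (hsub (Ioo_subset_Icc_self hu.1)) hu.2).neg
      rwa [neg_neg] at this)
    (H.intervalIntegrable_inv_sqrt_f one_pos H.root_pos)
  rw [h, H.crest]
  simp

/-- Each of the two edge values diverges at `u = 0`, but their difference tends to `i β`; the update
inserts this limit. -/
theorem continuousOn_rise (H : IsHodograph θ us Z) :
    ContinuousOn (Function.update
      (fun u : ℝ => Z ((-Real.log u : ℝ) + (Real.pi / 2 : ℝ) * I) - Z (-Real.log u : ℝ))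
      0 (beta θ * I)) (Icc 0 1) := by
  rw [continuousOn_update_iff]
  constructor
  · intro u hu
    have hu0 : u ∈ Ioi (0 : ℝ) := lt_of_le_of_ne hu.1.1 (Ne.symm hu.2)
    exact ((H.continuousOn_top_log.sub H.continuousOn_bottom_log).mono
      (fun v hv => lt_of_le_of_ne hv.1.1 (Ne.symm hv.2))) u hu
  · intro _
    have h1 : Tendsto (fun u : ℝ => -Real.log u) (𝓝[Icc 0 1 \ {0}] 0) atTop := by
      have := Real.tendsto_log_nhdsGT_zero
      exact tendsto_neg_atBot_atTop.comp (this.mono_left (nhdsWithin_mono _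
        fun v hv => lt_of_le_of_ne hv.1.1 (Ne.symm hv.2)))
    exact H.tendsto_top_sub_bottom.comp h1

theorem f_le_g (H : IsHodograph θ us Z) {u : ℝ} (hu : 0 < u) (hu1 : u < 1) : f θ u ≤ g θ u := by
  have h1 : 0 < 1 - u ^ 2 := by nlinarith
  have h2 : Real.log ((1 + u ^ 2) * (1 - u ^ 2)) ≤ 0 :=
    Real.log_nonpos (by positivity) (by nlinarith [sq_nonneg (u ^ 2)])
  rw [Real.log_mul (by positivity) h1.ne'] at h2
  have := H.theta_pos
  unfold f g
  nlinarith

theorem hasDerivAt_rise (H : IsHodograph θ us Z) {u : ℝ} (hu : 0 < u) (hu1 : u < 1)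
    (hne : u ≠ us) : HasDerivAt (Function.update
      (fun u : ℝ => Z ((-Real.log u : ℝ) + (Real.pi / 2 : ℝ) * I) - Z (-Real.log u : ℝ))
      0 (beta θ * I)) (1 / Complex.sqrt (f θ u) - 1 / Complex.sqrt (g θ u)) u := by
  have h := (H.hasDerivAt_top_log hu hu1).sub (H.hasDerivAt_bottom_log hu hne)
  rw [neg_sub_neg] at h
  refine h.congr_of_eventuallyEq ?_
  filter_upwards [lt_mem_nhds hu] with v hv
  rw [Function.update_of_ne hv.ne']
  rfl

theorem intervalIntegrable_rise (H : IsHodograph θ us Z) :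
    IntervalIntegrable (fun u : ℝ => 1 / Complex.sqrt (f θ u) - 1 / Complex.sqrt (g θ u))
      volume 0 1 := by
  -- Below `ε` both `f` and `g` are positive and `f ≤ g`, so the real difference is nonnegative and
  -- integrable as a derivative. Beyond `ε` the two terms are integrable separately.
  set ε := min us 1 / 2 with hε
  have hmin : 0 < min us 1 := lt_min H.root_pos one_pos
  have hε0 : 0 < ε := by positivity
  have hεus : ε < us := by linarith [min_le_left us 1]
  have hε1 : ε < 1 := by linarith [min_le_right us 1]
  have hright := (H.intervalIntegrable_inv_sqrt_f hε0 one_pos).sub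
    (H.intervalIntegrable_inv_sqrt_g hε0 hε1.le)
  refine IntervalIntegrable.trans ?_ hright
  have e : ∀ u ∈ Ioc 0 ε, 1 / Complex.sqrt (f θ u) - 1 / Complex.sqrt (g θ u) =
      (((√(f θ u))⁻¹ - (√(g θ u))⁻¹ : ℝ) : ℂ) := by
    intro u hu
    rw [sqrt_ofReal_pos (H.f_exp_nonneg hu.1 (hu.2.trans hεus.le)),
      sqrt_ofReal_pos (H.g_pos hu.1 (hu.2.trans_lt hε1)).le]
    push_cast; simp
  have h := intervalIntegral.intervalIntegrable_deriv_of_nonneg (a := 0) (b := ε)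
    (g' := fun u => (√(f θ u))⁻¹ - (√(g θ u))⁻¹)
    (by
      rw [uIcc_of_le hε0.le]
      exact continuous_re.comp_continuousOn (H.continuousOn_rise.mono
        (Icc_subset_Icc_right hε1.le)))
    (by
      rw [min_eq_left hε0.le, max_eq_right hε0.le]
      intro u hu
      have hd := hasDerivAt_re (H.hasDerivAt_rise hu.1 (hu.2.trans hε1) (hu.2.trans hεus).ne)
      rwa [e u ⟨hu.1, hu.2.le⟩, ofReal_re] at hd)
    (by
      rw [min_eq_left hε0.le, max_eq_right hε0.le]
      intro u hu
      have hf := f_pos_of_lt_root H.theta_pos H.root hu.1 (hu.2.trans hεus)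
      have := Real.sqrt_le_sqrt (H.f_le_g hu.1 (hu.2.trans hε1))
      rw [sub_nonneg]
      gcongr)
  have h2 : IntervalIntegrable (fun u : ℝ => (((√(f θ u))⁻¹ - (√(g θ u))⁻¹ : ℝ) : ℂ))
      volume 0 ε := ⟨h.1.ofReal, h.2.ofReal⟩
  refine h2.congr ?_
  rw [uIoc_of_le hε0.le]
  intro u hu
  exact (e u hu).symm

theorem integral_rise (H : IsHodograph θ us Z) :
    ∫ u in (0 : ℝ)..1, (1 / Complex.sqrt (f θ u) - 1 / Complex.sqrt (g θ u)) =
      Z ((Real.pi / 2 : ℝ) * I) - Z 0 - beta θ * I := by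
  -- The crest is the exceptional point; it lies inside the interval when `u* < 1`.
  have h := integral_eq_of_hasDerivAt_off_countable _
    (fun u : ℝ => 1 / Complex.sqrt (f θ u) - 1 / Complex.sqrt (g θ u)) (a := 0) (b := 1)
    (countable_singleton us)
    (by rw [uIcc_of_le zero_le_one]; exact H.continuousOn_rise)
    (fun u hu => by
      rw [min_eq_left zero_le_one, max_eq_right zero_le_one] at hu
      exact H.hasDerivAt_rise hu.1.1 hu.1.2 hu.2)
    H.intervalIntegrable_rise
  rw [h, Function.update_self, Function.update_of_ne one_ne_zero]
  simp

theorem sqrt_f_ne_zero (H : IsHodograph θ us Z) {u : ℝ} (hu : 0 < u) (hne : u ≠ us) :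
    Complex.sqrt (f θ u) ≠ 0 := by
  have hf : (f θ u : ℂ) ≠ 0 := by
    exact_mod_cast f_ne_zero_of_ne_root H.theta_pos H.root H.root_pos hu hne
  rw [sqrt_eq_exp hf]
  exact Complex.exp_ne_zero _

theorem sqrt_sq (r : ℝ) : Complex.sqrt r * Complex.sqrt r = r := by
  rcases le_total 0 r with h | h
  · rw [sqrt_ofReal_pos h, ← ofReal_mul, Real.mul_self_sqrt h]
  · rw [sqrt_ofReal_neg h, mul_mul_mul_comm, ← ofReal_mul, Real.mul_self_sqrt (by linarith),
      I_mul_I]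
    push_cast; ring

/-- The integrand of `J₂`, with its sign, is `1 / √f - 1 / √g` with the numerator rationalised,
because `f - g = θ (log (1 + u²) + log (1 - u²))`. The denominator does not vanish since `√g > 0`
and `Re √f ≥ 0`. -/
theorem J₂_eq (H : IsHodograph θ us Z) :
    J₂ θ = Z ((Real.pi / 2 : ℝ) * I) - Z 0 - beta θ * I := by
  rw [← H.integral_rise, J₂, ← intervalIntegral.integral_neg]
  apply intervalIntegral.integral_congr_ae
  have h1 : ∀ᵐ u : ℝ ∂volume, u ≠ 1 := by simp [ae_iff]
  have h2 : ∀ᵐ u : ℝ ∂volume, u ≠ us := by simp [ae_iff]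
  filter_upwards [h1, h2] with u hu1 hus hu
  rw [uIoc_of_le zero_le_one] at hu
  have hlt : u < 1 := lt_of_le_of_ne hu.2 hu1
  have hg := H.g_pos hu.1 hlt
  have hg0 : Complex.sqrt (g θ u) = (√(g θ u) : ℝ) := sqrt_ofReal_pos hg.le
  have hgs : 0 < √(g θ u) := Real.sqrt_pos.2 hg
  have hgne : Complex.sqrt (g θ u) ≠ 0 := by rw [hg0]; exact_mod_cast hgs.ne'
  have hfne := H.sqrt_f_ne_zero hu.1 hus
  have hsum : Complex.sqrt (f θ u) + Complex.sqrt (g θ u) ≠ 0 := by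
    intro h
    have hre := congrArg re h
    rw [hg0, add_re, ofReal_re, re_sqrt_ofReal, zero_re] at hre
    linarith [Real.sqrt_nonneg (f θ u)]
  have hnum : ((θ * (Real.log (1 + u ^ 2) + Real.log (1 - u ^ 2)) : ℝ) : ℂ) =
      Complex.sqrt (f θ u) * Complex.sqrt (f θ u) - Complex.sqrt (g θ u) * Complex.sqrt (g θ u) := by
    rw [sqrt_sq, sqrt_sq, ← ofReal_sub]
    congr 1
    unfold f g; ring
  rw [hnum]
  field_simp
  ring

theorem J₁_add_J₂ (H : IsHodograph θ us Z) :
    J₁ θ + J₂ θ = ((Z ((Real.pi / 2 : ℝ) * I)).re : ℂ) := by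
  rw [H.J₁_eq, H.J₂_eq]
  have him := H.top_im le_rfl
  simp only [ofReal_zero, zero_add] at him
  have h := re_add_im (Z ((Real.pi / 2 : ℝ) * I))
  rw [him] at h
  linear_combination -h

theorem alpha_eq (H : IsHodograph θ us Z) : alpha θ = (Z ((Real.pi / 2 : ℝ) * I)).re := by
  rw [alpha, H.J₁_add_J₂, ofReal_re]

theorem alpha_pos (H : IsHodograph θ us Z) : 0 < alpha θ := by
  rw [H.alpha_eq]
  simpa using H.re_pos 0 (y := Real.pi / 2) ⟨by positivity, le_rfl⟩

theorem apply_top_zero (H : IsHodograph θ us Z) :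
    Z ((Real.pi / 2 : ℝ) * I) = alpha θ + beta θ * I := by
  have him := H.top_im le_rfl
  simp only [ofReal_zero, zero_add] at him
  rw [H.alpha_eq, ← him, re_add_im]

end IsHodograph

/-! ### Continuation across the edge `p > 1`, where `p = i u` -/

/-- The strip coordinate `w = -log u` of the point `u = -i p`. -/
def stripCoord (p : ℂ) : ℂ := -log (-I * p)

/-- The continuation of `f (-i p)` from the first quadrant to the half-plane `Re p > 1`. -/
def contF (θ : ℝ) (p : ℂ) : ℂ := θ * (log (1 + p) + log (p - 1) - Real.pi * I) + p ^ 2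

/-- `dz / dp` on the half-plane `Re p > 1`. -/
def contSlope (θ : ℝ) (p : ℂ) : ℂ := I * exp (-(log (contF θ p) / 2))

/-- The half-plane `Re p > 1`. -/
def halfPlane : Set ℂ := {p | 1 < p.re}

theorem isOpen_halfPlane : IsOpen halfPlane := isOpen_lt continuous_const continuous_re

theorem convex_halfPlane : Convex ℝ halfPlane := convex_halfSpace_re_gt 1

theorem exp_neg_stripCoord {p : ℂ} (hp : p ≠ 0) : exp (-stripCoord p) = -I * p := by
  rw [stripCoord, neg_neg, exp_log (by simpa using hp)]

theorem stripCoord_mem_closedStrip {p : ℂ} (hre : 0 ≤ p.re) (him : 0 ≤ p.im) :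
    stripCoord p ∈ closedStrip := by
  have h1 : |arg (-I * p)| ≤ Real.pi / 2 := by
    rw [abs_arg_le_pi_div_two_iff]; simpa using him
  have h2 : arg (-I * p) ≤ 0 := by
    rcases hre.eq_or_lt with h | h
    · have e : -I * p = (p.im : ℝ) := by
        apply Complex.ext <;> simp [← h]
      rw [e, arg_ofReal_of_nonneg him]
    · exact (arg_neg_iff.2 (by simpa using h)).le
  rw [abs_le] at h1
  simp only [closedStrip, mem_ofPred_eq, stripCoord, neg_im, log_im]
  constructor <;> linarith [h1.1]

theorem stripCoord_mem_openStrip {p : ℂ} (hre : 0 < p.re) (him : 0 < p.im) :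
    stripCoord p ∈ openStrip := by
  have h1 : |arg (-I * p)| < Real.pi / 2 := by
    rw [abs_arg_lt_pi_div_two_iff]; left; simpa using him
  have h2 : arg (-I * p) < 0 := arg_neg_iff.2 (by simpa using hre)
  rw [abs_lt] at h1
  simp only [openStrip, mem_ofPred_eq, stripCoord, neg_im, log_im]
  constructor <;> linarith [h1.1]

theorem hasDerivAt_stripCoord {p : ℂ} (him : 0 ≤ p.im) (hp : p ≠ 0) :
    HasDerivAt stripCoord (-1 / p) p := by
  have h1 : HasDerivAt (fun p => -I * p) (-I) p := by
    simpa using (hasDerivAt_id p).const_mul (-I)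
  have h := (h1.clog (negI_mul_mem_slitPlane him hp)).neg
  refine h.congr_deriv ?_
  have := I_ne_zero
  field_simp

theorem stripCoord_I_mul_exp {w : ℂ} (hw : w ∈ closedStrip) : stripCoord (I * exp (-w)) = w := by
  have h : log (exp (-w)) = -w := by
    apply log_exp
    · simp only [neg_im]; linarith [hw.2, Real.pi_pos]
    · simp only [neg_im]; linarith [hw.1, Real.pi_pos]
  rw [stripCoord, ← mul_assoc, neg_mul, I_mul_I, neg_neg, one_mul, h, neg_neg]

theorem stripCoord_ofReal {x : ℝ} (hx : 0 < x) :
    stripCoord x = (-Real.log x : ℝ) + (Real.pi / 2 : ℝ) * I := by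
  have e : (x : ℂ) = I * exp (-((-Real.log x : ℝ) + (Real.pi / 2 : ℝ) * I)) := by
    rw [neg_add, Complex.exp_add, ofReal_neg, neg_neg, ofReal_log hx.le,
      exp_log (by exact_mod_cast hx.ne'), Complex.exp_neg, exp_pi_div_two_mul_I]
    field_simp
  conv_lhs => rw [e]
  exact stripCoord_I_mul_exp (IsHodograph.mem_closedStrip ⟨by positivity, le_rfl⟩)

theorem arg_abs_le_of_halfPlane {p : ℂ} (hp : p ∈ halfPlane) :
    |arg (1 + p)| ≤ Real.pi / 2 ∧ |arg (p - 1)| ≤ Real.pi / 2 := by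
  have hp' : 1 < p.re := hp
  rw [abs_arg_le_pi_div_two_iff, abs_arg_le_pi_div_two_iff]
  constructor
  · simp; linarith
  · simp; linarith

theorem one_add_ne_zero_of_halfPlane {p : ℂ} (hp : p ∈ halfPlane) : 1 + p ≠ 0 := by
  intro h
  have := congrArg re h
  have hp' : 1 < p.re := hp
  simp at this; linarith

theorem sub_one_ne_zero_of_halfPlane {p : ℂ} (hp : p ∈ halfPlane) : p - 1 ≠ 0 := by
  intro h
  have := congrArg re h
  have hp' : 1 < p.re := hp
  simp at this; linarith

theorem ne_zero_of_halfPlane {p : ℂ} (hp : p ∈ halfPlane) : p ≠ 0 := by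
  rintro rfl
  have hp' : (1 : ℝ) < (0 : ℂ).re := hp
  simp at hp'; linarith

/-- Factor `1 - p² = -(1 + p)(p - 1)`. For `Im p ≥ 0` both arguments lie in `[0, π / 2]`, so after
subtracting `π` their sum lies in the range `[-π, 0]` of `logLower`. -/
theorem logLower_one_sub_sq {p : ℂ} (hp : p ∈ halfPlane) (him : 0 ≤ p.im) :
    logLower (1 - p ^ 2) = log (1 + p) + log (p - 1) - Real.pi * I := by
  obtain ⟨h1, h2⟩ := arg_abs_le_of_halfPlane hp
  have h3 : 0 ≤ arg (1 + p) := arg_nonneg_iff.2 (by simpa using him)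
  have h4 : 0 ≤ arg (p - 1) := arg_nonneg_iff.2 (by simpa using him)
  rw [abs_le] at h1 h2
  apply logLower_eq_of_exp_eq
  · rw [Complex.exp_sub, exp_pi_mul_I, Complex.exp_add, exp_log (one_add_ne_zero_of_halfPlane hp),
      exp_log (sub_one_ne_zero_of_halfPlane hp)]
    ring
  · simp only [sub_im, add_im, log_im, im_ofReal_mul, I_im, mul_one]
    linarith [Real.pi_pos]
  · simp only [sub_im, add_im, log_im, im_ofReal_mul, I_im, mul_one]
    linarith [Real.pi_pos]

theorem contF_eq {θ : ℝ} {p : ℂ} (hp : p ∈ halfPlane) (him : 0 ≤ p.im) :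
    contF θ p = exp (-2 * stripCoord p) * quotF θ (stripCoord p) := by
  have e : exp (-2 * stripCoord p) = -p ^ 2 := by
    rw [show -2 * stripCoord p = ((2 : ℕ) : ℂ) * (-stripCoord p) by push_cast; ring,
      Complex.exp_nat_mul, exp_neg_stripCoord (ne_zero_of_halfPlane hp)]
    rw [mul_pow, neg_sq, I_sq]; ring
  have e2 : exp (2 * stripCoord p) * exp (-2 * stripCoord p) = 1 := by
    rw [← Complex.exp_add]; simp
  rw [quotF, contF, ← logLower_one_sub_sq hp him]
  rw [show (1 : ℂ) + exp (-2 * stripCoord p) = 1 - p ^ 2 by rw [e]; ring]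
  rw [show exp (-2 * stripCoord p) * (θ * logLower (1 - p ^ 2) * exp (2 * stripCoord p) - 1) =
    θ * logLower (1 - p ^ 2) * (exp (2 * stripCoord p) * exp (-2 * stripCoord p)) -
      exp (-2 * stripCoord p) by ring, e2, e]
  ring

/-- The two imaginary parts on the right lie in `(-π, 0)` and `(0, π)`, so their sum is a principal
argument and no branch jump occurs. -/
theorem log_contF {θ : ℝ} (hθ : 0 < θ) {p : ℂ} (hp : p ∈ halfPlane) (him : 0 < p.im) :
    log (contF θ p) = -2 * stripCoord p + logUpper (quotF θ (stripCoord p)) ∧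
      contF θ p ∈ slitPlane := by
  have hp' : 1 < p.re := hp
  have hw := stripCoord_mem_openStrip (by linarith) him
  have hq := quotF_im_pos hθ hw
  obtain ⟨h1, h2⟩ := logUpper_im_mem hq
  have hexp : exp (-2 * stripCoord p + logUpper (quotF θ (stripCoord p))) = contF θ p := by
    rw [contF_eq hp him.le, Complex.exp_add, exp_logUpper]
    intro h; simp [h] at hq
  have him' : (-2 * stripCoord p + logUpper (quotF θ (stripCoord p))).im =
      -2 * (stripCoord p).im + (logUpper (quotF θ (stripCoord p))).im := by simp
  have b1 : -Real.pi < (-2 * stripCoord p + logUpper (quotF θ (stripCoord p))).im := by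
    rw [him']; linarith [hw.2]
  have b2 : (-2 * stripCoord p + logUpper (quotF θ (stripCoord p))).im < Real.pi := by
    rw [him']; linarith [hw.1]
  have hlog := log_eq_of_exp_eq hexp b1 b2.le
  refine ⟨hlog, ?_⟩
  rw [mem_slitPlane_iff_arg]
  refine ⟨?_, by rw [← hexp]; exact Complex.exp_ne_zero _⟩
  rw [← log_im, hlog]
  exact b2.ne

/-- For `Im p ≤ 0` neither logarithm has positive argument, `-π θ` is strictly negative, and `Im p²
= 2 Re p Im p ≤ 0`. The continued square root thus keeps `contSlope` in the open second quadrant. -/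
theorem contF_im_neg {θ : ℝ} (hθ : 0 < θ) {p : ℂ} (hp : p ∈ halfPlane) (him : p.im ≤ 0) :
    (contF θ p).im < 0 := by
  have hp' : 1 < p.re := hp
  have key : ∀ z : ℂ, 0 < z.re → z.im ≤ 0 → arg z ≤ 0 := by
    intro z h1 h2
    rcases h2.eq_or_lt with h | h
    · rw [show z = (z.re : ℝ) from Complex.ext (by simp) (by simp [h]),
        arg_ofReal_of_nonneg h1.le]
    · exact (arg_neg_iff.2 h).le
  have h1 := key (1 + p) (by simp; linarith) (by simpa using him)
  have h2 := key (p - 1) (by simp; linarith) (by simpa using him)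
  have e : (contF θ p).im = θ * (arg (1 + p) + arg (p - 1) - Real.pi) + 2 * p.re * p.im := by
    simp only [contF, add_im, sub_im, log_im, I_im, I_re, mul_one, mul_zero, sq, mul_im, ofReal_re,
      ofReal_im]
    ring
  rw [e]
  have h3 : θ * (arg (1 + p) + arg (p - 1) - Real.pi) < 0 :=
    mul_neg_of_pos_of_neg hθ (by linarith [Real.pi_pos])
  nlinarith

theorem contF_mem_slitPlane {θ : ℝ} (hθ : 0 < θ) {p : ℂ} (hp : p ∈ halfPlane) :
    contF θ p ∈ slitPlane := by
  rcases lt_or_ge 0 p.im with h | h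
  · exact (log_contF hθ hp h).2
  · exact mem_slitPlane_iff.2 (Or.inr (contF_im_neg hθ hp h).ne)

theorem differentiableAt_contSlope {θ : ℝ} (hθ : 0 < θ) {p : ℂ} (hp : p ∈ halfPlane) :
    DifferentiableAt ℂ (contSlope θ) p := by
  have hp' : 1 < p.re := hp
  have h1 : DifferentiableAt ℂ (fun p : ℂ => log (1 + p)) p :=
    DifferentiableAt.clog (by fun_prop) (mem_slitPlane_iff.2 (Or.inl (by simp; linarith)))
  have h2 : DifferentiableAt ℂ (fun p : ℂ => log (p - 1)) p :=
    DifferentiableAt.clog (by fun_prop) (mem_slitPlane_iff.2 (Or.inl (by simp; linarith)))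
  have h3 : DifferentiableAt ℂ (contF θ) p := by unfold contF; fun_prop
  have h4 : DifferentiableAt ℂ (fun p => log (contF θ p)) p :=
    h3.clog (contF_mem_slitPlane hθ hp)
  unfold contSlope
  fun_prop

theorem contSlope_eq {θ : ℝ} (hθ : 0 < θ) {p : ℂ} (hp : p ∈ halfPlane) (him : 0 < p.im) :
    contSlope θ p = slope θ (stripCoord p) * (-1 / p) := by
  have hp0 := ne_zero_of_halfPlane hp
  rw [contSlope, (log_contF hθ hp him).1, slope]
  rw [show -((-2 * stripCoord p + logUpper (quotF θ (stripCoord p))) / 2) =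
    -(-stripCoord p) + -(logUpper (quotF θ (stripCoord p)) / 2) by ring, Complex.exp_add,
    Complex.exp_neg, exp_neg_stripCoord hp0]
  have := I_ne_zero
  field_simp

theorem contSlope_re_neg_im_pos {θ : ℝ} (hθ : 0 < θ) {p : ℂ} (hp : p ∈ halfPlane)
    (him : p.im ≤ 0) : (contSlope θ p).re < 0 ∧ 0 < (contSlope θ p).im := by
  have h1 : arg (contF θ p) < 0 := arg_neg_iff.2 (contF_im_neg hθ hp him)
  have h2 := neg_pi_lt_arg (contF θ p)
  have e : (-(log (contF θ p) / 2)).im = -(arg (contF θ p) / 2) := by simp [log_im]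
  rw [contSlope, I_mul_re, I_mul_im, exp_re, exp_im, e]
  constructor
  · rw [neg_lt_zero]
    exact mul_pos (Real.exp_pos _) (Real.sin_pos_of_pos_of_lt_pi (by linarith)
      (by linarith [Real.pi_pos]))
  · exact mul_pos (Real.exp_pos _) (Real.cos_pos_of_mem_Ioo ⟨by linarith, by linarith⟩)

/-- The continuation of the hodograph map across the part `u = -i v`, `v > 1`, of the imaginary
axis, in the coordinate `p = i u`. -/
structure IsHodographExt (θ us : ℝ) (Z Y : ℂ → ℂ) : Prop extends IsHodograph θ us Z where
  hasDerivAt_ext : ∀ p ∈ halfPlane, HasDerivAt Y (contSlope θ p) p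
  ext_eq : ∀ p ∈ halfPlane, 0 ≤ p.im → Y p = Z (stripCoord p)

theorem IsHodograph.hasDerivAt_comp_stripCoord {θ us : ℝ} {Z : ℂ → ℂ} (H : IsHodograph θ us Z)
    {p : ℂ} (hre : 0 < p.re) (him : 0 < p.im) :
    HasDerivAt (fun p => Z (stripCoord p)) (slope θ (stripCoord p) * (-1 / p)) p :=
  (H.hasDerivAt _ (stripCoord_mem_openStrip hre him)).comp p
    (hasDerivAt_stripCoord him.le (by rintro rfl; simp at hre))

theorem exists_isHodographExt {θ us : ℝ} {Z : ℂ → ℂ} (H : IsHodograph θ us Z) :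
    ∃ Y, IsHodographExt θ us Z Y := by
  obtain ⟨Y₀, hY₀⟩ := convex_halfPlane.exists_forall_hasDerivWithinAt (f := contSlope θ)
    fun p hp => (differentiableAt_contSlope H.theta_pos hp).differentiableWithinAt
  replace hY₀ : ∀ p ∈ halfPlane, HasDerivAt Y₀ (contSlope θ p) p := fun p hp =>
    (hY₀ p hp).hasDerivAt (isOpen_halfPlane.mem_nhds hp)
  set O : Set ℂ := {p | 1 < p.re} ∩ {p | 0 < p.im} with hO
  have hOo : IsOpen O := isOpen_halfPlane.inter (isOpen_lt continuous_const continuous_im)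
  have hOc : IsPreconnected O :=
    (convex_halfPlane.inter (convex_halfSpace_im_gt 0)).isPreconnected
  have hd : ∀ p ∈ O, HasDerivAt (fun p => Y₀ p - Z (stripCoord p)) 0 p := by
    intro p hp
    have h1 : 1 < p.re := hp.1
    have h := (hY₀ p hp.1).sub (H.hasDerivAt_comp_stripCoord (by linarith) hp.2)
    rwa [contSlope_eq H.theta_pos hp.1 hp.2, sub_self] at h
  obtain ⟨c, hc⟩ := hOo.exists_is_const_of_deriv_eq_zero hOc
    (fun p hp => (hd p hp).differentiableAt.differentiableWithinAt) (fun p hp => (hd p hp).deriv)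
  -- On the open overlap with the first quadrant the two primitives differ by `c`; equality on the
  -- real axis follows by continuity.
  refine ⟨fun p => Y₀ p - c, H, fun p hp => (hY₀ p hp).sub_const c, ?_⟩
  intro p hp him
  rcases him.eq_or_lt with h | h
  · have hp' : 1 < p.re := hp
    have hp0 := ne_zero_of_halfPlane hp
    have hmem : O ∈ 𝓝[O] p := self_mem_nhdsWithin
    have hcl : (𝓝[O] p).NeBot := by
      rw [← mem_closure_iff_nhdsWithin_neBot]
      have hO2 : O = Ioi 1 ×ℂ Ioi 0 := by ext q; simp [hO, mem_reProdIm]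
      rw [hO2, closure_reProdIm, closure_Ioi, closure_Ioi, mem_reProdIm]
      exact ⟨hp'.le, h.le⟩
    have t1 : Tendsto (fun q => Y₀ q - c) (𝓝[O] p) (𝓝 (Y₀ p - c)) :=
      ((hY₀ p hp).continuousAt.tendsto.mono_left nhdsWithin_le_nhds).sub_const c
    have t2 : Tendsto (fun q => Z (stripCoord q)) (𝓝[O] p) (𝓝 (Z (stripCoord p))) := by
      have a1 := H.continuousOn _ (stripCoord_mem_closedStrip (p := p) (by linarith) him)
      have a2 : Tendsto stripCoord (𝓝[O] p) (𝓝[closedStrip] (stripCoord p)) := by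
        refine tendsto_nhdsWithin_iff.2
          ⟨(hasDerivAt_stripCoord him hp0).continuousAt.tendsto.mono_left nhdsWithin_le_nhds, ?_⟩
        filter_upwards [hmem] with q hq
        have : 1 < q.re := hq.1
        exact stripCoord_mem_closedStrip (by linarith) (le_of_lt hq.2)
      exact a1.tendsto.comp a2
    refine tendsto_nhds_unique (t1.congr' ?_) t2
    filter_upwards [hmem] with q hq
    have := hc q hq
    rw [← this]; ring
  · have := hc p ⟨hp, h⟩
    rw [← this]; ring

namespace IsHodographExt

variable {θ us : ℝ} {Z Y : ℂ → ℂ}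

theorem mem_halfPlane {x y : ℝ} (hx : 1 < x) : (x + y * I : ℂ) ∈ halfPlane := by
  simpa [halfPlane] using hx

theorem hasDerivAt_ext_horizontal (H : IsHodographExt θ us Z Y) {x : ℝ} (hx : 1 < x) (y : ℝ) :
    HasDerivAt (fun x : ℝ => Y (x + y * I)) (contSlope θ (x + y * I)) x := by
  have h4 : HasDerivAt (fun t : ℝ => (t + y * I : ℂ)) 1 x :=
    (ofRealCLM.hasDerivAt (x := x)).add_const (y * I : ℂ)
  have h := (H.hasDerivAt_ext _ (mem_halfPlane hx)).comp x h4
  rwa [mul_one] at h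

theorem hasDerivAt_ext_vertical (H : IsHodographExt θ us Z Y) {x : ℝ} (hx : 1 < x) (y : ℝ) :
    HasDerivAt (fun y : ℝ => Y (x + y * I)) (contSlope θ (x + y * I) * I) y := by
  have h4 : HasDerivAt (fun t : ℝ => (x + t * I : ℂ)) I y := by
    simpa using ((ofRealCLM.hasDerivAt (x := y)).mul_const I).const_add (x : ℂ)
  exact (H.hasDerivAt_ext _ (mem_halfPlane hx)).comp y h4

theorem strictAntiOn_ext_horizontal_re (H : IsHodographExt θ us Z Y) {y : ℝ} (hy : y ≤ 0) :
    StrictAntiOn (fun x : ℝ => (Y (x + y * I)).re) (Ioi 1) := by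
  apply strictAntiOn_of_deriv_neg (convex_Ioi _)
  · intro x hx
    exact (IsHodograph.hasDerivAt_re
      (H.hasDerivAt_ext_horizontal hx y)).continuousAt.continuousWithinAt
  · intro x hx
    rw [interior_Ioi] at hx
    refine lt_of_eq_of_lt (IsHodograph.hasDerivAt_re (H.hasDerivAt_ext_horizontal hx y)).deriv ?_
    exact (contSlope_re_neg_im_pos H.theta_pos (mem_halfPlane hx) (by simpa using hy)).1

theorem strictMonoOn_ext_horizontal_im (H : IsHodographExt θ us Z Y) {y : ℝ} (hy : y ≤ 0) :
    StrictMonoOn (fun x : ℝ => (Y (x + y * I)).im) (Ioi 1) := by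
  apply strictMonoOn_of_deriv_pos (convex_Ioi _)
  · intro x hx
    exact (IsHodograph.hasDerivAt_im
      (H.hasDerivAt_ext_horizontal hx y)).continuousAt.continuousWithinAt
  · intro x hx
    rw [interior_Ioi] at hx
    refine lt_of_lt_of_eq ?_
      (IsHodograph.hasDerivAt_im (H.hasDerivAt_ext_horizontal hx y)).deriv.symm
    exact (contSlope_re_neg_im_pos H.theta_pos (mem_halfPlane hx) (by simpa using hy)).2

theorem strictAntiOn_ext_vertical_re (H : IsHodographExt θ us Z Y) {x : ℝ} (hx : 1 < x) :
    StrictAntiOn (fun y : ℝ => (Y (x + y * I)).re) (Iic 0) := by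
  apply strictAntiOn_of_deriv_neg (convex_Iic _)
  · intro y _
    exact (IsHodograph.hasDerivAt_re
      (H.hasDerivAt_ext_vertical hx y)).continuousAt.continuousWithinAt
  · intro y hy
    rw [interior_Iic] at hy
    refine lt_of_eq_of_lt (IsHodograph.hasDerivAt_re (H.hasDerivAt_ext_vertical hx y)).deriv ?_
    have := (contSlope_re_neg_im_pos H.theta_pos (p := x + y * I) (mem_halfPlane hx)
      (by simpa using le_of_lt hy)).2
    simpa using this

theorem strictAntiOn_ext_vertical_im (H : IsHodographExt θ us Z Y) {x : ℝ} (hx : 1 < x) :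
    StrictAntiOn (fun y : ℝ => (Y (x + y * I)).im) (Iic 0) := by
  apply strictAntiOn_of_deriv_neg (convex_Iic _)
  · intro y _
    exact (IsHodograph.hasDerivAt_im
      (H.hasDerivAt_ext_vertical hx y)).continuousAt.continuousWithinAt
  · intro y hy
    rw [interior_Iic] at hy
    refine lt_of_eq_of_lt (IsHodograph.hasDerivAt_im (H.hasDerivAt_ext_vertical hx y)).deriv ?_
    have := (contSlope_re_neg_im_pos H.theta_pos (p := x + y * I) (mem_halfPlane hx)
      (by simpa using le_of_lt hy)).1
    simpa using this

theorem ext_ofReal (H : IsHodographExt θ us Z Y) {x : ℝ} (hx : 1 < x) :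
    Y x = Z ((-Real.log x : ℝ) + (Real.pi / 2 : ℝ) * I) := by
  rw [H.ext_eq x (by simpa [halfPlane] using hx) (by simp), stripCoord_ofReal (by linarith)]

theorem ext_re_gt (H : IsHodographExt θ us Z Y) {x y : ℝ} (hx : 1 < x) (hy : y < 0) :
    (Y x).re < (Y (x + y * I)).re := by
  simpa using H.strictAntiOn_ext_vertical_re hx (le_of_lt hy : y ∈ Iic 0) self_mem_Iic hy

theorem ext_im_gt (H : IsHodographExt θ us Z Y) {x y : ℝ} (hx : 1 < x) (hy : y < 0) :
    (Y x).im < (Y (x + y * I)).im := by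
  simpa using H.strictAntiOn_ext_vertical_im hx (le_of_lt hy : y ∈ Iic 0) self_mem_Iic hy

/-- The image of the edge `p > 1` rises from the branch value `α + i β` as `p` moves away from `1`.
-/
theorem ext_ofReal_im_gt (H : IsHodographExt θ us Z Y) {x : ℝ} (hx : 1 < x) :
    beta θ < (Y x).im := by
  have h := H.strictAntiOn_top_im (a := -Real.log x) (b := 0)
    (by have := Real.log_pos hx; simp; linarith) self_mem_Iic (by linarith [Real.log_pos hx])
  rw [H.ext_ofReal hx]
  have h2 := H.top_im le_rfl
  linarith

theorem ext_ofReal_im_ge (H : IsHodographExt θ us Z Y) {x : ℝ} (hx : 1 < x) :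
    Real.log x - Real.log us ≤ (Y x).im := by
  rw [H.ext_ofReal hx]
  have h1 := H.bottom_im_ge (-Real.log x)
  have h2 := (H.strictMonoOn_vertical_im (-Real.log x)).monotoneOn
    (left_mem_Icc.2 (by positivity)) (right_mem_Icc.2 (by positivity)) (by positivity)
  simp only [ofReal_zero, zero_mul, add_zero] at h2
  linarith

theorem contSlope_sq {p : ℂ} (h : contF θ p ≠ 0) : contSlope θ p ^ 2 = -(contF θ p)⁻¹ := by
  rw [contSlope, mul_pow, I_sq, ← Complex.exp_nat_mul]
  rw [show ((2 : ℕ) : ℂ) * -(log (contF θ p) / 2) = -log (contF θ p) by push_cast; ring,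
    Complex.exp_neg, exp_log h]
  ring

theorem norm_log_le {z : ℂ} (hz : 1 ≤ ‖z‖) : ‖log z‖ ≤ ‖z‖ - 1 + Real.pi := by
  refine (norm_le_abs_re_add_abs_im _).trans ?_
  rw [log_re, log_im, abs_of_nonneg (Real.log_nonneg hz)]
  have := Real.log_le_sub_one_of_pos (x := ‖z‖) (by linarith)
  linarith [abs_arg_le_pi z]

/-- For `t` this large, `p²` dominates the logarithms, so `Re contF ≤ 0` and `|contF| ≤ (16 θ + 4)
t²`. As `contSlope² = -1 / contF` then has nonnegative real part, the squared real part is at least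
half of the squared modulus, which explains the factor `2` under the root. -/
theorem contSlope_re_le (hθ : 0 < θ) {A x t : ℝ} (hx : 1 < x) (hxA : x ≤ A)
    (ht : 8 * θ + 2 * A + 1 ≤ t) :
    (contSlope θ (x + (-t : ℝ) * I)).re ≤ -((√(2 * (16 * θ + 4)))⁻¹ * t⁻¹) := by
  set p : ℂ := x + (-t : ℝ) * I with hp
  have ht1 : 1 ≤ t := by linarith
  have hpH : p ∈ halfPlane := mem_halfPlane hx
  have hpre : p.re = x := by simp [hp]
  have hpim : p.im = -t := by simp [hp]
  have him : p.im ≤ 0 := by linarith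
  have hFim := contF_im_neg hθ hpH him
  have hF0 : contF θ p ≠ 0 := fun h => by simp [h] at hFim
  have hn : ‖p‖ ≤ 2 * t := by
    refine (norm_le_abs_re_add_abs_im p).trans ?_
    rw [hpre, hpim, abs_neg, abs_of_pos (by linarith), abs_of_pos (by linarith)]
    linarith
  have n1 : 1 ≤ ‖1 + p‖ := by
    refine le_trans ?_ (re_le_norm _)
    simp [hpre]; linarith
  have n2 : 1 ≤ ‖p - 1‖ := by
    refine le_trans ?_ (abs_im_le_norm _)
    simp only [sub_im, one_im, sub_zero, hpim, abs_neg]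
    exact ht1.trans (le_abs_self t)
  have n3 : ‖1 + p‖ ≤ 1 + ‖p‖ := (norm_add_le _ _).trans (by simp)
  have n4 : ‖p - 1‖ ≤ ‖p‖ + 1 := (norm_sub_le _ _).trans (by simp)
  have hnF : ‖contF θ p‖ ≤ (16 * θ + 4) * t ^ 2 := by
    have l1 := norm_log_le n1
    have l2 := norm_log_le n2
    have l3 : ‖log (1 + p) + log (p - 1) - Real.pi * I‖ ≤
        ‖log (1 + p)‖ + ‖log (p - 1)‖ + Real.pi := by
      refine (norm_sub_le _ _).trans (add_le_add (norm_add_le _ _) ?_)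
      rw [norm_mul, norm_I, mul_one, norm_real, Real.norm_of_nonneg Real.pi_pos.le]
    have l4 : ‖contF θ p‖ ≤ θ * ‖log (1 + p) + log (p - 1) - Real.pi * I‖ + ‖p‖ ^ 2 := by
      refine (norm_add_le _ _).trans ?_
      rw [norm_mul, norm_real, Real.norm_of_nonneg hθ.le, norm_pow]
    have l5 : ‖p‖ ^ 2 ≤ (2 * t) ^ 2 := by gcongr
    have l6 : ‖log (1 + p) + log (p - 1) - Real.pi * I‖ ≤ 16 * t ^ 2 := by
      nlinarith [Real.pi_lt_four]
    have l7 := mul_le_mul_of_nonneg_left l6 hθ.le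
    nlinarith
  have hReF : (contF θ p).re ≤ 0 := by
    have e : (contF θ p).re = θ * (Real.log ‖1 + p‖ + Real.log ‖p - 1‖) + (x ^ 2 - t ^ 2) := by
      simp only [contF, add_re, sub_re, log_re, I_re, I_im, mul_zero, sq, mul_re, hpre, hpim,
        ofReal_re, ofReal_im]
      ring
    have l1 := Real.log_le_sub_one_of_pos (x := ‖1 + p‖) (by linarith)
    have l2 := Real.log_le_sub_one_of_pos (x := ‖p - 1‖) (by linarith)
    have l3 : Real.log ‖1 + p‖ + Real.log ‖p - 1‖ ≤ 4 * t := by linarith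
    have l4 := mul_le_mul_of_nonneg_left l3 hθ.le
    rw [e]
    nlinarith
  obtain ⟨s1, s2⟩ := contSlope_re_neg_im_pos hθ hpH him
  have hsq := contSlope_sq hF0
  set n := contSlope θ p with hndef
  have hre : n.re ^ 2 - n.im ^ 2 = -(contF θ p).re / normSq (contF θ p) := by
    have := congrArg re hsq
    rw [neg_re, inv_re, sq, mul_re] at this
    rw [neg_div, ← this]; ring
  have h1 : 0 ≤ n.re ^ 2 - n.im ^ 2 := by
    rw [hre]; exact div_nonneg (by linarith) (normSq_nonneg _)
  have h2 : n.re ^ 2 + n.im ^ 2 = ‖contF θ p‖⁻¹ := by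
    have : ‖n‖ ^ 2 = ‖contF θ p‖⁻¹ := by rw [← norm_pow, hsq, norm_neg, norm_inv]
    rw [← this, ← normSq_eq_norm_sq, normSq_apply]; ring
  have h3 : ((16 * θ + 4) * t ^ 2)⁻¹ ≤ ‖contF θ p‖⁻¹ := by
    have := norm_pos_iff.2 hF0
    gcongr
  have h4 : ((√(2 * (16 * θ + 4)))⁻¹ * t⁻¹) ^ 2 ≤ (-n.re) ^ 2 := by
    rw [mul_pow, inv_pow, Real.sq_sqrt (by positivity), neg_sq]
    have e : (2 * (16 * θ + 4))⁻¹ * t⁻¹ ^ 2 = ((16 * θ + 4) * t ^ 2)⁻¹ / 2 := by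
      field_simp
    rw [e]; linarith
  have h5 := abs_le_of_sq_le_sq h4 (by linarith)
  linarith [le_abs_self ((√(2 * (16 * θ + 4)))⁻¹ * t⁻¹), h5]

/-- On vertical lines the imaginary part of the continued hodograph map tends to infinity,
uniformly on bounded intervals. -/
theorem exists_bound (H : IsHodographExt θ us Z Y) (A M : ℝ) :
    ∃ B, ∀ x y : ℝ, 1 < x → x ≤ A → y ≤ 0 → (Y (x + y * I)).im ≤ M → -B ≤ y := by
  have hθ := H.theta_pos
  set T := 8 * θ + 2 * |A| + 1 with hT
  have hT1 : 1 ≤ T := by have := abs_nonneg A; linarith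
  set c := (√(2 * (16 * θ + 4)))⁻¹ with hc
  have hc0 : 0 < c := by rw [hc]; positivity
  -- `Im Y - c log t` is nondecreasing for `t ≥ T` and `Im Y > 0` at `T`. Hence `Im Y > c (log t -
  -- log T)`, which exceeds `M` beyond this bound.
  refine ⟨max T (Real.exp (M / c + Real.log T)), ?_⟩
  intro x y hx hxA hy hM
  by_contra hlt
  push Not at hlt
  set t := -y with hty
  have htmax : max T (Real.exp (M / c + Real.log T)) < t := by linarith
  have htT : T < t := (le_max_left _ _).trans_lt htmax
  have hmono : MonotoneOn (fun t : ℝ => (Y (x + (-t : ℝ) * I)).im - c * Real.log t) (Ici T) := by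
    have hd : ∀ t ∈ Ici T, HasDerivAt (fun t : ℝ => (Y (x + (-t : ℝ) * I)).im - c * Real.log t)
        (-(contSlope θ (x + (-t : ℝ) * I)).re - c * t⁻¹) t := by
      intro t ht
      have ht0 : 0 < t := by have : T ≤ t := ht; linarith
      have h1 := IsHodograph.hasDerivAt_im (H.hasDerivAt_ext_vertical hx (-t))
      rw [mul_I_im] at h1
      have h2 := h1.scomp t (hasDerivAt_neg t)
      rw [smul_eq_mul, neg_one_mul] at h2
      exact h2.sub ((Real.hasDerivAt_log ht0.ne').const_mul c)
    apply monotoneOn_of_deriv_nonneg (convex_Ici _)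
    · exact fun t ht => (hd t ht).continuousAt.continuousWithinAt
    · exact fun t ht => (hd t (interior_subset ht)).differentiableAt.differentiableWithinAt
    · intro t ht
      rw [(hd t (interior_subset ht)).deriv]
      have htT' : T ≤ t := interior_subset ht
      have := contSlope_re_le hθ hx hxA (t := t) (by linarith [le_abs_self A])
      rw [← hc] at this
      linarith
  have h := hmono self_mem_Ici (htT.le : t ∈ Ici T) htT.le
  simp only at h
  have hpos : 0 < (Y (x + (-T : ℝ) * I)).im := by
    have := H.ext_im_gt hx (y := -T) (by linarith)
    have h2 := H.ext_ofReal_im_gt hx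
    have : 0 ≤ beta θ := by unfold beta; positivity
    linarith
  rw [hty, neg_neg] at h
  have h6 : M / c + Real.log T < Real.log (-y) := by
    rw [Real.lt_log_iff_exp_lt (by linarith)]
    exact (le_max_right _ _).trans_lt htmax
  have h7 : c * (M / c + Real.log T) < c * Real.log (-y) := mul_lt_mul_of_pos_left h6 hc0
  rw [mul_add, mul_div_cancel₀ _ hc0.ne'] at h7
  linarith

end IsHodographExt

/-! ### The hodograph map is a bijection onto the quarter of the cut strip -/

/-- The hodograph map in the coordinate `p = i u`, on the closed first quadrant and its
continuation across `p > 1`. -/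
def hodo (Z Y : ℂ → ℂ) (p : ℂ) : ℂ := if 0 ≤ p.im then Z (stripCoord p) else Y p

/-- The closed first quadrant without the points `0` and `1`. -/
def quadrant : Set ℂ := {p | p ≠ 0 ∧ p ≠ 1 ∧ 0 ≤ p.re ∧ 0 ≤ p.im}

/-- The part of the continuation that is mapped to the left of the cut. -/
def extDomain (a : ℝ) (Y : ℂ → ℂ) : Set ℂ := {p | 1 < p.re ∧ p.im < 0 ∧ (Y p).re < a}

/-- The interior of the domain of the hodograph map. -/
def interiorDomain (a : ℝ) (Y : ℂ → ℂ) : Set ℂ :=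
  {p | 0 < p.re ∧ 0 < p.im} ∪ {p | 1 < p.re ∧ (Y p).re < a}

/-- The quarter of the cut strip, with its boundary (the cut excepted). -/
def quarterClosed (a b : ℝ) : Set ℂ :=
  {z | 0 ≤ z.re ∧ 0 ≤ z.im ∧ (z.re < a ∨ z.im < b ∨ (a < z.re ∧ z.im = b))}

/-- The interior of `quarterClosed`. -/
def quarterOpen (a b : ℝ) : Set ℂ := {z | 0 < z.re ∧ 0 < z.im ∧ (z.re < a ∨ z.im < b)}

theorem beta_pos {θ : ℝ} (hθ : 1 < θ) : 0 < beta θ := by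
  have : 0 < √(θ - 1) := Real.sqrt_pos.2 (by linarith)
  unfold beta; positivity

theorem isOpen_quarterOpen (a b : ℝ) : IsOpen (quarterOpen a b) :=
  (isOpen_lt continuous_const continuous_re).inter
    ((isOpen_lt continuous_const continuous_im).inter
      ((isOpen_lt continuous_re continuous_const).union
        (isOpen_lt continuous_im continuous_const)))

theorem isPreconnected_quarterOpen {a b : ℝ} (ha : 0 < a) (hb : 0 < b) :
    IsPreconnected (quarterOpen a b) := by
  have e : quarterOpen a b = ({z | 0 < z.re} ∩ {z | 0 < z.im} ∩ {z | z.re < a}) ∪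
      ({z | 0 < z.re} ∩ {z | 0 < z.im} ∩ {z | z.im < b}) := by
    ext z; simp only [quarterOpen, mem_ofPred_eq, mem_union, mem_inter_iff]; tauto
  have h1 : Convex ℝ ({z : ℂ | 0 < z.re} ∩ {z | 0 < z.im}) :=
    (convex_halfSpace_re_gt 0).inter (convex_halfSpace_im_gt 0)
  rw [e]
  refine IsPreconnected.union ((a / 2 : ℝ) + (b / 2 : ℝ) * I) ?_ ?_
    (h1.inter (convex_halfSpace_re_lt a)).isPreconnected
    (h1.inter (convex_halfSpace_im_lt b)).isPreconnected
  · simp [ha, hb]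
  · simp [ha, hb]

theorem quarterOpen_subset_quarterClosed (a b : ℝ) : quarterOpen a b ⊆ quarterClosed a b :=
  fun _ h => ⟨h.1.le, h.2.1.le, h.2.2.imp_right Or.inl⟩

theorem quarterClosed_subset_closure {a b : ℝ} (ha : 0 < a) (hb : 0 < b) :
    quarterClosed a b ⊆ closure (quarterOpen a b) := by
  rintro z ⟨h1, h2, h3⟩
  rw [mem_closure_iff_frequently]
  have hlim : ∀ s : ℝ, Tendsto (fun ε : ℝ => z + ε * (1 + s * I)) (𝓝[>] 0) (𝓝 z) := by
    intro s
    have : Continuous fun ε : ℝ => z + ε * (1 + s * I) := by fun_prop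
    have h := this.tendsto 0
    simp only [ofReal_zero, zero_mul, add_zero] at h
    exact h.mono_left nhdsWithin_le_nhds
  rcases h3 with h3 | h3 | h3
  · refine (hlim 1).frequently (Eventually.frequently ?_)
    filter_upwards [self_mem_nhdsWithin,
      nhdsWithin_le_nhds (gt_mem_nhds (show 0 < a - z.re by linarith))] with ε h4 h5
    have h4' : 0 < ε := h4
    refine ⟨?_, ?_, Or.inl ?_⟩ <;> simp <;> linarith
  · refine (hlim 1).frequently (Eventually.frequently ?_)
    filter_upwards [self_mem_nhdsWithin,
      nhdsWithin_le_nhds (gt_mem_nhds (show 0 < b - z.im by linarith))] with ε h4 h5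
    have h4' : 0 < ε := h4
    refine ⟨?_, ?_, Or.inr ?_⟩ <;> simp <;> linarith
  -- A point of the edge `Im z = b` beyond the cut is approached from below.
  · refine (hlim (-1)).frequently (Eventually.frequently ?_)
    filter_upwards [self_mem_nhdsWithin, nhdsWithin_le_nhds (gt_mem_nhds hb)] with ε h4 h5
    have h4' : 0 < ε := h4
    refine ⟨?_, ?_, Or.inr ?_⟩ <;> simp <;> linarith [h3.1, h3.2]

namespace IsHodographExt

variable {θ us : ℝ} {Z Y : ℂ → ℂ}

theorem hodo_eq_of_im_nonneg {p : ℂ} (h : 0 ≤ p.im) : hodo Z Y p = Z (stripCoord p) := if_pos h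

theorem hodo_eq_of_im_neg {p : ℂ} (h : p.im < 0) : hodo Z Y p = Y p := if_neg (not_le.2 h)

theorem hodo_eq_of_halfPlane (H : IsHodographExt θ us Z Y) {p : ℂ} (hp : p ∈ halfPlane) :
    hodo Z Y p = Y p := by
  rcases le_or_gt 0 p.im with h | h
  · rw [hodo_eq_of_im_nonneg h, H.ext_eq p hp h]
  · exact hodo_eq_of_im_neg h

theorem continuousAt_ext (H : IsHodographExt θ us Z Y) {p : ℂ} (hp : p ∈ halfPlane) :
    ContinuousAt Y p := (H.hasDerivAt_ext p hp).continuousAt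

theorem isOpen_interiorDomain (H : IsHodographExt θ us Z Y) (a : ℝ) :
    IsOpen (interiorDomain a Y) := by
  refine ((isOpen_lt continuous_const continuous_re).inter
    (isOpen_lt continuous_const continuous_im)).union ?_
  have hc : ContinuousOn (fun p => (Y p).re) halfPlane := fun p hp =>
    (continuous_re.continuousAt.comp (H.continuousAt_ext hp)).continuousWithinAt
  exact hc.isOpen_inter_preimage isOpen_halfPlane isOpen_Iio

theorem hasDerivAt_hodo (H : IsHodographExt θ us Z Y) {a : ℝ} {p : ℂ}
    (hp : p ∈ interiorDomain a Y) : ∃ d, d ≠ 0 ∧ HasDerivAt (hodo Z Y) d p := by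
  rcases hp with ⟨h1, h2⟩ | ⟨h1, h2⟩
  · refine ⟨_, ?_, (H.hasDerivAt_comp_stripCoord h1 h2).congr_of_eventuallyEq ?_⟩
    · refine mul_ne_zero (Complex.exp_ne_zero _) (div_ne_zero (by norm_num) ?_)
      rintro rfl; simp at h1
    · filter_upwards [(isOpen_lt continuous_const continuous_im).mem_nhds h2] with q hq
      exact hodo_eq_of_im_nonneg (le_of_lt hq)
  · refine ⟨_, ?_, (H.hasDerivAt_ext p h1).congr_of_eventuallyEq ?_⟩
    · exact mul_ne_zero I_ne_zero (Complex.exp_ne_zero _)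
    · filter_upwards [isOpen_halfPlane.mem_nhds h1] with q hq
      exact H.hodo_eq_of_halfPlane hq

theorem le_top_of_mem (H : IsHodographExt θ us Z Y) {w : ℂ} (hw : w ∈ closedStrip) :
    (Z w).re ≤ (Z (w.re + (Real.pi / 2 : ℝ) * I)).re ∧
      (Z w).im ≤ (Z (w.re + (Real.pi / 2 : ℝ) * I)).im := by
  have m1 : (Real.pi / 2 : ℝ) ∈ Icc 0 (Real.pi / 2) := ⟨by positivity, le_rfl⟩
  have h1 := (H.strictMonoOn_vertical_re w.re).monotoneOn hw m1 hw.2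
  have h2 := (H.strictMonoOn_vertical_im w.re).monotoneOn hw m1 hw.2
  simp only [re_add_im] at h1 h2
  exact ⟨h1, h2⟩

theorem bottom_le_of_mem (H : IsHodographExt θ us Z Y) {w : ℂ} (hw : w ∈ closedStrip) :
    (Z (w.re : ℝ)).re ≤ (Z w).re ∧ (Z (w.re : ℝ)).im ≤ (Z w).im := by
  have m1 : (0 : ℝ) ∈ Icc 0 (Real.pi / 2) := ⟨le_rfl, by positivity⟩
  have h1 := (H.strictMonoOn_vertical_re w.re).monotoneOn m1 hw hw.1
  have h2 := (H.strictMonoOn_vertical_im w.re).monotoneOn m1 hw hw.1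
  simp only [re_add_im, ofReal_zero, zero_mul, add_zero] at h1 h2
  exact ⟨h1, h2⟩

theorem alpha_lt_top (H : IsHodographExt θ us Z Y) {x : ℝ} (hx : 0 < x) :
    alpha θ < (Z (x + (Real.pi / 2 : ℝ) * I)).re := by
  rw [H.alpha_eq]
  simpa using H.strictMono_top_re hx

theorem top_lt_alpha (H : IsHodographExt θ us Z Y) {x : ℝ} (hx : x < 0) :
    (Z (x + (Real.pi / 2 : ℝ) * I)).re < alpha θ := by
  rw [H.alpha_eq]
  simpa using H.strictMono_top_re hx

/-- `Z w` lies strictly below and to the left of the top value on the same vertical line. That value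
has `Re z < α` if `Re w < 0` and `Im z = β` otherwise. -/
theorem mem_quarterOpen_of_mem_openStrip (H : IsHodographExt θ us Z Y) {w : ℂ}
    (hw : w ∈ openStrip) : Z w ∈ quarterOpen (alpha θ) (beta θ) := by
  have m1 : (Real.pi / 2 : ℝ) ∈ Icc 0 (Real.pi / 2) := ⟨by positivity, le_rfl⟩
  have hwc : w.im ∈ Icc 0 (Real.pi / 2) := ⟨hw.1.le, hw.2.le⟩
  have p1 := H.re_pos w.re (y := w.im) ⟨hw.1, hw.2.le⟩
  have p2 := H.im_pos w.re (y := w.im) ⟨hw.1, hw.2.le⟩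
  rw [re_add_im] at p1 p2
  refine ⟨p1, p2, ?_⟩
  rcases lt_or_ge w.re 0 with h | h
  · left
    have h1 := H.strictMonoOn_vertical_re w.re hwc m1 hw.2
    simp only [re_add_im] at h1
    exact h1.trans (H.top_lt_alpha h)
  · right
    have h2 := H.strictMonoOn_vertical_im w.re hwc m1 hw.2
    simp only [re_add_im] at h2
    rwa [H.top_im h] at h2

theorem ext_ofReal_re (H : IsHodographExt θ us Z Y) {x : ℝ} (hx : 1 < x) :
    0 < (Y x).re ∧ (Y x).re < alpha θ := by
  rw [H.ext_ofReal hx]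
  exact ⟨H.re_pos _ ⟨by positivity, le_rfl⟩, H.top_lt_alpha (by linarith [Real.log_pos hx])⟩

theorem ext_ge (H : IsHodographExt θ us Z Y) {p : ℂ} (hp : p ∈ halfPlane) (him : p.im ≤ 0) :
    (Y (p.re : ℝ)).re ≤ (Y p).re ∧ (Y (p.re : ℝ)).im ≤ (Y p).im := by
  rcases him.eq_or_lt with h | h
  · have e : p = (p.re : ℝ) := Complex.ext (by simp) (by simp [h])
    rw [← e]
    exact ⟨le_rfl, le_rfl⟩
  · have h1 := H.ext_re_gt hp h
    have h2 := H.ext_im_gt hp h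
    rw [re_add_im] at h1 h2
    exact ⟨h1.le, h2.le⟩

theorem ext_im_gt_beta (H : IsHodographExt θ us Z Y) {p : ℂ} (hp : p ∈ halfPlane)
    (him : p.im ≤ 0) : beta θ < (Y p).im :=
  (H.ext_ofReal_im_gt hp).trans_le (H.ext_ge hp him).2

theorem mapsTo_interiorDomain (H : IsHodographExt θ us Z Y) :
    MapsTo (hodo Z Y) (interiorDomain (alpha θ) Y) (quarterOpen (alpha θ) (beta θ)) := by
  have key : ∀ p : ℂ, 0 < p.re → 0 < p.im → hodo Z Y p ∈ quarterOpen (alpha θ) (beta θ) := by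
    intro p h1 h2
    rw [hodo_eq_of_im_nonneg h2.le]
    exact H.mem_quarterOpen_of_mem_openStrip (stripCoord_mem_openStrip h1 h2)
  rintro p (⟨h1, h2⟩ | ⟨h1, h2⟩)
  · exact key p h1 h2
  · rcases lt_or_ge 0 p.im with h | h
    · exact key p (by linarith) h
    · rw [H.hodo_eq_of_halfPlane h1]
      refine ⟨(H.ext_ofReal_re h1).1.trans_le (H.ext_ge h1 h).1, ?_, Or.inl h2⟩
      exact (beta_pos H.one_lt).trans (H.ext_im_gt_beta h1 h)

theorem stripCoord_of_re_zero {p : ℂ} (hre : p.re = 0) (him : 0 < p.im) :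
    stripCoord p = (-Real.log p.im : ℝ) := by
  have e : -I * p = (p.im : ℝ) := by apply Complex.ext <;> simp [hre]
  rw [stripCoord, e, ← ofReal_log him.le]; simp

theorem stripCoord_of_im_zero {p : ℂ} (hre : 0 < p.re) (him : p.im = 0) :
    stripCoord p = (-Real.log p.re : ℝ) + (Real.pi / 2 : ℝ) * I := by
  have e : p = (p.re : ℝ) := Complex.ext (by simp) (by simp [him])
  rw [e, stripCoord_ofReal hre]; simp

theorem cases_of_mem (H : IsHodographExt θ us Z Y) {p : ℂ}
    (hp : p ∈ quadrant ∪ extDomain (alpha θ) Y) :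
    p ∈ interiorDomain (alpha θ) Y ∨ (p.re = 0 ∧ 0 < p.im) ∨
      (p.im = 0 ∧ 0 < p.re ∧ p.re < 1) := by
  rcases hp with ⟨h0, h1, h2, h3⟩ | ⟨h1, h2, h3⟩
  · rcases h2.eq_or_lt with h4 | h4
    · right; left
      refine ⟨h4.symm, lt_of_le_of_ne h3 fun h => h0 (Complex.ext h4.symm h.symm)⟩
    · rcases h3.eq_or_lt with h5 | h5
      · have e : p = (p.re : ℝ) := Complex.ext (by simp) (by simp [h5])
        rcases lt_trichotomy p.re 1 with h6 | h6 | h6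
        · right; right; exact ⟨h5.symm, h4, h6⟩
        · exact absurd (Complex.ext h6 h5.symm) h1
        · left; right
          refine ⟨h6, ?_⟩
          rw [e]; exact (H.ext_ofReal_re h6).2
      · left; left; exact ⟨h4, h5⟩
  · left; right; exact ⟨h1, h3⟩

theorem interiorDomain_subset (a : ℝ) (Y : ℂ → ℂ) :
    interiorDomain a Y ⊆ quadrant ∪ extDomain a Y := by
  rintro p (⟨h1, h2⟩ | ⟨h1, h2⟩)
  · left
    exact ⟨by rintro rfl; simp at h1, by rintro rfl; simp at h2, h1.le, h2.le⟩
  · rcases lt_or_ge p.im 0 with h | h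
    · right; exact ⟨h1, h, h2⟩
    · left
      refine ⟨by rintro rfl; simp at h1; linarith, by rintro rfl; simp at h1, by linarith, h⟩

/-- The values of the hodograph map on the edges. -/
theorem hodo_of_re_zero {p : ℂ} (hre : p.re = 0) (him : 0 < p.im) :
    hodo Z Y p = Z (-Real.log p.im : ℝ) := by
  rw [hodo_eq_of_im_nonneg him.le, stripCoord_of_re_zero hre him]

theorem hodo_of_im_zero {p : ℂ} (hre : 0 < p.re) (him : p.im = 0) :
    hodo Z Y p = Z ((-Real.log p.re : ℝ) + (Real.pi / 2 : ℝ) * I) := by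
  rw [hodo_eq_of_im_nonneg him.ge, stripCoord_of_im_zero hre him]

theorem mem_interiorDomain_of_hodo_mem (H : IsHodographExt θ us Z Y) {p : ℂ}
    (hp : p ∈ quadrant ∪ extDomain (alpha θ) Y)
    (hz : hodo Z Y p ∈ quarterOpen (alpha θ) (beta θ)) : p ∈ interiorDomain (alpha θ) Y := by
  rcases H.cases_of_mem hp with h | ⟨h1, h2⟩ | ⟨h1, h2, h3⟩
  · exact h
  · exfalso
    rw [hodo_of_re_zero h1 h2] at hz
    rcases le_total (-Real.log p.im) (-Real.log us) with h | h
    · exact hz.1.ne' (H.bottom_left_re h)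
    · exact hz.2.1.ne' (H.bottom_right_im h)
  · exfalso
    rw [hodo_of_im_zero h2 h1] at hz
    have hl : 0 < -Real.log p.re := by linarith [Real.log_neg h2 h3]
    rcases hz.2.2 with h | h
    · exact lt_asymm h (H.alpha_lt_top hl)
    · rw [H.top_im hl.le] at h; exact lt_irrefl _ h

/-- The image of the top edge separates the two pieces: its real part increases and its imaginary
part does not increase in `Re w`. Points of the strip map weakly below and left of their curve
point, points of the continuation strictly above and right of theirs. Comparing the two curve points
excludes equality in one coordinate. -/
theorem quadrant_ext_disjoint (H : IsHodographExt θ us Z Y) {w q : ℂ} (hw : w ∈ closedStrip)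
    (hq : q ∈ halfPlane) (him : q.im < 0) : Z w ≠ Y q := by
  intro he
  have h1 := H.ext_re_gt hq him
  have h2 := H.ext_im_gt hq him
  rw [re_add_im, H.ext_ofReal hq, ← he] at h1 h2
  have m1 : (Real.pi / 2 : ℝ) ∈ Icc 0 (Real.pi / 2) := ⟨by positivity, le_rfl⟩
  obtain ⟨t1, t2⟩ := H.le_top_of_mem hw
  rcases le_total w.re (-Real.log q.re) with h | h
  · have := H.monotone_horizontal_re m1 h
    simp only at this
    linarith
  · have := H.antitone_horizontal_im m1 h
    simp only at this
    linarith

theorem injOn_ext (H : IsHodographExt θ us Z Y) : InjOn Y {p | p ∈ halfPlane ∧ p.im < 0} := by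
  have key : ∀ x₁ y₁ x₂ y₂ : ℝ, 1 < x₁ → y₁ < 0 → y₂ < 0 → x₁ ≤ x₂ →
      Y (x₁ + y₁ * I) = Y (x₂ + y₂ * I) → x₁ = x₂ ∧ y₁ = y₂ := by
    intro x₁ y₁ x₂ y₂ hx₁ h1 h2 hx he
    have hx₂ : 1 < x₂ := hx₁.trans_le hx
    rcases lt_trichotomy y₁ y₂ with hy | hy | hy
    · have a1 := (H.strictAntiOn_ext_horizontal_re h2.le).antitoneOn hx₁ hx₂ hx
      have a2 := H.strictAntiOn_ext_vertical_re hx₁ (le_of_lt h1 : y₁ ∈ Iic 0)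
        (le_of_lt h2 : y₂ ∈ Iic 0) hy
      simp only [he] at a1 a2
      linarith
    · subst hy
      exact ⟨(H.strictMonoOn_ext_horizontal_im h1.le).injOn hx₁ hx₂ (by simp only [he]), rfl⟩
    · have a1 := (H.strictMonoOn_ext_horizontal_im h2.le).monotoneOn hx₁ hx₂ hx
      have a2 := H.strictAntiOn_ext_vertical_im hx₁ (le_of_lt h2 : y₂ ∈ Iic 0)
        (le_of_lt h1 : y₁ ∈ Iic 0) hy
      simp only [he] at a1 a2
      linarith
  rintro p ⟨hp, hp'⟩ q ⟨hq, hq'⟩ he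
  rw [← re_add_im p, ← re_add_im q] at he
  rcases le_total p.re q.re with h | h
  · obtain ⟨a, b⟩ := key _ _ _ _ hp hp' hq' h he
    exact Complex.ext a b
  · obtain ⟨a, b⟩ := key _ _ _ _ hq hq' hp' h he.symm
    exact Complex.ext a.symm b.symm

theorem injOn_hodo (H : IsHodographExt θ us Z Y) :
    InjOn (hodo Z Y) (quadrant ∪ extDomain (alpha θ) Y) := by
  rintro p (hp | hp) q (hq | hq) he
  · rw [hodo_eq_of_im_nonneg hp.2.2.2, hodo_eq_of_im_nonneg hq.2.2.2] at he
    have h := H.injOn (stripCoord_mem_closedStrip hp.2.2.1 hp.2.2.2)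
      (stripCoord_mem_closedStrip hq.2.2.1 hq.2.2.2) he
    have h1 := exp_neg_stripCoord hp.1
    rw [h, exp_neg_stripCoord hq.1] at h1
    exact (mul_left_cancel₀ (neg_ne_zero.2 I_ne_zero) h1).symm
  · rw [hodo_eq_of_im_nonneg hp.2.2.2, hodo_eq_of_im_neg hq.2.1] at he
    exact absurd he (H.quadrant_ext_disjoint (stripCoord_mem_closedStrip hp.2.2.1 hp.2.2.2)
      hq.1 hq.2.1)
  · rw [hodo_eq_of_im_nonneg hq.2.2.2, hodo_eq_of_im_neg hp.2.1] at he
    exact absurd he.symm (H.quadrant_ext_disjoint (stripCoord_mem_closedStrip hq.2.2.1 hq.2.2.2)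
      hp.1 hp.2.1)
  · rw [hodo_eq_of_im_neg hp.2.1, hodo_eq_of_im_neg hq.2.1] at he
    exact H.injOn_ext ⟨hp.1, hp.2.1⟩ ⟨hq.1, hq.2.1⟩ he

theorem not_mem_quarterClosed_of_ge {a b : ℝ} {z : ℂ} (h1 : z.re = a) (h2 : b ≤ z.im) :
    z ∉ quarterClosed a b := by
  rintro ⟨_, _, h | h | ⟨h, _⟩⟩ <;> linarith

/-- Bounded images force bounded strip coordinates, so the ultrafilter converges in a compact
rectangle. The limit cannot be the branch point, whose image is the tip of the cut and is not in
`quarterClosed`. -/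
theorem exists_limit_of_quadrant (H : IsHodographExt θ us Z Y) {𝒰 : Ultrafilter ℂ}
    (hD : quadrant ∈ 𝒰) {z : ℂ} (hz : z ∈ quarterClosed (alpha θ) (beta θ))
    (hlim : Tendsto (hodo Z Y) 𝒰 (𝓝 z)) :
    ∃ p ∈ quadrant, (𝒰 : Filter ℂ) ≤ 𝓝 p ∧ hodo Z Y p = z := by
  have hstrip : ∀ᶠ p in (𝒰 : Filter ℂ), stripCoord p ∈ closedStrip := by
    filter_upwards [hD] with p hp
    exact stripCoord_mem_closedStrip hp.2.2.1 hp.2.2.2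
  have hZlim : Tendsto (fun p => Z (stripCoord p)) 𝒰 (𝓝 z) := by
    refine hlim.congr' ?_
    filter_upwards [hD] with p hp
    exact hodo_eq_of_im_nonneg hp.2.2.2
  have e1 : ∀ᶠ p in (𝒰 : Filter ℂ), (Z (stripCoord p)).re < z.re + 1 :=
    ((continuous_re.tendsto z).comp hZlim).eventually (gt_mem_nhds (by linarith))
  have e2 : ∀ᶠ p in (𝒰 : Filter ℂ), (Z (stripCoord p)).im < z.im + 1 :=
    ((continuous_im.tendsto z).comp hZlim).eventually (gt_mem_nhds (by linarith))
  set c := √(θ - 1) with hc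
  have hc0 : 0 < c := Real.sqrt_pos.2 (by linarith [H.one_lt])
  -- The left bound comes from the growth of `Im Z` (`bottom_im_ge`), the right bound from that of
  -- `Re Z` (`bottom_re_ge`).
  set a := -Real.log us - (z.im + 1) with ha
  set b := c * (z.re + 1) - Real.log us with hb
  have hK : IsCompact (Icc a b ×ℂ Icc 0 (Real.pi / 2)) := isCompact_Icc.reProdIm isCompact_Icc
  have hmem : ∀ᶠ p in (𝒰 : Filter ℂ), stripCoord p ∈ Icc a b ×ℂ Icc 0 (Real.pi / 2) := by
    filter_upwards [hstrip, e1, e2] with p h1 h2 h3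
    obtain ⟨b1, b2⟩ := H.bottom_le_of_mem h1
    refine ⟨⟨?_, ?_⟩, h1⟩
    · have := H.bottom_im_ge (stripCoord p).re
      linarith
    · rcases le_total (-Real.log us) (stripCoord p).re with h | h
      · have h4 := H.bottom_re_ge h
        rw [← hc] at h4
        have h5 : c⁻¹ * ((stripCoord p).re + Real.log us) ≤ z.re + 1 := by linarith
        rw [inv_mul_le_iff₀ hc0] at h5
        linarith
      · have : 0 ≤ c * (z.re + 1) := mul_nonneg hc0.le (by linarith [hz.1])
        linarith
  obtain ⟨w, hw, hle⟩ := hK.ultrafilter_le_nhds (𝒰.map stripCoord) (le_principal_iff.2 hmem)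
  have hwS : w ∈ closedStrip := hw.2
  have ht : Tendsto stripCoord 𝒰 (𝓝 w) := hle
  have hZw : Z w = z := by
    refine tendsto_nhds_unique ?_ hZlim
    exact (H.continuousOn w hwS).tendsto.comp (tendsto_nhdsWithin_iff.2 ⟨ht, hstrip⟩)
  have hne : w ≠ (Real.pi / 2 : ℝ) * I := by
    rintro rfl
    rw [H.apply_top_zero] at hZw
    refine not_mem_quarterClosed_of_ge ?_ ?_ hz
    · rw [← hZw]; simp
    · rw [← hZw]; simp
  have hcoord := stripCoord_I_mul_exp hwS
  have hre : 0 ≤ (I * exp (-w)).re := by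
    rw [I_mul_re, exp_im, neg_im, Real.sin_neg]
    have := mul_nonneg (Real.exp_pos (-w).re).le
      (Real.sin_nonneg_of_nonneg_of_le_pi hwS.1 (by linarith [hwS.2, Real.pi_pos]))
    linarith
  have him : 0 ≤ (I * exp (-w)).im := by
    rw [I_mul_im, exp_re, neg_im, Real.cos_neg]
    exact mul_nonneg (Real.exp_pos _).le (Real.cos_nonneg_of_mem_Icc
      ⟨by linarith [hwS.1, Real.pi_pos], hwS.2⟩)
  refine ⟨I * exp (-w), ⟨mul_ne_zero I_ne_zero (Complex.exp_ne_zero _), ?_, hre, him⟩, ?_, ?_⟩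
  · intro h
    apply hne
    rw [← hcoord, h]
    simpa using stripCoord_ofReal one_pos
  · have h1 : Tendsto (fun p => I * exp (-stripCoord p)) 𝒰 (𝓝 (I * exp (-w))) := by
      have : Continuous fun v : ℂ => I * exp (-v) := by fun_prop
      exact (this.tendsto w).comp ht
    have h2 : Tendsto id (𝒰 : Filter ℂ) (𝓝 (I * exp (-w))) := by
      refine h1.congr' ?_
      filter_upwards [hD] with p hp
      rw [exp_neg_stripCoord hp.1, ← mul_assoc, mul_neg, I_mul_I, neg_neg, one_mul, id]
    exact h2
  · rw [hodo_eq_of_im_nonneg him, hcoord, hZw]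

/-- The image of the edge bounds `Re p`, and `exists_bound` then bounds `Im p`. A limit with `Re p =
1` would force `Re z ≥ α` by comparison with the edge near the branch point, but `z` lies strictly
left of the cut. -/
theorem exists_limit_of_extDomain (H : IsHodographExt θ us Z Y) {𝒰 : Ultrafilter ℂ}
    (hD : extDomain (alpha θ) Y ∈ 𝒰) {z : ℂ} (hz : z ∈ quarterClosed (alpha θ) (beta θ))
    (hlim : Tendsto (hodo Z Y) 𝒰 (𝓝 z)) :
    ∃ p ∈ quadrant ∪ extDomain (alpha θ) Y, (𝒰 : Filter ℂ) ≤ 𝓝 p ∧ hodo Z Y p = z := by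
  have hYlim : Tendsto Y 𝒰 (𝓝 z) := by
    refine hlim.congr' ?_
    filter_upwards [hD] with p hp
    exact hodo_eq_of_im_neg hp.2.1
  have hYre : Tendsto (fun p => (Y p).re) 𝒰 (𝓝 z.re) := (continuous_re.tendsto z).comp hYlim
  have hYim : Tendsto (fun p => (Y p).im) 𝒰 (𝓝 z.im) := (continuous_im.tendsto z).comp hYlim
  have e2 : ∀ᶠ p in (𝒰 : Filter ℂ), (Y p).im < z.im + 1 :=
    hYim.eventually (gt_mem_nhds (by linarith))
  have hzre : z.re ≤ alpha θ := by
    refine le_of_tendsto hYre ?_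
    filter_upwards [hD] with p hp using hp.2.2.le
  have hzim : beta θ ≤ z.im := by
    refine ge_of_tendsto hYim ?_
    filter_upwards [hD] with p hp using (H.ext_im_gt_beta hp.1 hp.2.1.le).le
  have hzlt : z.re < alpha θ := lt_of_le_of_ne hzre fun h => not_mem_quarterClosed_of_ge h hzim hz
  set A := Real.exp (z.im + 1 + Real.log us) with hA
  obtain ⟨B, hB⟩ := H.exists_bound A (z.im + 1)
  have hK : IsCompact (Icc 1 A ×ℂ Icc (-B) 0) := isCompact_Icc.reProdIm isCompact_Icc
  have hmem : (Icc 1 A ×ℂ Icc (-B) 0) ∈ 𝒰 := by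
    filter_upwards [hD, e2] with p h1 h2
    have h3 := H.ext_ofReal_im_ge h1.1
    have h4 := (H.ext_ge h1.1 h1.2.1.le).2
    have hpA : p.re ≤ A := by
      rw [hA, ← Real.log_le_iff_le_exp (by linarith [h1.1])]
      linarith
    exact ⟨⟨h1.1.le, hpA⟩, ⟨hB p.re p.im h1.1 hpA h1.2.1.le (by rw [re_add_im]; exact h2.le),
      h1.2.1.le⟩⟩
  obtain ⟨p, hp, hle⟩ := hK.ultrafilter_le_nhds 𝒰 (le_principal_iff.2 hmem)
  have hp1 : 1 < p.re := by
    refine lt_of_le_of_ne hp.1.1 fun hp1 => ?_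
    have hre : Tendsto (fun q : ℂ => -Real.log q.re) 𝒰 (𝓝 0) := by
      have h1 : ContinuousAt (fun q : ℂ => -Real.log q.re) p :=
        (continuous_re.continuousAt.log (by rw [← hp1]; exact one_ne_zero)).neg
      have h2 := h1.tendsto.mono_left hle
      simpa [← hp1] using h2
    have hc : Tendsto (fun q : ℂ =>
        (Z ((-Real.log q.re : ℝ) + (Real.pi / 2 : ℝ) * I)).re) 𝒰 (𝓝 (alpha θ)) := by
      have := ((continuous_re.comp H.continuous_top).tendsto 0).comp hre
      rw [H.alpha_eq]
      simpa [Function.comp_def] using this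
    have : alpha θ ≤ z.re := by
      refine le_of_tendsto_of_tendsto hc hYre ?_
      filter_upwards [hD] with q hq
      rw [← H.ext_ofReal hq.1]
      exact (H.ext_ge hq.1 hq.2.1.le).1
    linarith
  have hYp : Y p = z := tendsto_nhds_unique ((H.continuousAt_ext hp1).tendsto.mono_left hle) hYlim
  refine ⟨p, ?_, hle, by rw [H.hodo_eq_of_halfPlane hp1, hYp]⟩
  rcases hp.2.2.eq_or_lt with h | h
  · left
    have h' : p.im = 0 := h
    exact ⟨ne_zero_of_halfPlane hp1, by rintro rfl; simp at hp1, by linarith, h'.ge⟩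
  · right
    exact ⟨hp1, h, by rwa [hYp]⟩

/-- The hodograph map is proper over `quarterClosed`. -/
theorem exists_limit (H : IsHodographExt θ us Z Y) {𝒰 : Ultrafilter ℂ}
    (hD : quadrant ∪ extDomain (alpha θ) Y ∈ 𝒰) {z : ℂ}
    (hz : z ∈ quarterClosed (alpha θ) (beta θ)) (hlim : Tendsto (hodo Z Y) 𝒰 (𝓝 z)) :
    ∃ p ∈ quadrant ∪ extDomain (alpha θ) Y, (𝒰 : Filter ℂ) ≤ 𝓝 p ∧ hodo Z Y p = z := by
  rcases Ultrafilter.union_mem_iff.1 hD with h | h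
  · obtain ⟨p, h1, h2⟩ := H.exists_limit_of_quadrant h hz hlim
    exact ⟨p, Or.inl h1, h2⟩
  · exact H.exists_limit_of_extDomain h hz hlim

/-- The derivative of the holomorphic map never vanishes, so it is locally open. -/
theorem isOpen_image (H : IsHodographExt θ us Z Y) (a : ℝ) :
    IsOpen (hodo Z Y '' interiorDomain a Y) := by
  rw [isOpen_iff_mem_nhds]
  rintro _ ⟨p, hp, rfl⟩
  have hO := H.isOpen_interiorDomain a
  have hdiff : DifferentiableOn ℂ (hodo Z Y) (interiorDomain a Y) := fun q hq =>
    (H.hasDerivAt_hodo hq).choose_spec.2.differentiableAt.differentiableWithinAt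
  have han := (hdiff.analyticOnNhd hO) p hp
  obtain ⟨d, hd0, hd⟩ := H.hasDerivAt_hodo hp
  have hs : HasStrictDerivAt (hodo Z Y) d p := by
    have := han.hasStrictDerivAt
    rwa [hd.deriv] at this
  rw [← hs.map_nhds_eq hd0]
  exact image_mem_map (hO.mem_nhds hp)

/-- Properness makes the open image relatively closed in a connected set that it meets. Limit
preimages cannot sit on the edges, because edges do not map into the open quarter. -/
theorem quarterOpen_subset_image (H : IsHodographExt θ us Z Y) :
    quarterOpen (alpha θ) (beta θ) ⊆ hodo Z Y '' interiorDomain (alpha θ) Y := by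
  refine (isPreconnected_quarterOpen H.alpha_pos (beta_pos H.one_lt)).subset_of_closure_inter_subset
    (H.isOpen_image _) ?_ ?_
  · have hI : (1 + I : ℂ) ∈ interiorDomain (alpha θ) Y := Or.inl (by simp)
    exact ⟨_, H.mapsTo_interiorDomain hI, mem_image_of_mem _ hI⟩
  · rintro z ⟨hzc, hz⟩
    obtain ⟨𝒱, h1, h2⟩ := mem_closure_iff_ultrafilter.1 hzc
    have hex : ∀ v ∈ hodo Z Y '' interiorDomain (alpha θ) Y,
        Function.invFunOn (hodo Z Y) (interiorDomain (alpha θ) Y) v ∈ interiorDomain (alpha θ) Y ∧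
        hodo Z Y (Function.invFunOn (hodo Z Y) (interiorDomain (alpha θ) Y) v) = v := fun v hv =>
      ⟨Function.invFunOn_mem hv, Function.invFunOn_eq hv⟩
    obtain ⟨p, hp, -, hpz⟩ := H.exists_limit
      (𝒰 := 𝒱.map (Function.invFunOn (hodo Z Y) (interiorDomain (alpha θ) Y)))
      (by
        rw [Ultrafilter.mem_map]
        filter_upwards [h1] with v hv
        exact interiorDomain_subset _ _ (hex v hv).1)
      (quarterOpen_subset_quarterClosed _ _ hz)
      (by
        rw [Ultrafilter.coe_map, tendsto_map'_iff]
        refine (tendsto_id.mono_left h2).congr' ?_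
        filter_upwards [h1] with v hv
        exact (hex v hv).2.symm)
    exact ⟨p, H.mem_interiorDomain_of_hodo_mem hp (hpz ▸ hz), hpz⟩

theorem quarterClosed_subset_image (H : IsHodographExt θ us Z Y) :
    quarterClosed (alpha θ) (beta θ) ⊆ hodo Z Y '' (quadrant ∪ extDomain (alpha θ) Y) := by
  intro z hz
  obtain ⟨𝒱, h1, h2⟩ := mem_closure_iff_ultrafilter.1
    (quarterClosed_subset_closure H.alpha_pos (beta_pos H.one_lt) hz)
  have hex : ∀ v ∈ quarterOpen (alpha θ) (beta θ),
      Function.invFunOn (hodo Z Y) (interiorDomain (alpha θ) Y) v ∈ interiorDomain (alpha θ) Y ∧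
      hodo Z Y (Function.invFunOn (hodo Z Y) (interiorDomain (alpha θ) Y) v) = v := fun v hv =>
    ⟨Function.invFunOn_mem (H.quarterOpen_subset_image hv),
      Function.invFunOn_eq (H.quarterOpen_subset_image hv)⟩
  obtain ⟨p, hp, -, hpz⟩ := H.exists_limit
    (𝒰 := 𝒱.map (Function.invFunOn (hodo Z Y) (interiorDomain (alpha θ) Y)))
    (by
      rw [Ultrafilter.mem_map]
      filter_upwards [h1] with v hv
      exact interiorDomain_subset _ _ (hex v hv).1)
    hz
    (by
      rw [Ultrafilter.coe_map, tendsto_map'_iff]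
      refine (tendsto_id.mono_left h2).congr' ?_
      filter_upwards [h1] with v hv
      exact (hex v hv).2.symm)
  exact ⟨p, hp, hpz⟩

/-- The inverse of the hodograph map, continuous up to the boundary of the quarter. -/
theorem exists_inverse (H : IsHodographExt θ us Z Y) :
    ∃ P : ℂ → ℂ, (∀ z ∈ quarterClosed (alpha θ) (beta θ),
        P z ∈ quadrant ∪ extDomain (alpha θ) Y ∧ hodo Z Y (P z) = z) ∧
      ContinuousOn P (quarterClosed (alpha θ) (beta θ)) ∧
      ∀ z ∈ quarterOpen (alpha θ) (beta θ), DifferentiableAt ℂ P z := by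
  set D := quadrant ∪ extDomain (alpha θ) Y with hDdef
  have hinv : ∀ z ∈ quarterClosed (alpha θ) (beta θ), Function.invFunOn (hodo Z Y) D z ∈ D ∧
      hodo Z Y (Function.invFunOn (hodo Z Y) D z) = z := fun z hz =>
    ⟨Function.invFunOn_mem (H.quarterClosed_subset_image hz),
      Function.invFunOn_eq (H.quarterClosed_subset_image hz)⟩
  have hcont : ContinuousOn (Function.invFunOn (hodo Z Y) D)
      (quarterClosed (alpha θ) (beta θ)) := by
    intro z hz
    rw [ContinuousWithinAt, tendsto_iff_ultrafilter]
    intro 𝒱 h𝒱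
    have hmem : quarterClosed (alpha θ) (beta θ) ∈ 𝒱 := h𝒱 self_mem_nhdsWithin
    obtain ⟨p, hp, hle, hpz⟩ := H.exists_limit
      (𝒰 := 𝒱.map (Function.invFunOn (hodo Z Y) D))
      (by
        rw [Ultrafilter.mem_map]
        filter_upwards [hmem] with v hv
        exact (hinv v hv).1)
      hz
      (by
        rw [Ultrafilter.coe_map, tendsto_map'_iff]
        refine (tendsto_id.mono_left (h𝒱.trans nhdsWithin_le_nhds)).congr' ?_
        filter_upwards [hmem] with v hv
        exact (hinv v hv).2.symm)
    -- Every ultrafilter limit of preimages is a preimage of `z`; injectivity identifies it, which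
    -- is continuity of the inverse.
    have e : p = Function.invFunOn (hodo Z Y) D z :=
      H.injOn_hodo hp (hinv z hz).1 (by rw [hpz, (hinv z hz).2])
    rw [← e]
    exact hle
  refine ⟨_, hinv, hcont, fun z hz => ?_⟩
  have hzc := quarterOpen_subset_quarterClosed _ _ hz
  have hnhds : quarterOpen (alpha θ) (beta θ) ∈ 𝓝 z := (isOpen_quarterOpen _ _).mem_nhds hz
  have hpD := H.mem_interiorDomain_of_hodo_mem (hinv z hzc).1 ((hinv z hzc).2.symm ▸ hz)
  obtain ⟨d, hd0, hd⟩ := H.hasDerivAt_hodo hpD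
  refine (HasDerivAt.of_local_left_inverse ?_ hd hd0 ?_).differentiableAt
  · exact (hcont z hzc).continuousAt
      (mem_of_superset hnhds (quarterOpen_subset_quarterClosed _ _))
  · filter_upwards [hnhds] with v hv
    exact (hinv v (quarterOpen_subset_quarterClosed _ _ hv)).2

end IsHodographExt

/-! ### The solitary wave on the real line -/

theorem hasDerivAt_f (θ u : ℝ) : HasDerivAt (f θ) (θ * (2 * u / (1 + u ^ 2)) - 2 * u) u := by
  have h1 : HasDerivAt (fun u : ℝ => 1 + u ^ 2) (2 * u) u := by
    simpa using (hasDerivAt_pow 2 u).const_add 1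
  have h2 : HasDerivAt (fun u : ℝ => u ^ 2) (2 * u) u := by simpa using hasDerivAt_pow 2 u
  exact ((h1.log (by positivity)).const_mul θ).sub h2

namespace IsSolitaryWave

variable {θ : ℝ} {U : ℝ → ℝ}

theorem hasDerivAt (hU : IsSolitaryWave θ U) (x : ℝ) : HasDerivAt U (deriv U x) x :=
  (hU.contDiff.differentiable (by norm_num) x).hasDerivAt

theorem hasDerivAt_deriv (hU : IsSolitaryWave θ U) (x : ℝ) :
    HasDerivAt (deriv U) (deriv (deriv U) x) x :=
  (((contDiff_succ_iff_deriv (n := 1)).1 hU.contDiff).2.2.differentiable (by norm_num) x).hasDerivAt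

theorem deriv_sq_sub_eq (hU : IsSolitaryWave θ U) (x : ℝ) :
    deriv U x ^ 2 - f θ (U x) = deriv U 0 ^ 2 - f θ (U 0) := by
  have h : ∀ x, HasDerivAt (fun x => deriv U x ^ 2 - f θ (U x)) 0 x := by
    intro x
    have h1 := ((hU.hasDerivAt_deriv x).pow 2).sub
      ((hasDerivAt_f θ (U x)).comp x (hU.hasDerivAt x))
    refine h1.congr_deriv ?_
    have h2 := hU.ode x
    have h3 : deriv (deriv U) x = θ * U x / (1 + U x ^ 2) - U x := by linarith
    rw [h3]; push_cast; ring
  exact is_const_of_deriv_eq_zero (fun x => (h x).differentiableAt) (fun x => (h x).deriv) x 0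

/-- The energy of the solitary wave vanishes. -/
theorem deriv_sq (hU : IsSolitaryWave θ U) (x : ℝ) : deriv U x ^ 2 = f θ (U x) := by
  set E := deriv U 0 ^ 2 - f θ (U 0) with hE
  have hcont : Continuous (f θ) :=
    continuous_iff_continuousAt.2 fun u => (hasDerivAt_f θ u).continuousAt
  have h1 : Tendsto (fun x => deriv U x ^ 2) atTop (𝓝 E) := by
    have h := ((hcont.tendsto 0).comp hU.tendsto_atTop).const_add E
    have h0 : f θ 0 = 0 := by simp [f]
    rw [h0, add_zero] at h
    refine h.congr fun x => ?_
    have := hU.deriv_sq_sub_eq x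
    simp only [Function.comp]; linarith
  -- Decay of `U` does not directly give decay of `U'`; the mean value theorem supplies points going
  -- to infinity at which `U'` tends to zero.
  have h2 : ∀ x : ℝ, ∃ c ∈ Ioo x (x + 1), deriv U c = U (x + 1) - U x := by
    intro x
    obtain ⟨c, hc, h⟩ := exists_hasDerivAt_eq_slope U (deriv U) (lt_add_one x)
      hU.contDiff.continuous.continuousOn fun y _ => hU.hasDerivAt y
    exact ⟨c, hc, by rw [h]; simp⟩
  choose c hc hcd using h2
  have hctop : Tendsto c atTop atTop := tendsto_atTop_mono (fun x => (hc x).1.le) tendsto_id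
  have h3 : Tendsto (fun x => deriv U (c x) ^ 2) atTop (𝓝 0) := by
    have h := ((hU.tendsto_atTop.comp (tendsto_atTop_add_const_right _ 1 tendsto_id)).sub
      hU.tendsto_atTop).pow 2
    simp only [sub_zero, ne_eq, OfNat.ofNat_ne_zero, not_false_eq_true, zero_pow] at h
    refine h.congr fun x => ?_
    rw [hcd]; rfl
  have h4 : E = 0 := tendsto_nhds_unique (h1.comp hctop) h3
  have := hU.deriv_sq_sub_eq x
  linarith

theorem deriv_zero (hU : IsSolitaryWave θ U) : deriv U 0 = 0 := by
  have h := deriv_comp_neg U 0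
  rw [funext hU.even, neg_zero] at h
  linarith

/-- The crest of the solitary wave is the positive root of `f`. -/
theorem f_crest (hU : IsSolitaryWave θ U) : f θ (U 0) = 0 := by
  rw [← hU.deriv_sq, hU.deriv_zero]; simp

theorem le_crest (hU : IsSolitaryWave θ U) (hθ : 1 < θ) (x : ℝ) : U x ≤ U 0 := by
  by_contra! h
  have h1 := f_neg_of_root_lt (by linarith) hU.f_crest (hU.pos 0) h
  rw [← hU.deriv_sq] at h1
  exact absurd h1 (not_lt.2 (sq_nonneg _))

theorem eq_crest_of_deriv_eq_zero (hU : IsSolitaryWave θ U) (hθ : 1 < θ) {x : ℝ}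
    (h : deriv U x = 0) : U x = U 0 := by
  refine (hU.le_crest hθ x).eq_or_lt.resolve_right fun h1 => ?_
  have h2 := f_pos_of_lt_root (by linarith) hU.f_crest (hU.pos x) h1
  rw [← hU.deriv_sq, h] at h2
  simp at h2

/-- The strict inequality `log y > 1 - 1 / y` at `y = 1 + u²` shows that the crest is not an
equilibrium of the equation. -/
theorem theta_lt_of_root {u : ℝ} (hθ : 0 < θ) (hu : 0 < u) (h : f θ u = 0) : θ < 1 + u ^ 2 := by
  have h1 : 0 < 1 + u ^ 2 := by positivity
  have h2 : Real.log (1 + u ^ 2)⁻¹ < (1 + u ^ 2)⁻¹ - 1 := by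
    refine Real.log_lt_sub_one_of_pos (by positivity) ?_
    have : 0 < u ^ 2 := by positivity
    rw [ne_eq, inv_eq_one]; linarith
  rw [Real.log_inv] at h2
  have h3 : θ * Real.log (1 + u ^ 2) = u ^ 2 := by unfold f at h; linarith
  have h4 : θ * (1 - (1 + u ^ 2)⁻¹) < u ^ 2 := by
    exact (mul_lt_mul_of_pos_left (by linarith) hθ).trans_eq h3
  have h5 : 1 - (1 + u ^ 2)⁻¹ = u ^ 2 / (1 + u ^ 2) := by field_simp; ring
  rw [h5, mul_div_assoc', div_lt_iff₀ h1] at h4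
  have : 0 < u ^ 2 := by positivity
  nlinarith

/-- A critical point has the crest value, by the energy identity. With one at `x > 0`, the minimum
over `[0, x]` is also the crest value, so `U` is constant there, but the crest height is not an
equilibrium. -/
theorem deriv_ne_zero (hU : IsSolitaryWave θ U) (hθ : 1 < θ) {x : ℝ} (hx : 0 < x) :
    deriv U x ≠ 0 := by
  intro h
  obtain ⟨m, hm, hmin⟩ := isCompact_Icc.exists_isMinOn (nonempty_Icc.2 hx.le)
    hU.contDiff.continuous.continuousOn
  have hmc : U m = U 0 := by
    rcases hm.1.eq_or_lt with h1 | h1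
    · rw [← h1]
    rcases hm.2.eq_or_lt with h2 | h2
    · rw [h2]; exact hU.eq_crest_of_deriv_eq_zero hθ h
    · exact hU.eq_crest_of_deriv_eq_zero hθ
        (hmin.isLocalMin (Icc_mem_nhds h1 h2)).deriv_eq_zero
  have hconst : ∀ y ∈ Ioo 0 x, U y = U 0 := fun y hy =>
    le_antisymm (hU.le_crest hθ y) (hmc ▸ hmin (Ioo_subset_Icc_self hy))
  have hy : x / 2 ∈ Ioo 0 x := ⟨by linarith, by linarith⟩
  have hd : ∀ y ∈ Ioo 0 x, deriv U y = 0 := fun y hy => by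
    rw [EventuallyEq.deriv_eq (f := fun _ => U 0)
      (by filter_upwards [isOpen_Ioo.mem_nhds hy] with z hz using hconst z hz)]
    simp
  have hdd : deriv (deriv U) (x / 2) = 0 := by
    rw [EventuallyEq.deriv_eq (f := fun _ => (0 : ℝ))
      (by filter_upwards [isOpen_Ioo.mem_nhds hy] with z hz using hd z hz)]
    simp
  have hode := hU.ode (x / 2)
  rw [hdd, hconst _ hy] at hode
  have hp := hU.pos 0
  have h1 : 0 < 1 + U 0 ^ 2 := by positivity
  have h2 := theta_lt_of_root (by linarith) hp hU.f_crest
  have h3 : θ * U 0 / (1 + U 0 ^ 2) < U 0 := by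
    rw [div_lt_iff₀ h1]; nlinarith
  linarith

theorem deriv_neg (hU : IsSolitaryWave θ U) (hθ : 1 < θ) {x : ℝ} (hx : 0 < x) :
    deriv U x < 0 := by
  have h := hasDerivWithinAt_forall_lt_or_forall_gt_of_forall_ne (m := 0) (convex_Ioi (0 : ℝ))
    (fun y _ => (hU.hasDerivAt y).hasDerivWithinAt) fun y hy => hU.deriv_ne_zero hθ hy
  rcases h with h | h
  · exact h x hx
  · exfalso
    have hmono : StrictMonoOn U (Ici 0) := by
      refine strictMonoOn_of_deriv_pos (convex_Ici 0) hU.contDiff.continuous.continuousOn ?_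
      rw [interior_Ici]; exact h
    have h1 := hmono self_mem_Ici hx.le hx
    exact absurd (hU.le_crest hθ x) (not_le.2 h1)

theorem lt_crest (hU : IsSolitaryWave θ U) (hθ : 1 < θ) {x : ℝ} (hx : 0 < x) : U x < U 0 := by
  refine lt_of_le_of_ne (hU.le_crest hθ x) fun h => ?_
  have h1 := hU.deriv_sq x
  rw [h, hU.f_crest] at h1
  exact hU.deriv_ne_zero hθ hx (pow_eq_zero_iff two_ne_zero |>.1 h1)

theorem deriv_eq (hU : IsSolitaryWave θ U) (hθ : 1 < θ) {x : ℝ} (hx : 0 < x) :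
    deriv U x = -√(f θ (U x)) := by
  rw [← hU.deriv_sq, Real.sqrt_sq_eq_abs, abs_of_neg (hU.deriv_neg hθ hx), neg_neg]

/-- The hodograph map inverts the solitary wave. -/
theorem hodograph_eq (hU : IsSolitaryWave θ U) {Z : ℂ → ℂ} (H : IsHodograph θ (U 0) Z) {x : ℝ}
    (hx : 0 ≤ x) : Z (-Real.log (U x) : ℝ) = x := by
  have hθ := H.one_lt
  have hc : ContinuousOn (fun x => Z (-Real.log (U x) : ℝ)) (Icc 0 x) :=
    (H.continuousOn_bottom_log.comp_continuous hU.contDiff.continuous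
      fun x => hU.pos x).continuousOn
  have hd : ∀ y ∈ Ioo 0 x, HasDerivAt (fun x => Z (-Real.log (U x) : ℝ)) 1 y := by
    intro y hy
    have hlt := hU.lt_crest hθ hy.1
    have h := (H.hasDerivAt_bottom_log (hU.pos y) hlt.ne).scomp y (hU.hasDerivAt y)
    refine h.congr_deriv ?_
    have hf := f_pos_of_lt_root (by linarith) hU.f_crest (hU.pos y) hlt
    rw [sqrt_ofReal_pos hf.le, hU.deriv_eq hθ hy.1, real_smul]
    have : ((√(f θ (U y)) : ℝ) : ℂ) ≠ 0 := ofReal_ne_zero.2 (Real.sqrt_pos.2 hf).ne'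
    push_cast
    field_simp
  have h := intervalIntegral.integral_eq_sub_of_hasDerivAt_of_le hx hc hd
    intervalIntegrable_const
  simp only [intervalIntegral.integral_const, H.crest, sub_zero, real_smul, mul_one] at h
  exact h.symm

end IsSolitaryWave

/-! ### Extension to the quarter and reflections -/

/-- `G` continues `U` from the positive half-line to the quarter `quarterClosed a b` of the cut
strip, with boundary values that allow for reflections. -/
structure IsQuarterExt (a b : ℝ) (U : ℝ → ℝ) (G : ℂ → ℂ) : Prop where
  continuousOn : ContinuousOn G (quarterClosed a b)
  differentiableAt : ∀ z ∈ quarterOpen a b, DifferentiableAt ℂ G z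
  ofReal : ∀ x : ℝ, 0 ≤ x → G x = U x
  im_eq_zero : ∀ z : ℂ, z.re = 0 → 0 ≤ z.im → (G z).im = 0
  re_eq_zero : ∀ z : ℂ, a < z.re → z.im = b → (G z).re = 0
  decay : ∀ ε : ℝ, 0 < ε → ∃ R, ∀ z ∈ quarterClosed a b, R < z.re → ‖G z‖ < ε

theorem exists_isQuarterExt {θ : ℝ} {U : ℝ → ℝ} {Z Y : ℂ → ℂ} (hU : IsSolitaryWave θ U)
    (H : IsHodographExt θ (U 0) Z Y) : ∃ G, IsQuarterExt (alpha θ) (beta θ) U G := by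
  have ha : 0 < alpha θ := H.alpha_pos
  have hb : 0 < beta θ := beta_pos H.one_lt
  obtain ⟨P, hP, hPc, hPd⟩ := H.exists_inverse
  refine ⟨fun z => -I * P z, continuousOn_const.mul hPc, fun z hz => (hPd z hz).const_mul _,
    fun x hx => ?_, fun z hz hz' => ?_, fun z hz hz' => ?_, fun ε hε => ?_⟩
  · have hmem : (x : ℂ) ∈ quarterClosed (alpha θ) (beta θ) := by
      refine ⟨by simpa using hx, by simp, Or.inr (Or.inl (by simpa using hb))⟩
    have hp : I * (U x : ℂ) ∈ quadrant := by
      have h1 := hU.pos x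
      refine ⟨mul_ne_zero I_ne_zero (ofReal_ne_zero.2 h1.ne'), fun h => ?_, by simp,
        by simpa using h1.le⟩
      have := congrArg re h
      simp at this
    have he : hodo Z Y (I * (U x : ℂ)) = x := by
      rw [IsHodographExt.hodo_of_re_zero (by simp) (by simpa using hU.pos x)]
      simpa using hU.hodograph_eq H.toIsHodograph hx
    -- `i U x` is a preimage of `x` by the real hodograph identity, so injectivity makes it the
    -- chosen one.
    have h := H.injOn_hodo (hP _ hmem).1 (Or.inl hp) ((hP _ hmem).2.trans he.symm)
    simp only [h]
    linear_combination (-(U x : ℂ)) * I_sq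
  · obtain ⟨h1, h2⟩ := hP z ⟨hz.ge, hz', Or.inl (by rwa [hz])⟩
    -- Only the edge `Re p = 0` can map to the imaginary axis: the interior has `Re z > 0`, and the
    -- edge `0 < p < 1` has `Re z > α`.
    rcases H.cases_of_mem h1 with h | ⟨h, _⟩ | ⟨h, h3, h4⟩
    · have h3 := H.mapsTo_interiorDomain h
      rw [h2] at h3
      exact absurd hz h3.1.ne'
    · simp [h]
    · rw [IsHodographExt.hodo_of_im_zero h3 h] at h2
      have h5 := H.alpha_lt_top (x := -Real.log (P z).re) (by linarith [Real.log_neg h3 h4])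
      rw [h2, hz] at h5
      exact absurd h5 (not_lt.2 ha.le)
  · have hre : 0 < z.re := ha.trans hz
    obtain ⟨h1, h2⟩ := hP z ⟨hre.le, hz' ▸ hb.le, Or.inr (Or.inr ⟨hz, hz'⟩)⟩
    rcases H.cases_of_mem h1 with h | ⟨h, h3⟩ | ⟨h, h3, h4⟩
    · have h3 := H.mapsTo_interiorDomain h
      rw [h2] at h3
      rcases h3.2.2 with h4 | h4 <;> linarith
    · rw [IsHodographExt.hodo_of_re_zero h h3] at h2
      rcases le_total (-Real.log (P z).im) (-Real.log (U 0)) with h4 | h4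
      · have := H.bottom_left_re h4
        rw [h2] at this; linarith
      · have := H.bottom_right_im h4
        rw [h2] at this; linarith
    · simp [h]
  -- Past `α` the continued piece is excluded. In the strip, `Re Z` is at most its top value, so the
  -- second bound forces `Re w > -log ε`, that is `|u| < ε`.
  · refine ⟨max (alpha θ) (Z ((-Real.log ε : ℝ) + (Real.pi / 2 : ℝ) * I)).re, fun z hz hR => ?_⟩
    obtain ⟨h1, h2⟩ := hP z hz
    rcases h1 with h1 | ⟨_, h3, h4⟩
    · rw [IsHodographExt.hodo_eq_of_im_nonneg h1.2.2.2] at h2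
      have hw := stripCoord_mem_closedStrip h1.2.2.1 h1.2.2.2
      have hlt : -Real.log ε < (stripCoord (P z)).re := by
        refine H.strictMono_top_re.lt_iff_lt.1 ?_
        have := (H.le_top_of_mem hw).1
        rw [h2] at this
        exact ((le_max_right _ _).trans_lt hR).trans_le this
      rw [← exp_neg_stripCoord h1.1, norm_exp, neg_re, ← Real.lt_log_iff_exp_lt hε]
      linarith
    · rw [IsHodographExt.hodo_eq_of_im_neg h3] at h2
      rw [h2] at h4
      exact absurd h4 (not_lt.2 ((le_max_left _ _).trans hR.le))

theorem continuousOn_of_isClosed_cover {F : ℂ → ℂ} {D A B : Set ℂ} (hA : IsClosed A)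
    (hB : IsClosed B) (hAB : ∀ z, z ∈ A ∨ z ∈ B) (h1 : ContinuousOn F (D ∩ A))
    (h2 : ContinuousOn F (D ∩ B)) : ContinuousOn F D := by
  have key : ∀ C : Set ℂ, IsClosed C → ContinuousOn F (D ∩ C) → ∀ z ∈ D,
      ContinuousWithinAt F (D ∩ C) z := by
    intro C hC h z hz
    by_cases hzC : z ∈ C
    · exact h z ⟨hz, hzC⟩
    · exact continuousWithinAt_of_notMem_closure fun h' =>
        hzC (hC.closure_subset_iff.2 inter_subset_right h')
  intro z hz
  refine ((key A hA h1 z hz).union (key B hB h2 z hz)).mono fun w hw => ?_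
  exact (hAB w).imp (fun h => ⟨hw, h⟩) fun h => ⟨hw, h⟩

/-- Schwarz reflection across the real axis. -/
def reflectReal (G : ℂ → ℂ) (z : ℂ) : ℂ :=
  if 0 ≤ z.im then G z else starRingEnd ℂ (G (starRingEnd ℂ z))

/-- Even extension from the right half-plane. -/
def evenExt (G : ℂ → ℂ) (z : ℂ) : ℂ := if 0 ≤ z.re then G z else G (-z)

/-- Continuation across the horizontal lines `Im z = b` with `|Re z| > a`. -/
def reflectTop (a b : ℝ) (G : ℂ → ℂ) (z : ℂ) : ℂ :=
  if a < |z.re| ∧ b < z.im then -G (z - 2 * b * I) else G z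

/-- The cross-shaped domain of the twice reflected function. -/
def crossOpen (a b : ℝ) : Set ℂ := {z | |z.re| < a ∨ |z.im| < b}

/-- `crossOpen` together with the uncut part of its horizontal edges. -/
def crossClosed (a b : ℝ) : Set ℂ := {z | |z.re| < a ∨ |z.im| < b ∨ (a < |z.re| ∧ |z.im| = b)}

theorem isOpen_crossOpen (a b : ℝ) : IsOpen (crossOpen a b) :=
  (isOpen_lt continuous_re.abs continuous_const).union
    (isOpen_lt continuous_im.abs continuous_const)

theorem crossOpen_subset (a b : ℝ) : crossOpen a b ⊆ crossClosed a b :=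
  fun _ h => h.imp_right Or.inl

theorem reflectReal_of_im_nonneg {G : ℂ → ℂ} {z : ℂ} (h : 0 ≤ z.im) : reflectReal G z = G z :=
  if_pos h

theorem evenExt_of_re_nonneg {G : ℂ → ℂ} {z : ℂ} (h : 0 ≤ z.re) : evenExt G z = G z := if_pos h

theorem reflectTop_of_im_le {a b : ℝ} {G : ℂ → ℂ} {z : ℂ} (h : z.im ≤ b) :
    reflectTop a b G z = G z := if_neg fun h' => absurd h'.2 (not_lt.2 h)

theorem reflectTop_of_re_le {a b : ℝ} {G : ℂ → ℂ} {z : ℂ} (h : |z.re| ≤ a) :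
    reflectTop a b G z = G z := if_neg fun h' => absurd h'.1 (not_lt.2 h)

theorem reflectTop_of_lt {a b : ℝ} {G : ℂ → ℂ} {z : ℂ} (h : a < |z.re|) (h' : b < z.im) :
    reflectTop a b G z = -G (z - 2 * b * I) := if_pos ⟨h, h'⟩

namespace IsQuarterExt

variable {a b : ℝ} {U : ℝ → ℝ} {G : ℂ → ℂ}

theorem reflectReal_of_im_nonpos (hG : IsQuarterExt a b U G) {z : ℂ} (hre : 0 ≤ z.re)
    (h : z.im ≤ 0) : reflectReal G z = starRingEnd ℂ (G (starRingEnd ℂ z)) := by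
  rcases h.eq_or_lt with h1 | h1
  · have e : z = (z.re : ℝ) := Complex.ext (by simp) (by simp [h1])
    rw [e, conj_ofReal, reflectReal_of_im_nonneg (by simp), hG.ofReal _ hre, conj_ofReal]
  · exact if_neg (not_le.2 h1)

theorem reflectReal_conj (hG : IsQuarterExt a b U G) {z : ℂ} (hre : 0 ≤ z.re) :
    reflectReal G (starRingEnd ℂ z) = starRingEnd ℂ (reflectReal G z) := by
  rcases le_total 0 z.im with h | h
  · rw [reflectReal_of_im_nonneg h, hG.reflectReal_of_im_nonpos (by simpa) (by simpa), conj_conj]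
  · rw [reflectReal_of_im_nonneg (by simpa), hG.reflectReal_of_im_nonpos hre h, conj_conj]

theorem mem_quarterClosed {z : ℂ} (hz : z ∈ crossClosed a b) (hre : 0 ≤ z.re) (him : 0 ≤ z.im) :
    z ∈ quarterClosed a b := by
  refine ⟨hre, him, ?_⟩
  simpa only [crossClosed, mem_ofPred_eq, abs_of_nonneg hre, abs_of_nonneg him] using hz

theorem conj_mem_crossClosed {z : ℂ} (hz : z ∈ crossClosed a b) :
    starRingEnd ℂ z ∈ crossClosed a b := by
  simpa only [crossClosed, mem_ofPred_eq, conj_re, conj_im, abs_neg] using hz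

theorem neg_mem_crossClosed {z : ℂ} (hz : z ∈ crossClosed a b) : -z ∈ crossClosed a b := by
  simpa only [crossClosed, mem_ofPred_eq, neg_re, neg_im, abs_neg] using hz

theorem continuousOn_reflectReal (hG : IsQuarterExt a b U G) :
    ContinuousOn (reflectReal G) (crossClosed a b ∩ {z | 0 ≤ z.re}) := by
  refine continuousOn_of_isClosed_cover (isClosed_le continuous_const continuous_im)
    (isClosed_le continuous_im continuous_const) (fun z => le_total 0 z.im) ?_ ?_
  · refine (hG.continuousOn.mono ?_).congr fun z hz => reflectReal_of_im_nonneg hz.2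
    exact fun z hz => mem_quarterClosed hz.1.1 hz.1.2 hz.2
  · refine ContinuousOn.congr (f := fun z => starRingEnd ℂ (G (starRingEnd ℂ z))) ?_
      fun z hz => hG.reflectReal_of_im_nonpos hz.1.2 hz.2
    refine continuous_conj.comp_continuousOn
      (hG.continuousOn.comp continuous_conj.continuousOn fun z hz => ?_)
    exact mem_quarterClosed (conj_mem_crossClosed hz.1.1) (by simpa using hz.1.2)
      (by simpa using hz.2)

theorem differentiableOn_reflectReal (hG : IsQuarterExt a b U G) :
    DifferentiableOn ℂ (reflectReal G) (crossOpen a b ∩ {z | 0 < z.re}) := by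
  refine differentiableOn_of_off_horizontal_line
    ((isOpen_crossOpen a b).inter (isOpen_lt continuous_const continuous_re)) 0
    (hG.continuousOn_reflectReal.mono fun z hz => ⟨crossOpen_subset a b hz.1, (show 0 < z.re from hz.2).le⟩) ?_
  rintro z ⟨hz, hre⟩ him
  have hre' : 0 < z.re := hre
  rcases lt_or_gt_of_ne him with h | h
  · have hq : starRingEnd ℂ z ∈ quarterOpen a b := by
      refine ⟨by simpa using hre, by simpa using h, ?_⟩
      simpa only [crossOpen, mem_ofPred_eq, abs_of_pos hre', abs_of_neg h, conj_re, conj_im] using hz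
    refine (differentiableAt_conj_conj_iff.2 (hG.differentiableAt _ hq)).congr_of_eventuallyEq ?_
    filter_upwards [(isOpen_lt continuous_im continuous_const).mem_nhds h] with w hw
    exact if_neg (not_le.2 hw)
  · have hq : z ∈ quarterOpen a b := by
      refine ⟨hre, h, ?_⟩
      simpa only [crossOpen, mem_ofPred_eq, abs_of_pos hre', abs_of_pos h] using hz
    refine (hG.differentiableAt _ hq).congr_of_eventuallyEq ?_
    filter_upwards [(isOpen_lt continuous_const continuous_im).mem_nhds h] with w hw
    exact reflectReal_of_im_nonneg (le_of_lt hw)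

/-- On the imaginary axis negation is conjugation, and the values there are real. The even extension
is therefore continuous across this axis. -/
theorem reflectReal_neg (hG : IsQuarterExt a b U G) {z : ℂ} (hz : z.re = 0) :
    reflectReal G (-z) = reflectReal G z := by
  have e : -z = starRingEnd ℂ z := Complex.ext (by simp [hz]) (by simp)
  have him : (reflectReal G z).im = 0 := by
    rcases le_total 0 z.im with h | h
    · rw [reflectReal_of_im_nonneg h, hG.im_eq_zero z hz h]
    · rw [hG.reflectReal_of_im_nonpos hz.ge h, conj_im,
        hG.im_eq_zero _ (by simpa using hz) (by simpa using h), neg_zero]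
  rw [e, hG.reflectReal_conj hz.ge, conj_eq_iff_im.2 him]

theorem evenExt_of_re_nonpos (hG : IsQuarterExt a b U G) {z : ℂ} (hz : z.re ≤ 0) :
    evenExt (reflectReal G) z = reflectReal G (-z) := by
  rcases hz.eq_or_lt with h | h
  · rw [evenExt_of_re_nonneg h.ge, hG.reflectReal_neg h]
  · exact if_neg (not_le.2 h)

theorem continuousOn_evenExt (hG : IsQuarterExt a b U G) :
    ContinuousOn (evenExt (reflectReal G)) (crossClosed a b) := by
  refine continuousOn_of_isClosed_cover (isClosed_le continuous_const continuous_re)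
    (isClosed_le continuous_re continuous_const) (fun z => le_total 0 z.re) ?_ ?_
  · exact hG.continuousOn_reflectReal.congr fun z hz => evenExt_of_re_nonneg hz.2
  · refine ContinuousOn.congr (f := fun z => reflectReal G (-z)) ?_
      fun z hz => hG.evenExt_of_re_nonpos hz.2
    exact hG.continuousOn_reflectReal.comp continuous_neg.continuousOn
      fun z hz => ⟨neg_mem_crossClosed hz.1, by simpa using hz.2⟩

theorem differentiableOn_evenExt (hG : IsQuarterExt a b U G) :
    DifferentiableOn ℂ (evenExt (reflectReal G)) (crossOpen a b) := by
  have hO : IsOpen (crossOpen a b ∩ {z | 0 < z.re}) :=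
    (isOpen_crossOpen a b).inter (isOpen_lt continuous_const continuous_re)
  refine differentiableOn_of_off_imaginary_axis (isOpen_crossOpen a b)
    (hG.continuousOn_evenExt.mono (crossOpen_subset a b)) fun z hz hre => ?_
  rcases lt_or_gt_of_ne hre with h | h
  · have hq : -z ∈ crossOpen a b ∩ {z | 0 < z.re} := by
      refine ⟨?_, by simpa using h⟩
      simpa only [crossOpen, mem_ofPred_eq, neg_re, neg_im, abs_neg] using hz
    refine DifferentiableAt.congr_of_eventuallyEq (f := fun w => reflectReal G (-w)) ?_ ?_
    · exact DifferentiableAt.fun_comp' z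
        (hG.differentiableOn_reflectReal.differentiableAt (hO.mem_nhds hq)) differentiableAt_id.neg
    · filter_upwards [(isOpen_lt continuous_re continuous_const).mem_nhds h] with w hw
      exact if_neg (not_le.2 hw)
  · refine (hG.differentiableOn_reflectReal.differentiableAt
      (hO.mem_nhds ⟨hz, h⟩)).congr_of_eventuallyEq ?_
    filter_upwards [(isOpen_lt continuous_const continuous_re).mem_nhds h] with w hw
    exact evenExt_of_re_nonneg (le_of_lt hw)

theorem evenExt_decay (hG : IsQuarterExt a b U G) {ε : ℝ} (hε : 0 < ε) :
    ∃ R, ∀ z : ℂ, R < |z.re| → |z.im| ≤ b → ‖evenExt (reflectReal G) z‖ < ε := by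
  obtain ⟨R, hR⟩ := hG.decay ε hε
  have h1 : ∀ z : ℂ, max a R < z.re → 0 ≤ z.re → |z.im| ≤ b → ‖reflectReal G z‖ < ε := by
    intro z hz h0 him
    have ha := (le_max_left a R).trans_lt hz
    have hmem : z ∈ crossClosed a b := by
      rcases him.lt_or_eq with h | h
      · exact Or.inr (Or.inl h)
      · exact Or.inr (Or.inr ⟨ha.trans_le (le_abs_self _), h⟩)
    rcases le_total 0 z.im with h | h
    · rw [reflectReal_of_im_nonneg h]
      exact hR z (mem_quarterClosed hmem h0 h) ((le_max_right a R).trans_lt hz)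
    · rw [hG.reflectReal_of_im_nonpos h0 h, norm_conj]
      exact hR _ (mem_quarterClosed (conj_mem_crossClosed hmem) (by simpa) (by simpa))
        (by simpa using (le_max_right a R).trans_lt hz)
  refine ⟨max a R, fun z hz him => ?_⟩
  rcases le_total 0 z.re with h | h
  · rw [evenExt_of_re_nonneg h]
    rw [abs_of_nonneg h] at hz
    exact h1 z hz h him
  · rw [hG.evenExt_of_re_nonpos h]
    rw [abs_of_nonpos h] at hz
    exact h1 (-z) (by simpa using hz) (by simpa using h) (by simpa using him)

/-- On the horizontal edges the reflected function is purely imaginary. -/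
theorem evenExt_sub (hG : IsQuarterExt a b U G) (ha : 0 < a) (hb : 0 < b) {z : ℂ}
    (hre : a < |z.re|) (him : z.im = b) :
    -evenExt (reflectReal G) (z - 2 * b * I) = evenExt (reflectReal G) z := by
  have key : ∀ w : ℂ, a < w.re → w.im = b →
      reflectReal G (starRingEnd ℂ w) = -reflectReal G w := by
    intro w hw hw'
    rw [hG.reflectReal_conj (ha.trans hw).le, reflectReal_of_im_nonneg (hw' ▸ hb.le)]
    have := hG.re_eq_zero w hw hw'
    exact Complex.ext (by simp [this]) (by simp)
  -- On `Im z = b` the shift is conjugation, and conjugating a purely imaginary value negates it.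
  have e : z - 2 * b * I = starRingEnd ℂ z :=
    Complex.ext (by simp) (by simp [him]; ring)
  rw [e]
  rcases le_total 0 z.re with h | h
  · rw [abs_of_nonneg h] at hre
    rw [evenExt_of_re_nonneg (by simpa using h), evenExt_of_re_nonneg h, key z hre him, neg_neg]
  · rw [abs_of_nonpos h] at hre
    have h2 := key (starRingEnd ℂ (-z)) (by simpa using hre) (by simpa using him)
    rw [conj_conj, map_neg] at h2
    rw [hG.evenExt_of_re_nonpos (by simpa using h), hG.evenExt_of_re_nonpos h, h2]

/-- The two definitions agree on the seam `Im z = b` by `evenExt_sub`, and the Morera argument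
removes it. The region extends past `Im z = 2b`, as analyticity on the closed upper edge requires.
-/
theorem differentiableOn_reflectTop (hG : IsQuarterExt a b U G) (ha : 0 < a) (hb : 0 < b) :
    DifferentiableOn ℂ (reflectTop a b (evenExt (reflectReal G)))
      {z | a < |z.re| ∧ -b < z.im ∧ z.im < 3 * b} := by
  have hO : IsOpen {z : ℂ | a < |z.re| ∧ -b < z.im ∧ z.im < 3 * b} :=
    (isOpen_lt continuous_const continuous_re.abs).inter
      ((isOpen_lt continuous_const continuous_im).inter (isOpen_lt continuous_im continuous_const))
  have hsub : ContinuousOn (fun z : ℂ => z - 2 * b * I) univ := by fun_prop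
  have him2 : ∀ z : ℂ, (z - 2 * b * I).im = z.im - 2 * b := fun z => by simp
  have hre2 : ∀ z : ℂ, (z - 2 * b * I).re = z.re := fun z => by simp
  have hmem : ∀ z : ℂ, a < |z.re| → |z.im| ≤ b → z ∈ crossClosed a b := fun z h1 h2 =>
    Or.inr (h2.lt_or_eq.imp id fun h => ⟨h1, h⟩)
  refine differentiableOn_of_off_horizontal_line hO b ?_ ?_
  · refine continuousOn_of_isClosed_cover (isClosed_le continuous_im continuous_const)
      (isClosed_le continuous_const continuous_im) (fun z => le_total z.im b) ?_ ?_
    · refine (hG.continuousOn_evenExt.mono ?_).congr fun z hz => reflectTop_of_im_le hz.2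
      rintro z ⟨⟨h1, h2, _⟩, h3⟩
      exact hmem z h1 (abs_le.2 ⟨h2.le, h3⟩)
    · refine ContinuousOn.congr
        (f := fun z : ℂ => -evenExt (reflectReal G) (z - 2 * b * I)) ?_ ?_
      · refine (hG.continuousOn_evenExt.comp (hsub.mono (subset_univ _)) ?_).neg
        rintro z ⟨⟨h1, h2, h3⟩, h4⟩
        have h4' : b ≤ z.im := h4
        refine hmem _ (by rwa [hre2]) ?_
        rw [him2, abs_le]; constructor <;> linarith
      · rintro z ⟨⟨h1, h2, h3⟩, h4⟩
        have h4' : b ≤ z.im := h4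
        rcases h4'.eq_or_lt with h | h
        · rw [reflectTop_of_im_le h.ge]
          exact (hG.evenExt_sub ha hb h1 h.symm).symm
        · exact reflectTop_of_lt h1 h
  · rintro z ⟨h1, h2, h3⟩ hne
    rcases lt_or_gt_of_ne hne with h | h
    · have hz : z ∈ crossOpen a b := Or.inr (abs_lt.2 ⟨h2, h⟩)
      refine (hG.differentiableOn_evenExt.differentiableAt
        ((isOpen_crossOpen a b).mem_nhds hz)).congr_of_eventuallyEq ?_
      filter_upwards [(isOpen_lt continuous_im continuous_const).mem_nhds h] with w hw
      exact reflectTop_of_im_le (le_of_lt hw)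
    · have hz : z - 2 * b * I ∈ crossOpen a b := by
        right; rw [him2, abs_lt]; constructor <;> linarith
      refine DifferentiableAt.congr_of_eventuallyEq
        (f := fun z : ℂ => -evenExt (reflectReal G) (z - 2 * b * I)) ?_ ?_
      · refine DifferentiableAt.neg (DifferentiableAt.fun_comp' z
          (hG.differentiableOn_evenExt.differentiableAt ((isOpen_crossOpen a b).mem_nhds hz)) ?_)
        fun_prop
      · filter_upwards [(isOpen_lt continuous_const continuous_re.abs).mem_nhds h1,
          (isOpen_lt continuous_const continuous_im).mem_nhds h] with w hw hw'
        exact reflectTop_of_lt hw hw'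

theorem analyticOnNhd_reflectTop (hG : IsQuarterExt a b U G) (ha : 0 < a) (hb : 0 < b) :
    AnalyticOnNhd ℂ (reflectTop a b (evenExt (reflectReal G))) (cutStrip a b) := by
  have hcross : ∀ z ∈ crossOpen a b, ∀ O : Set ℂ, IsOpen O → z ∈ O →
      (∀ w ∈ O, reflectTop a b (evenExt (reflectReal G)) w = evenExt (reflectReal G) w) →
      AnalyticAt ℂ (reflectTop a b (evenExt (reflectReal G))) z := by
    intro z hz O hO hzO h
    refine (hG.differentiableOn_evenExt.analyticAt ((isOpen_crossOpen a b).mem_nhds hz)).congr ?_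
    filter_upwards [hO.mem_nhds hzO] with w hw using (h w hw).symm
  rintro z ⟨⟨h1, h2⟩, hcut⟩
  rcases lt_trichotomy |z.re| a with h | h | h
  · exact hcross z (Or.inl h) _ (isOpen_lt continuous_re.abs continuous_const) h
      fun w hw => reflectTop_of_re_le (le_of_lt hw)
  -- On the vertical lines through the cuts, only points below the cuts belong to the domain, and
  -- there no top reflection is made.
  · have him : z.im < b := by
      by_contra! h3
      refine hcut ?_
      rcases eq_or_eq_neg_of_abs_eq h with h4 | h4
      · exact Or.inr ⟨h4, h3, h2⟩
      · exact Or.inl ⟨h4, h3, h2⟩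
    exact hcross z (Or.inr (abs_lt.2 ⟨by linarith, him⟩)) _
      (isOpen_lt continuous_im continuous_const) him fun w hw => reflectTop_of_im_le (le_of_lt hw)
  · refine (hG.differentiableOn_reflectTop ha hb).analyticAt (IsOpen.mem_nhds ?_ ?_)
    · exact (isOpen_lt continuous_const continuous_re.abs).inter
        ((isOpen_lt continuous_const continuous_im).inter
          (isOpen_lt continuous_im continuous_const))
    · exact ⟨h, by linarith, by linarith⟩

theorem reflectTop_ofReal (hG : IsQuarterExt a b U G) (hb : 0 < b) (heven : ∀ x, U (-x) = U x)
    (x : ℝ) : reflectTop a b (evenExt (reflectReal G)) x = U x := by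
  rw [reflectTop_of_im_le (by simpa using hb.le)]
  rcases le_total 0 x with h | h
  · rw [evenExt_of_re_nonneg (by simpa using h), reflectReal_of_im_nonneg (by simp),
      hG.ofReal x h]
  · rw [hG.evenExt_of_re_nonpos (by simpa using h), ← ofReal_neg,
      reflectReal_of_im_nonneg (by simp), hG.ofReal _ (by linarith), heven]

theorem reflectTop_decay (hG : IsQuarterExt a b U G) {ε : ℝ} (hε : 0 < ε) :
    ∃ R, ∀ z : ℂ, R < |z.re| → 0 ≤ z.im → z.im ≤ 2 * b →
      ‖reflectTop a b (evenExt (reflectReal G)) z‖ < ε := by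
  obtain ⟨R, hR⟩ := hG.evenExt_decay hε
  refine ⟨max a R, fun z hz h1 h2 => ?_⟩
  have h3 := (le_max_left a R).trans_lt hz
  have h4 := (le_max_right a R).trans_lt hz
  rcases le_or_gt z.im b with h | h
  · rw [reflectTop_of_im_le h]
    exact hR z h4 (by rwa [abs_of_nonneg h1])
  · rw [reflectTop_of_lt h3 h, norm_neg]
    refine hR _ (by simpa using h4) ?_
    have : (z - 2 * b * I).im = z.im - 2 * b := by simp
    rw [this, abs_le]; constructor <;> linarith

theorem tendsto_reflectTop (hG : IsQuarterExt a b U G) {y : ℝ} (hy : 0 ≤ y) (hy' : y ≤ 2 * b)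
    {l : Filter ℝ} (hl : Tendsto (fun x : ℝ => |x|) l atTop) :
    Tendsto (fun R : ℝ => reflectTop a b (evenExt (reflectReal G)) (R + y * I)) l (𝓝 0) := by
  rw [Metric.tendsto_nhds]
  intro ε hε
  obtain ⟨R, hR⟩ := hG.reflectTop_decay hε
  filter_upwards [hl.eventually_gt_atTop R] with x hx
  rw [dist_zero_right]
  exact hR _ (by simpa using hx) (by simpa using hy) (by simpa using hy')

theorem reflectTop_add (hb : 0 < b) {x : ℝ} (hx : a < |x|) :
    reflectTop a b (evenExt (reflectReal G)) (x + 2 * b * I) =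
      -reflectTop a b (evenExt (reflectReal G)) x := by
  rw [reflectTop_of_lt (by simpa using hx) (by simp; linarith),
    reflectTop_of_im_le (by simpa using hb.le), add_sub_cancel_right]

end IsQuarterExt

end

end SaturableNLS

/-! ### Assembly -/

/-- `V` is the analytic continuation; analyticity on the set `cutStrip` means analyticity in a
complex neighbourhood of each of its points, those with `Im z = 0` and `Im z = 2β` included. -/
theorem corollary2p3 (θ : ℝ) (hθ : 1 < θ) (U : ℝ → ℝ)
    (hU : SaturableNLS.IsSolitaryWave θ U) :
    ((SaturableNLS.alpha θ : ℂ) = SaturableNLS.J₁ θ + SaturableNLS.J₂ θ ∧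
      0 < SaturableNLS.alpha θ) ∧
    ∃ V : ℂ → ℂ,
      AnalyticOnNhd ℂ V
        (SaturableNLS.cutStrip (SaturableNLS.alpha θ) (SaturableNLS.beta θ)) ∧
      (∀ x : ℝ, V (x : ℂ) = (U x : ℂ)) ∧
      (∀ y : ℝ, 0 ≤ y → y ≤ 2 * SaturableNLS.beta θ →
        Tendsto (fun R : ℝ => V ((R : ℂ) + (y : ℂ) * Complex.I)) atTop (𝓝 0) ∧
        Tendsto (fun R : ℝ => V ((R : ℂ) + (y : ℂ) * Complex.I)) atBot (𝓝 0)) ∧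
      (∀ x : ℝ, x < -SaturableNLS.alpha θ ∨ SaturableNLS.alpha θ < x →
        V ((x : ℂ) + 2 * (SaturableNLS.beta θ : ℂ) * Complex.I) = -V (x : ℂ)) := by
  obtain ⟨Z, hZ⟩ := SaturableNLS.exists_isHodograph hθ (hU.pos 0) hU.f_crest
  obtain ⟨Y, hY⟩ := SaturableNLS.exists_isHodographExt hZ
  obtain ⟨G, hG⟩ := SaturableNLS.exists_isQuarterExt hU hY
  have ha := hZ.alpha_pos
  have hb := SaturableNLS.beta_pos hθ
  refine ⟨⟨by rw [hZ.alpha_eq, hZ.J₁_add_J₂], ha⟩, _, hG.analyticOnNhd_reflectTop ha hb,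
    hG.reflectTop_ofReal hb hU.even, fun y hy hy' => ?_, fun x hx => ?_⟩
  · exact ⟨hG.tendsto_reflectTop hy hy' tendsto_abs_atTop_atTop,
      hG.tendsto_reflectTop hy hy' tendsto_abs_atBot_atTop⟩
  · refine SaturableNLS.IsQuarterExt.reflectTop_add hb (lt_abs.2 ?_)
    exact hx.symm.imp id fun h => by linarith
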